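/- Let $k$ be an algebraically closed field of characteristic $p>2$, and let $G=\mathrm{SL}_2(p)=\mathrm{SL}_2(\mathbb F_p)$. Terminology. A $G$-Galois cover of $\mathbb P^1_k$ is a finite surjective morphism $f:Y\to\mathbb P^1_k$ from a (not necessarily connected) complete nonsingular curve $Y$, with an action of $G$ on $Y$ over $\mathbb P^1_k$, which over a dense open subset $U$ of $\mathbb P^1_k$ is étale with $G$ acting simply transitively on the fibres over the closed points of $U$. For a closed point $y\in Y$ with maximal ideal $\mathfrak m_y\subset\mathcal O_{Y,y}$ and $i\ge 0$, the ramification group $G_{y,i}$ is the group of all $g\in G$ that fix $y$ and act trivially on $\mathcal O_{Y,y}/\mathfrak m_y^{i+1}$; the inertia group of $y$ is $G_{y,0}$; the cover is branched at a closed point $x\in\mathbb P^1_k$ if the inertia groups of the points above $x$ are nontrivial. The cover is a $G$-tail cover if it is wildly branched at $\infty$, with inertia groups of order $pn$ with $n$ prime to $p$, and tamely branched at no more than one other point. It is primitive if it is branched at exactly two points, and new otherwise. Its ramification invariant is $\sigma=h/n$, where the conductor $h$ is the largest $i$ such that $G_{y,i}\neq 1$, for a point $y$ above $\infty$. Statement.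 Let $Y_k$ be the complete nonsingular curve over $k$ with affine equation $y^{p+1}=x^p-x$, on which $G$ acts by $$A x=\frac{ax+b}{cx+d},\qquad A y=\frac{y}{cx+d},\qquad A=\begin{pmatrix}a&b\\c&d\end{pmatrix}\in \mathrm{SL}_2(p)$$ (that is, $Ax$ and $Ay$ are the pull-backs of the functions $x$ and $y$ under the action of $A$ on $Y_k$). Then there is a morphism $h:Y_k\to\mathbb P^1_k$ which, with this action, is a connected new $\mathrm{SL}_2(p)$-tail cover. It is branched exactly at $\infty$, the inertia group of every point above $\infty$ has order $p(p-1)$, and the ramification invariant is $\sigma=(p+1)/(p-1)$. -/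

import Mathlib

open AlgebraicGeometry CategoryTheory

universe u v

namespace TailCover

noncomputable section

section ProjectiveLine

attribute [local instance] MvPolynomial.gradedAlgebra

variable (k : Type u) [Field k]

/-- The projective line `Proj k[X₀, X₁]` over the field `k`. -/
abbrev P1 : Scheme.{u} :=
  Proj (MvPolynomial.homogeneousSubmodule (Fin 2) k)

/-- The structure morphism of the projective line over `k`. -/
def P1.toSpec : P1 k ⟶ Spec (CommRingCat.of k) :=
  Proj.toSpecZero (MvPolynomial.homogeneousSubmodule (Fin 2) k) ≫
    Spec.map (CommRingCat.ofHom
      (algebraMap k (MvPolynomial.homogeneousSubmodule (Fin 2) k 0)))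

/-- The point `∞ = [1 : 0]` of the projective line, that is, the homogeneous prime
ideal generated by the second coordinate. -/
def P1.infty : P1 k where
  asHomogeneousIdeal :=
    ⟨Ideal.span {MvPolynomial.X 1}, Ideal.homogeneous_span _ _ (by
      rintro _ rfl
      exact ⟨1, MvPolynomial.isHomogeneous_X k 1⟩)⟩
  isPrime := by
    refine (Ideal.span_singleton_prime (MvPolynomial.X_ne_zero 1)).2 ?_
    exact MvPolynomial.X_prime
  not_irrelevant_le := by
    intro h
    have h0 : (MvPolynomial.X 0 : MvPolynomial (Fin 2) k) ∈
        HomogeneousIdeal.irrelevant (MvPolynomial.homogeneousSubmodule (Fin 2) k) := by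
      rw [HomogeneousIdeal.mem_irrelevant_iff]
      exact DirectSum.decompose_of_mem_ne _
        ((MvPolynomial.mem_homogeneousSubmodule 1 _).2
          (MvPolynomial.isHomogeneous_X k (0 : Fin 2))) one_ne_zero
    have h1 := Ideal.mem_span_singleton.1 (h h0)
    exact absurd ((MvPolynomial.X_dvd_X).1 h1) (by simp)

variable {k}

/-- The embedding of the constants `k` in the local ring at `y` of a scheme over the
projective line. -/
def const (Y : Over (P1 k)) (y : Y.left) : k →+* Y.left.presheaf.stalk y :=
  ((Scheme.ΓSpecIso (CommRingCat.of k)).inv ≫ (Y.hom ≫ P1.toSpec k).appTop ≫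
    Y.left.presheaf.germ ⊤ y trivial).hom

end ProjectiveLine

section Ramification

/-- If the endomorphism `φ` of `Y` fixes the point `y`, this is the pull-back
`s ↦ φ^* s` on the local ring of `Y` at `y`. -/
def stalkPullback {Y : Scheme.{u}} (φ : Y ⟶ Y) (y : Y) (h : φ y = y) :
    Y.presheaf.stalk y →+* Y.presheaf.stalk y :=
  (Y.presheaf.stalkSpecializes (specializes_of_eq h) ≫ φ.stalkMap y).hom

theorem stalkPullback_germ {Y : Scheme.{u}} (φ : Y ⟶ Y) (y : Y) (h : φ y = y)
    (U : Y.Opens) (hU : y ∈ U) (s : Γ(Y, U)) :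
    stalkPullback φ y h (Y.presheaf.germ U y hU s) =
      Y.presheaf.germ (φ ⁻¹ᵁ U) y (show φ y ∈ U from h.symm ▸ hU) (φ.app U s) := by
  have h1 : Y.presheaf.stalkSpecializes (specializes_of_eq h) (Y.presheaf.germ U y hU s) =
      Y.presheaf.germ U (φ y) (show φ y ∈ U from h.symm ▸ hU) s :=
    TopCat.Presheaf.germ_stalkSpecializes_apply ..
  change φ.stalkMap y (Y.presheaf.stalkSpecializes (specializes_of_eq h)
    (Y.presheaf.germ U y hU s)) = _
  rw [h1, Scheme.Hom.germ_stalkMap_apply]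

theorem stalkPullback_id {Y : Scheme.{u}} (y : Y) (h : (𝟙 Y : Y ⟶ Y) y = y)
    (s : Y.presheaf.stalk y) : stalkPullback (𝟙 Y) y h s = s := by
  obtain ⟨U, hU, t, rfl⟩ := Y.presheaf.exists_germ_eq s
  rw [stalkPullback_germ]
  rfl

theorem stalkPullback_comp {Y : Scheme.{u}} (φ ψ : Y ⟶ Y) (y : Y) (h : φ y = y)
    (h' : ψ y = y) (h'' : (φ ≫ ψ) y = y) (s : Y.presheaf.stalk y) :
    stalkPullback (φ ≫ ψ) y h'' s = stalkPullback φ y h (stalkPullback ψ y h' s) := by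
  obtain ⟨U, hU, t, rfl⟩ := Y.presheaf.exists_germ_eq s
  rw [stalkPullback_germ ψ y h' U hU t]
  erw [stalkPullback_germ φ y h]
  rw [stalkPullback_germ (φ ≫ ψ) y h'' U hU t, Scheme.Hom.comp_app]
  rfl

variable {X : Scheme.{u}} {Y : Over X} {G : Type v} [Group G]

/-- The automorphism of the scheme `Y` by which `g` acts. Since multiplication in `Aut Y` is
composition of maps, a homomorphism `ρ : G →* Aut Y` is a left action of `G` on `Y` over `X`. -/
def act (ρ : G →* Aut Y) (g : G) : Y.left ⟶ Y.left := (ρ g).hom.left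

theorem act_one (ρ : G →* Aut Y) : act ρ 1 = 𝟙 Y.left := by
  simp only [act, map_one]
  rfl

theorem act_mul (ρ : G →* Aut Y) (g h : G) : act ρ (g * h) = act ρ h ≫ act ρ g := by
  simp only [act, map_mul]
  rfl

instance (ρ : G →* Aut Y) (g : G) : IsIso (act ρ g) :=
  inferInstanceAs (IsIso ((Over.forget X).mapIso (ρ g)).hom)

/-- The `i`-th ramification group at `y` in the lower numbering: the elements of `G` that fix
`y` and act trivially on the local ring at `y` modulo the `(i + 1)`-st power of its maximal
ideal. -/
def ramificationGroup (ρ : G →* Aut Y) (y : Y.left) (i : ℕ) : Subgroup G where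
  carrier := {g | ∃ h : act ρ g y = y, ∀ s : Y.left.presheaf.stalk y,
    stalkPullback (act ρ g) y h s - s ∈
      IsLocalRing.maximalIdeal (Y.left.presheaf.stalk y) ^ (i + 1)}
  one_mem' := by
    refine ⟨by rw [act_one]; rfl, fun s => ?_⟩
    have : stalkPullback (act ρ 1) y (by rw [act_one]; rfl) s = s := by
      simp only [act_one]
      exact stalkPullback_id ..
    rw [this, sub_self]
    exact zero_mem _
  mul_mem' := by
    rintro a b ⟨ha, ha'⟩ ⟨hb, hb'⟩
    have hab : (act ρ b ≫ act ρ a) y = y := by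
      rw [Scheme.Hom.comp_apply, hb, ha]
    refine ⟨by rw [act_mul, hab], fun s => ?_⟩
    have : stalkPullback (act ρ (a * b)) y (by rw [act_mul, hab]) s =
        stalkPullback (act ρ b) y hb (stalkPullback (act ρ a) y ha s) := by
      simp only [act_mul]
      exact stalkPullback_comp ..
    rw [this, ← sub_add_sub_cancel _ (stalkPullback (act ρ a) y ha s)]
    exact add_mem (hb' _) (ha' _)
  inv_mem' := by
    rintro a ⟨ha, ha'⟩
    have hc : act ρ a ≫ act ρ a⁻¹ = 𝟙 _ := by rw [← act_mul, inv_mul_cancel, act_one]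
    have hi : act ρ a⁻¹ y = y := by
      conv_lhs => rw [← ha]
      rw [← Scheme.Hom.comp_apply, hc]
      rfl
    refine ⟨hi, fun s => ?_⟩
    have h1 : stalkPullback (act ρ a) y ha (stalkPullback (act ρ a⁻¹) y hi s) = s := by
      rw [← stalkPullback_comp (h'' := by rw [hc]; rfl)]
      simp only [hc]
      exact stalkPullback_id ..
    have h2 := ha' (stalkPullback (act ρ a⁻¹) y hi s)
    rw [h1] at h2
    rw [← neg_sub]
    exact neg_mem h2

/-- The inertia group at `y`: the elements of `G` that fix `y` and act trivially on the
residue field of `y`. -/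
def inertiaGroup (ρ : G →* Aut Y) (y : Y.left) : Subgroup G := ramificationGroup ρ y 0

/-- The conductor at `y` is `h`: the group `G_h` is the last non-trivial ramification group in
the lower numbering. -/
def IsConductorAt (ρ : G →* Aut Y) (y : Y.left) (h : ℕ) : Prop :=
  ramificationGroup ρ y h ≠ ⊥ ∧ ∀ i, h < i → ramificationGroup ρ y i = ⊥

/-- The set of closed points of `X` above which there is a ramified point of `Y`. -/
def branchLocus (ρ : G →* Aut Y) : Set X :=
  {x | IsClosed {x} ∧ ∃ y : Y.left, Y.hom y = x ∧ inertiaGroup ρ y ≠ ⊥}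

/-- The action of `g` on the rational functions of `Y` by pull-back, `f ↦ f ∘ g`. -/
def functionFieldPullback [IrreducibleSpace Y.left] (ρ : G →* Aut Y) (g : G) :
    Y.left.functionField →+* Y.left.functionField :=
  stalkPullback (act ρ g) (genericPoint Y.left) (genericPoint_eq_of_isOpenImmersion _)

end Ramification

section Covers

variable {k : Type u} [Field k] {G : Type v} [Group G]

/-- The scheme `Y`, with the action `ρ` of `G`, is a (not necessarily connected) `G`-Galois
cover of the curve `X` (over an algebraically closed field): `Y` is a nonsingular curve, `Y → X`
is finite and surjective, and over a dense open subset `U` of `X` it is étale and `G` acts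
simply transitively on the fibre over every closed point. -/
structure IsGaloisCover {X : Scheme.{u}} {Y : Over X} (ρ : G →* Aut Y) : Prop where
  nonsingular : ∀ y : Y.left, IsClosed {y} →
    ∃ _ : IsDomain (Y.left.presheaf.stalk y),
      IsDiscreteValuationRing (Y.left.presheaf.stalk y)
  finite : IsFinite Y.hom
  surjective : AlgebraicGeometry.Surjective Y.hom
  torsor : ∃ U : X.Opens, Dense (U : Set X) ∧ Etale (Y.hom ∣_ U) ∧
    ∀ y y' : Y.left, Y.hom y ∈ U → IsClosed {y} → IsClosed {y'} → Y.hom y = Y.hom y' →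
      ∃! g : G, act ρ g y = y'

/-- A `G`-tail cover in characteristic `p`: a `G`-Galois cover of the projective line that is
wildly branched at `∞`, of order `p * n` with `n` prime to `p`, and tamely branched at no more
than one other point. -/
structure IsTailCover (p : ℕ) {Y : Over (P1 k)} (ρ : G →* Aut Y) : Prop where
  isGaloisCover : IsGaloisCover ρ
  wild : ∃ n : ℕ, n.Coprime p ∧
    ∀ y : Y.left, Y.hom y = P1.infty k → Nat.card (inertiaGroup ρ y) = p * n
  tame : ∀ y : Y.left, IsClosed {y} → Y.hom y ≠ P1.infty k →
    (Nat.card (inertiaGroup ρ y)).Coprime p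
  subsingleton : (branchLocus ρ \ {P1.infty k}).Subsingleton

/-- A tail cover is primitive if it is branched at two points. -/
def IsPrimitive {Y : Over (P1 k)} (ρ : G →* Aut Y) : Prop :=
  (branchLocus ρ).encard = 2

/-- A tail cover is new if it is not primitive. -/
def IsNew {Y : Over (P1 k)} (ρ : G →* Aut Y) : Prop :=
  ¬ IsPrimitive ρ

/-- The ramification invariant of a `G`-tail cover is `σ = h / n`, where `h` is the conductor
at `∞` and `n` is the order of the prime-to-`p` ramification at `∞`. -/
def HasRamificationInvariant (p : ℕ) {Y : Over (P1 k)} (ρ : G →* Aut Y) (σ : ℚ) : Prop :=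
  ∃ h n : ℕ, n.Coprime p ∧ σ = (h : ℚ) / (n : ℚ) ∧
    ∀ y : Y.left, Y.hom y = P1.infty k →
      Nat.card (inertiaGroup ρ y) = p * n ∧ IsConductorAt ρ y h

/-- The curve `Y` is the complete nonsingular model of the affine curve
`y ^ (p + 1) = x ^ p - x` over `k` (its function field is generated over `k` by functions `x` and
`y` with this relation), and the group `SL₂(p)` acts on it by `A x = (a x + b) / (c x + d)` and
`A y = y / (c x + d)`. -/
def IsStandardModel (p : ℕ) [CharP k p] {Y : Over (P1 k)}
    (ρ : Matrix.SpecialLinearGroup (Fin 2) (ZMod p) →* Aut Y) : Prop :=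
  ∃ (_ : AlgebraicGeometry.IsIntegral Y.left) (x y : Y.left.functionField),
    let c : ZMod p → Y.left.functionField := fun a =>
      const Y (genericPoint Y.left) (ZMod.castHom dvd_rfl k a)
    Subfield.closure (Set.range (const Y (genericPoint Y.left)) ∪ {x, y}) = ⊤ ∧
    y ^ (p + 1) = x ^ p - x ∧
    ∀ A : Matrix.SpecialLinearGroup (Fin 2) (ZMod p),
      functionFieldPullback ρ A x = (c (A 0 0) * x + c (A 0 1)) / (c (A 1 0) * x + c (A 1 1)) ∧
      functionFieldPullback ρ A y = y / (c (A 1 0) * x + c (A 1 1))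

end Covers

end

end TailCover

open TailCover

/-! The functions u = x/y and v = 1/y satisfy u^p v - u v^p = 1, and in them the action of SL₂(p) is
linear. An 𝔽_p-linear substitution multiplies both u^p v - u v^p and t = u^(p²) v - u v^(p²) by its
determinant (`dickson_linear_substitution`). Hence t is invariant, and the cover is the map t to the
projective line.

Expanding the Moore determinant of u, v and T shows that the p² elements au + bv, with a, b in 𝔽_p,
are the roots of T^(p²) - t T^p + T, a polynomial with derivative 1. So K = k(u, v) is a separable
splitting field over k(t). An automorphism of it substitutes linearly in u and v and preserves u^p v
- u v^p = 1, so its matrix has determinant 1: the Galois group is SL₂(p)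
(`IsDrinfeldField.isGaloisGroup`).

Where t is finite, u and v are integral. An element of inertia moves each of them by some au + bv
lying in the prime; but a = (au + bv)^p v - (au + bv) v^p, and similarly for b, so both coefficients
vanish. The cover is therefore étale over the affine line (`IsDrinfeldField.inertia_eq_bot`,
`IsDrinfeldField.etale`).

Every point above ∞ has a translate at which x = u/v has a pole
(`IsDrinfeldField.exists_one_lt_valuation`). If u has a pole of order m there, then v has a zero of
order pm and t a pole of order m(p² - p), which is the order of the inertia group. Inertia consists
of upper triangular matrices, of which there are p(p - 1). So m = 1, inertia is the whole Borel
subgroup and 1/u is a uniformizer (`IsDrinfeldField.inertia_of_pole`). A nontrivial unipotent matrix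
moves 1/u by a function of order p + 2, any other matrix of the Borel subgroup by one of order at
most 1 unless it is the identity; so the conductor is p + 1 (`IsDrinfeldField.conductor_of_pole`).

As a scheme, Y is the normalization of the projective line in K along the point [t : 1]. On the two
standard charts its sections are the integral closures of k[t] and k[1/t] in K, and
`IsNormalizationIn.chart` carries the algebra over to Y. -/

namespace TailCover

/-! ### The function field and the linear action of SL₂(p) -/

section FunctionFieldConstruction

open Polynomial

/-- The image in a `k`-algebra of an element of the prime field. -/
noncomputable def primeCoeff (k : Type*) [Field k] (p : ℕ) [CharP k p] (K : Type*) [Field K]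
    [Algebra k K] : ZMod p →+* K :=
  (algebraMap k K).comp (ZMod.castHom dvd_rfl k)

/-- `K` is the function field of the curve `u ^ p * v - u * v ^ p = 1` with the contragredient
of the linear action of `SL₂(p)` on `(u, v)`. -/
structure IsDrinfeldField (k : Type*) [Field k] (p : ℕ) [CharP k p] {K : Type*} [Field K]
    [Algebra k K] [MulSemiringAction (Matrix.SpecialLinearGroup (Fin 2) (ZMod p)) K]
    (u v : K) : Prop where
  eqn : u ^ p * v - u * v ^ p = 1
  adjoin : IntermediateField.adjoin k {u, v} = ⊤
  smul_const : ∀ (A : Matrix.SpecialLinearGroup (Fin 2) (ZMod p)) (r : k),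
    A • algebraMap k K r = algebraMap k K r
  nonconst : u / v ∉ Set.range (algebraMap k K)
  inv_smul_fst : ∀ A : Matrix.SpecialLinearGroup (Fin 2) (ZMod p),
    A⁻¹ • u = primeCoeff k p K (A 0 0) * u + primeCoeff k p K (A 0 1) * v
  inv_smul_snd : ∀ A : Matrix.SpecialLinearGroup (Fin 2) (ZMod p),
    A⁻¹ • v = primeCoeff k p K (A 1 0) * u + primeCoeff k p K (A 1 1) * v

/-- Eisenstein at the prime X of k[X], which divides X^p - X exactly once, followed by Gauss's
lemma. -/
theorem irreducible_X_pow_sub_C (k : Type*) [Field k] {p : ℕ} (hp : 2 ≤ p) :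
    Irreducible (X ^ (p + 1) - C (RatFunc.X ^ p - RatFunc.X) : (RatFunc k)[X]) := by
  have h0 : (X ^ p - X : k[X]).coeff 1 ≠ 0 := by
    simp [coeff_X_pow, show (1 : ℕ) ≠ p by omega]
  have hm : (X ^ (p + 1) - C (X ^ p - X) : k[X][X]).Monic := monic_X_pow_sub_C _ (by omega)
  have hd : (X ^ (p + 1) - C (X ^ p - X) : k[X][X]).natDegree = p + 1 := natDegree_X_pow_sub_C
  have hirr : Irreducible (X ^ (p + 1) - C (X ^ p - X) : k[X][X]) := by
    have hP : (Ideal.span {(X : k[X])}).IsPrime :=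
      (Ideal.span_singleton_prime X_ne_zero).2 prime_X
    refine IsEisensteinAt.irreducible (𝓟 := Ideal.span {(X : k[X])}) ⟨?_, ?_, ?_⟩ hP
      hm.isPrimitive (by omega)
    · rw [hm.leadingCoeff]
      exact fun h => hP.ne_top ((Ideal.eq_top_iff_one _).2 h)
    · intro n hn
      rw [hd] at hn
      rw [Ideal.mem_span_singleton, coeff_sub, coeff_X_pow, if_neg hn.ne, zero_sub, dvd_neg,
        coeff_C]
      split_ifs
      · exact dvd_sub (dvd_pow_self _ (by omega)) dvd_rfl
      · exact dvd_zero _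
    · rw [coeff_sub, coeff_X_pow, if_neg (by omega), zero_sub, coeff_C_zero, neg_mem_iff,
        Ideal.span_singleton_pow, Ideal.mem_span_singleton]
      intro h
      exact h0 (X_pow_dvd_iff.1 h 1 (by norm_num))
  have := (hm.irreducible_iff_irreducible_map_fraction_map (K := RatFunc k)).1 hirr
  simpa using this

/-- A function field of the curve `y ^ (p + 1) = x ^ p - x`, with its mapping property. -/
theorem exists_functionField_curve (k : Type u) [Field k] {p : ℕ} (hp : 2 ≤ p) :
    ∃ (K : Type u) (_ : Field K) (_ : Algebra k K) (x y : K), Transcendental k x ∧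
      y ^ (p + 1) = x ^ p - x ∧ IntermediateField.adjoin k {x, y} = ⊤ ∧
      ∀ x' y' : K, Transcendental k x' → y' ^ (p + 1) = x' ^ p - x' →
        ∃ σ : K →ₐ[k] K, σ x = x' ∧ σ y = y' := by
  let f : (RatFunc k)[X] := X ^ (p + 1) - C (RatFunc.X ^ p - RatFunc.X)
  have : Fact (Irreducible f) := ⟨irreducible_X_pow_sub_C k hp⟩
  let x : AdjoinRoot f := algebraMap (RatFunc k) _ RatFunc.X
  have hy : AdjoinRoot.root f ^ (p + 1) = x ^ p - x := by
    have := AdjoinRoot.eval₂_root f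
    simp only [f, eval₂_sub, eval₂_X_pow, eval₂_C, sub_eq_zero] at this
    simpa [x] using this
  have hx : Transcendental k x :=
    (transcendental_algebraMap_iff (algebraMap (RatFunc k) (AdjoinRoot f)).injective).2
      RatFunc.transcendental_X
  refine ⟨AdjoinRoot f, inferInstance, inferInstance, x, AdjoinRoot.root f, hx, hy, ?_, ?_⟩
  · have hx' : x ∈ IntermediateField.adjoin k {x, AdjoinRoot.root f} :=
      IntermediateField.subset_adjoin _ _ (by simp)
    have hy' : AdjoinRoot.root f ∈ IntermediateField.adjoin k {x, AdjoinRoot.root f} :=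
      IntermediateField.subset_adjoin _ _ (by simp)
    have hc (g : RatFunc k) : AdjoinRoot.of f g ∈
        IntermediateField.adjoin k {x, AdjoinRoot.root f} := by
      have hX : IntermediateField.adjoin k {(RatFunc.X : RatFunc k)} ≤
          (IntermediateField.adjoin k {x, AdjoinRoot.root f}).comap
            (IsScalarTower.toAlgHom k (RatFunc k) (AdjoinRoot f)) :=
        IntermediateField.adjoin_le_iff.2 (by rintro _ rfl; exact hx')
      rw [RatFunc.adjoin_X] at hX
      exact hX (IntermediateField.mem_top (x := g))
    refine eq_top_iff.2 fun z hz => ?_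
    clear hz
    induction z using AdjoinRoot.induction_on with
    | ih g =>
      induction g using Polynomial.induction_on' with
      | add g h hg hh => rw [map_add]; exact add_mem hg hh
      | monomial n a =>
        rw [← C_mul_X_pow_eq_monomial, map_mul, map_pow, AdjoinRoot.mk_X, AdjoinRoot.mk_C]
        exact mul_mem (hc a) (pow_mem hy' n)
  · intro x' y' hx' h'
    have hinj : Function.Injective (aeval (R := k) x') := transcendental_iff_injective.1 hx'
    let φ : RatFunc k →ₐ[k] AdjoinRoot f := RatFunc.liftAlgHom (aeval x')
      (nonZeroDivisors_le_comap_nonZeroDivisors_of_injective _ hinj)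
    have hφ : φ RatFunc.X = x' := by
      have := RatFunc.liftAlgHom_apply_div' (φ := aeval (R := k) x')
          (hφ := nonZeroDivisors_le_comap_nonZeroDivisors_of_injective _ hinj) X 1
      simpa [φ] using this
    let σ : AdjoinRoot f →ₐ[k] AdjoinRoot f := AdjoinRoot.liftAlgHom f φ y' (by
      simp only [f, eval₂_sub, eval₂_X_pow, eval₂_C]
      simp [hφ, h'])
    exact ⟨σ, (AdjoinRoot.liftAlgHom_of f φ y' _ RatFunc.X).trans hφ,
      AdjoinRoot.liftAlgHom_root f φ y' _⟩

theorem primeCoeff_mem_range (k : Type*) [Field k] (p : ℕ) [CharP k p] (K : Type*)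
    [Field K] [Algebra k K] (a : ZMod p) :
    primeCoeff k p K a ∈ Set.range (algebraMap k K) :=
  ⟨_, rfl⟩

theorem primeCoeff_mul_add_pow {k : Type*} [Field k] {p : ℕ} [Fact p.Prime] [CharP k p]
    {K : Type*} [Field K] [Algebra k K] (a b : ZMod p) (u v : K) (n : ℕ) :
    (primeCoeff k p K a * u + primeCoeff k p K b * v) ^ p ^ n =
      primeCoeff k p K a * u ^ p ^ n + primeCoeff k p K b * v ^ p ^ n := by
  have : CharP K p := charP_of_injective_algebraMap (algebraMap k K).injective p
  rw [add_pow_char_pow, mul_pow, mul_pow, ← map_pow, ← map_pow, ZMod.pow_card_pow,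
    ZMod.pow_card_pow]

/-- An `𝔽_p`-linear substitution multiplies the form `u ^ q * v - u * v ^ q`, where `q` is a power
of `p`, by its determinant. -/
theorem dickson_linear_substitution {k : Type*} [Field k] {p : ℕ} [Fact p.Prime] [CharP k p]
    {K : Type*} [Field K] [Algebra k K] (a b c d : ZMod p) (u v : K) (n : ℕ) :
    (primeCoeff k p K a * u + primeCoeff k p K b * v) ^ p ^ n *
        (primeCoeff k p K c * u + primeCoeff k p K d * v) -
      (primeCoeff k p K a * u + primeCoeff k p K b * v) *
        (primeCoeff k p K c * u + primeCoeff k p K d * v) ^ p ^ n =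
      primeCoeff k p K (a * d - b * c) * (u ^ p ^ n * v - u * v ^ p ^ n) := by
  simp only [primeCoeff_mul_add_pow, map_sub, map_mul]
  ring

theorem Matrix.SpecialLinearGroup.det_fin_two_eq_one {R : Type*} [CommRing R]
    (A : Matrix.SpecialLinearGroup (Fin 2) R) : A 0 0 * A 1 1 - A 0 1 * A 1 0 = 1 := by
  rw [← Matrix.det_fin_two, A.det_coe]

/-- A fractional linear transform of a non-constant function is not constant. -/
theorem moebius_notMem_range {k K : Type*} [Field k] [Field K] [Algebra k K] {x : K}
    (hx : x ∉ Set.range (algebraMap k K)) {a b c d : K} (ha : a ∈ Set.range (algebraMap k K))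
    (hb : b ∈ Set.range (algebraMap k K)) (hc : c ∈ Set.range (algebraMap k K))
    (hd : d ∈ Set.range (algebraMap k K)) (hdet : a * d - b * c = 1) :
    c * x + d ≠ 0 ∧ (a * x + b) / (c * x + d) ∉ Set.range (algebraMap k K) := by
  obtain ⟨a, rfl⟩ := ha
  obtain ⟨b, rfl⟩ := hb
  obtain ⟨c, rfl⟩ := hc
  obtain ⟨d, rfl⟩ := hd
  rw [← map_mul, ← map_mul, ← map_sub, map_eq_one_iff _ (algebraMap k K).injective] at hdet
  have key (r s : k) (h : algebraMap k K r * x + algebraMap k K s = 0) : r = 0 ∧ s = 0 := by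
    have hr : r = 0 := by
      by_contra hr
      refine hx ⟨-s / r, ?_⟩
      have : algebraMap k K r ≠ 0 := by simpa using hr
      rw [map_div₀, map_neg]
      field_simp
      linear_combination -h
    subst hr
    simpa using h
  have h0 : algebraMap k K c * x + algebraMap k K d ≠ 0 := by
    intro h
    obtain ⟨rfl, rfl⟩ := key c d h
    simp at hdet
  refine ⟨h0, ?_⟩
  rintro ⟨r, hr⟩
  rw [eq_div_iff h0] at hr
  obtain ⟨h1, h2⟩ := key (a - r * c) (b - r * d) (by
    simp only [map_sub, map_mul]
    linear_combination -hr)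
  apply one_ne_zero (α := k)
  linear_combination -hdet + d * h1 - c * h2

/-- An algebraic element generates an algebraic extension of the algebraically closed field k, which
is trivial. -/
theorem transcendental_iff_notMem_range {k K : Type*} [Field k] [IsAlgClosed k] [Field K]
    [Algebra k K] {z : K} : Transcendental k z ↔ z ∉ Set.range (algebraMap k K) := by
  refine not_iff_not.2 ⟨fun h => ?_, ?_⟩
  · have := IntermediateField.isAlgebraic_adjoin_simple (isAlgebraic_iff_isIntegral.1 h)
    have hz := IntermediateField.mem_adjoin_simple_self k z
    rw [IntermediateField.eq_bot_of_isAlgClosed_of_isAlgebraic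
      (IntermediateField.adjoin k {z})] at hz
    exact IntermediateField.mem_bot.1 hz
  · rintro ⟨r, rfl⟩
    exact isAlgebraic_algebraMap r

/-- In the coordinates u = x/y, v = 1/y the fractional linear action becomes linear, so the
composition law can be checked on matrices. -/
theorem exists_isDrinfeldField (k : Type u) [Field k] [IsAlgClosed k] (p : ℕ) [Fact p.Prime]
    [CharP k p] :
    ∃ (K : Type u) (_ : Field K) (_ : Algebra k K)
      (_ : MulSemiringAction (Matrix.SpecialLinearGroup (Fin 2) (ZMod p)) K) (u v : K),
      IsDrinfeldField k p u v := by
  obtain ⟨K, _, _, x, y, hx, hxy, htop, hlift⟩ :=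
    exists_functionField_curve k (Fact.out : p.Prime).two_le
  have : CharP K p := charP_of_injective_algebraMap (algebraMap k K).injective p
  have hp1 : p ≠ 0 := (Fact.out : p.Prime).ne_zero
  have htr := fun z : K => transcendental_iff_notMem_range (k := k) (z := z)
  have hx' : x ∉ Set.range (algebraMap k K) := (htr x).1 hx
  have hy0 : y ≠ 0 := by
    rintro rfl
    have h1 : (X ^ p - X : k[X]) = 0 := transcendental_iff.1 hx _ (by
      rw [map_sub, map_pow, aeval_X, ← hxy, zero_pow (by omega)])
    have h2 := congrArg (coeff · 1) h1
    simp [coeff_X_pow, show (1 : ℕ) ≠ p from (Fact.out : p.Prime).one_lt.ne] at h2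
  let u := x / y
  let v := 1 / y
  have huv : u ^ p * v - u * v ^ p = 1 := by
    simp only [u, v]
    have h1 : x ^ p - x = y ^ p * y := by rw [← hxy, pow_succ]
    have h2 : (x / y) ^ p * (1 / y) - x / y * (1 / y) ^ p = (x ^ p - x) / (y ^ p * y) := by
      rw [div_pow, div_pow, one_pow]
      ring
    rw [h2, h1, div_self (mul_ne_zero (pow_ne_zero _ hy0) hy0)]
  have hv0 : v ≠ 0 := one_div_ne_zero hy0
  have hadj : IntermediateField.adjoin k {u, v} = ⊤ := by
    rw [eq_top_iff, ← htop, IntermediateField.adjoin_le_iff]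
    have hu : u ∈ IntermediateField.adjoin k {u, v} :=
      IntermediateField.subset_adjoin _ _ (by simp)
    have hv : v ∈ IntermediateField.adjoin k {u, v} :=
      IntermediateField.subset_adjoin _ _ (by simp)
    rintro z (rfl | rfl)
    · have h : u / v = z := (div_div_div_cancel_right₀ hy0 z 1).trans (div_one z)
      exact h ▸ div_mem hu hv
    · have h : v⁻¹ = z := by rw [inv_eq_one_div, one_div_one_div]
      exact h ▸ inv_mem hv
  have hext (σ τ : K →ₐ[k] K) (h1 : σ u = τ u) (h2 : σ v = τ v) : σ = τ := by
    refine AlgHom.ext fun z => ?_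
    induction (hadj ▸ IntermediateField.mem_top : z ∈ IntermediateField.adjoin k {u, v}) using
      IntermediateField.adjoin_induction with
    | mem z hz => rcases hz with rfl | rfl <;> assumption
    | algebraMap r => rw [σ.commutes, τ.commutes]
    | add z w _ _ hz hw => rw [map_add, map_add, hz, hw]
    | inv z _ hz => rw [map_inv₀, map_inv₀, hz]
    | mul z w _ _ hz hw => rw [map_mul, map_mul, hz, hw]
  have hσ (A : Matrix.SpecialLinearGroup (Fin 2) (ZMod p)) : ∃ σ : K →ₐ[k] K,
      σ u = primeCoeff k p K (A 0 0) * u + primeCoeff k p K (A 0 1) * v ∧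
      σ v = primeCoeff k p K (A 1 0) * u + primeCoeff k p K (A 1 1) * v := by
    have hdet := Matrix.SpecialLinearGroup.det_fin_two_eq_one A
    obtain ⟨h0, hm⟩ := moebius_notMem_range hx' (primeCoeff_mem_range k p K (A 0 0))
      (primeCoeff_mem_range k p K (A 0 1)) (primeCoeff_mem_range k p K (A 1 0))
      (primeCoeff_mem_range k p K (A 1 1)) (by rw [← map_mul, ← map_mul, ← map_sub, hdet, map_one])
    -- With N and D the numerator and denominator of the transform of x, this reads N^p D - N D^p =
    -- x^p - x. Division by D^(p+1) shows that (N/D, y/D) again satisfies the equation of the curve.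
    have hL := dickson_linear_substitution (k := k) (A 0 0) (A 0 1) (A 1 0) (A 1 1) x 1 1
    rw [hdet, map_one] at hL
    simp only [mul_one, one_pow, one_mul, pow_one] at hL
    have hN : u * primeCoeff k p K (A 0 0) + v * primeCoeff k p K (A 0 1) =
        (primeCoeff k p K (A 0 0) * x + primeCoeff k p K (A 0 1)) / y := by
      simp only [u, v]
      ring
    have hD : u * primeCoeff k p K (A 1 0) + v * primeCoeff k p K (A 1 1) =
        (primeCoeff k p K (A 1 0) * x + primeCoeff k p K (A 1 1)) / y := by
      simp only [u, v]
      ring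
    simp only [mul_comm _ u, mul_comm _ v, hN, hD]
    generalize primeCoeff k p K (A 0 0) * x + primeCoeff k p K (A 0 1) = N at *
    generalize primeCoeff k p K (A 1 0) * x + primeCoeff k p K (A 1 1) = D at *
    obtain ⟨σ, h1, h2⟩ := hlift _ (y / D) ((htr _).2 hm) (by
      rw [div_pow, hxy, div_pow, ← hL, pow_succ]
      field_simp)
    refine ⟨σ, ?_, ?_⟩
    · simp only [u, map_div₀, h1, h2]
      field_simp
    · simp only [v, map_div₀, h2, map_one]
      field_simp
  choose σ hσu hσv using hσ
  have hσc (A) (a : ZMod p) : σ A (primeCoeff k p K a) = primeCoeff k p K a := (σ A).commutes _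
  have hone : σ 1 = AlgHom.id k K := hext _ _ (by simp [hσu]) (by simp [hσv])
  have hmul (A B) : (σ A).comp (σ B) = σ (B * A) := by
    refine hext _ _ ?_ ?_
    · simp only [AlgHom.comp_apply, hσu, hσv, map_add, map_mul, hσc,
        Matrix.SpecialLinearGroup.coe_mul, Matrix.mul_apply, Fin.sum_univ_two]
      ring
    · simp only [AlgHom.comp_apply, hσu, hσv, map_add, map_mul, hσc,
        Matrix.SpecialLinearGroup.coe_mul, Matrix.mul_apply, Fin.sum_univ_two]
      ring
  -- Pull-backs compose in the reverse order, so a left action needs the pull-back under the inverse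
  -- matrix.
  let act : MulSemiringAction (Matrix.SpecialLinearGroup (Fin 2) (ZMod p)) K :=
    { smul A f := σ A⁻¹ f
      one_smul f := by
        change σ 1⁻¹ f = f
        rw [inv_one, hone]
        rfl
      mul_smul A B f := by
        change σ (A * B)⁻¹ f = σ A⁻¹ (σ B⁻¹ f)
        rw [← AlgHom.comp_apply, hmul, mul_inv_rev]
      smul_zero A := map_zero (σ A⁻¹)
      smul_add A := map_add (σ A⁻¹)
      smul_one A := map_one (σ A⁻¹)
      smul_mul A := map_mul (σ A⁻¹) }
  refine ⟨K, inferInstance, inferInstance, act, u, v, huv, hadj, fun A r => (σ A⁻¹).commutes r, ?_,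
      fun A => ?_, fun A => ?_⟩
  · rwa [show u / v = x from (div_div_div_cancel_right₀ hy0 x 1).trans (div_one x)]
  · change σ A⁻¹⁻¹ u = _
    rw [inv_inv, hσu]
  · change σ A⁻¹⁻¹ v = _
    rw [inv_inv, hσv]

end FunctionFieldConstruction

/-! ### K is Galois over k(t) with group SL₂(p) -/

section Galois

open Polynomial

variable {k : Type*} [Field k] {p : ℕ} [CharP k p] {K : Type*} [Field K]
  [Algebra k K] [MulSemiringAction (Matrix.SpecialLinearGroup (Fin 2) (ZMod p)) K] {u v : K}

/-- The invariant `u ^ p ^ 2 * v - u * v ^ p ^ 2`. -/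
def dicksonInvariant (p : ℕ) {K : Type*} [Field K] (u v : K) : K := u ^ p ^ 2 * v - u * v ^ p ^ 2

namespace IsDrinfeldField

theorem charP (_ : IsDrinfeldField k p u v) : CharP K p :=
  charP_of_injective_algebraMap (algebraMap k K).injective p

theorem ne_zero [Fact p.Prime] (h : IsDrinfeldField k p u v) : u ≠ 0 ∧ v ≠ 0 := by
  have hp : p ≠ 0 := (Fact.out : p.Prime).ne_zero
  constructor <;>
  · rintro rfl
    simpa [hp] using h.eqn

theorem inv_smul_dicksonInvariant [Fact p.Prime] (h : IsDrinfeldField k p u v)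
    (A : Matrix.SpecialLinearGroup (Fin 2) (ZMod p)) :
    A⁻¹ • dicksonInvariant p u v = dicksonInvariant p u v := by
  rw [dicksonInvariant, smul_sub, smul_mul', smul_mul', smul_pow', smul_pow', h.inv_smul_fst,
    h.inv_smul_snd, dickson_linear_substitution,
    Matrix.SpecialLinearGroup.det_fin_two_eq_one, map_one, one_mul]

theorem smul_dicksonInvariant [Fact p.Prime] (h : IsDrinfeldField k p u v)
    (A : Matrix.SpecialLinearGroup (Fin 2) (ZMod p)) :
    A • dicksonInvariant p u v = dicksonInvariant p u v := by
  simpa using h.inv_smul_dicksonInvariant A⁻¹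

theorem eqn_pow [Fact p.Prime] (h : IsDrinfeldField k p u v) :
    u ^ p ^ 2 * v ^ p - u ^ p * v ^ p ^ 2 = 1 := by
  have := h.charP
  have h1 := congrArg (· ^ p) h.eqn
  simp only [sub_pow_char, mul_pow, one_pow] at h1
  rw [← pow_mul, ← pow_mul, ← pow_two] at h1
  exact h1

/-- The polynomial T^(p²) - t T^p + T is, up to sign, the Moore determinant of u, v, T: its outer
coefficients are u^p v - u v^p and the p-th power of that form, both equal to 1. The determinant
vanishes at T = u. -/
theorem root_fst [Fact p.Prime] (h : IsDrinfeldField k p u v) :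
    u ^ p ^ 2 - dicksonInvariant p u v * u ^ p + u = 0 := by
  rw [dicksonInvariant]
  linear_combination (-u ^ p ^ 2) * h.eqn - u * h.eqn_pow

theorem root_snd [Fact p.Prime] (h : IsDrinfeldField k p u v) :
    v ^ p ^ 2 - dicksonInvariant p u v * v ^ p + v = 0 := by
  rw [dicksonInvariant]
  linear_combination (-v ^ p ^ 2) * h.eqn - v * h.eqn_pow

theorem ringHom_ext (h : IsDrinfeldField k p u v) {L : Type*} [Field L] {σ τ : K →+* L}
    (hk : ∀ r, σ (algebraMap k K r) = τ (algebraMap k K r)) (hu : σ u = τ u) (hv : σ v = τ v) :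
    σ = τ := by
  refine RingHom.ext fun z => ?_
  induction (h.adjoin ▸ IntermediateField.mem_top : z ∈ IntermediateField.adjoin k {u, v}) using
    IntermediateField.adjoin_induction with
  | mem z hz => rcases hz with rfl | rfl <;> assumption
  | algebraMap r => exact hk r
  | add z w _ _ hz hw => rw [map_add, map_add, hz, hw]
  | inv z _ hz => rw [map_inv₀, map_inv₀, hz]
  | mul z w _ _ hz hw => rw [map_mul, map_mul, hz, hw]

/-- The elements `a * u + b * v` are roots of `T ^ p ^ 2 - t * T ^ p + T`. -/
theorem root [Fact p.Prime] (h : IsDrinfeldField k p u v) (a b : ZMod p) :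
    (primeCoeff k p K a * u + primeCoeff k p K b * v) ^ p ^ 2 - dicksonInvariant p u v *
      (primeCoeff k p K a * u + primeCoeff k p K b * v) ^ p +
      (primeCoeff k p K a * u + primeCoeff k p K b * v) = 0 := by
  have h1 := primeCoeff_mul_add_pow (k := k) a b u v 1
  rw [pow_one] at h1
  rw [h1, primeCoeff_mul_add_pow]
  linear_combination primeCoeff k p K a * h.root_fst + primeCoeff k p K b * h.root_snd

/-- A nontrivial relation over 𝔽_p would make u/v a constant. -/
theorem eq_zero_of_linear_relation [Fact p.Prime] (h : IsDrinfeldField k p u v) {a b : ZMod p}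
    (hab : primeCoeff k p K a * u + primeCoeff k p K b * v = 0) : a = 0 ∧ b = 0 := by
  obtain ⟨-, hv⟩ := h.ne_zero
  have ha : a = 0 := by
    by_contra ha
    have ha' : primeCoeff k p K a ≠ 0 := by simpa using ha
    refine h.nonconst ⟨ZMod.castHom dvd_rfl k (-b / a), ?_⟩
    change primeCoeff k p K (-b / a) = _
    rw [map_div₀, map_neg, div_eq_div_iff ha' hv]
    linear_combination -hab
  subst ha
  simpa [hv] using hab

theorem linear_injective [Fact p.Prime] (h : IsDrinfeldField k p u v) :
    Function.Injective fun q : ZMod p × ZMod p =>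
      primeCoeff k p K q.1 * u + primeCoeff k p K q.2 * v := by
  rintro ⟨a, b⟩ ⟨a', b'⟩ hq
  obtain ⟨h1, h2⟩ := h.eq_zero_of_linear_relation (a := a - a') (b := b - b') (by
    simp only [map_sub]
    linear_combination hq)
  rw [Prod.mk.injEq]
  exact ⟨sub_eq_zero.1 h1, sub_eq_zero.1 h2⟩

theorem eq_of_smul_eq [Fact p.Prime] (h : IsDrinfeldField k p u v)
    {A B : Matrix.SpecialLinearGroup (Fin 2) (ZMod p)} (hu : A • u = B • u) (hv : A • v = B • v) :
    A = B := by
  have h1 := h.inv_smul_fst A⁻¹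
  have h2 := h.inv_smul_snd A⁻¹
  rw [inv_inv, hu, ← inv_inv B, h.inv_smul_fst] at h1
  rw [inv_inv, hv, ← inv_inv B, h.inv_smul_snd] at h2
  have h3 := h.linear_injective (a₁ := (_, _)) (a₂ := (_, _)) h1
  have h4 := h.linear_injective (a₁ := (_, _)) (a₂ := (_, _)) h2
  rw [Prod.mk.injEq] at h3 h4
  refine inv_injective (Matrix.SpecialLinearGroup.ext _ _ fun i j => ?_)
  fin_cases i <;> fin_cases j
  exacts [h3.1.symm, h3.2.symm, h4.1.symm, h4.2.symm]

theorem natDegree_linearized {R : Type*} [CommRing R] [Nontrivial R] {p : ℕ} (hp : 1 < p) (t : R) :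
    (X ^ p ^ 2 - C t * X ^ p + X : R[X]).Monic ∧
      (X ^ p ^ 2 - C t * X ^ p + X : R[X]).natDegree = p ^ 2 := by
  have hpp : p < p ^ 2 := by nlinarith
  have hd : (- (C t * X ^ p) + X : R[X]).degree < (p ^ 2 : ℕ) := by
    refine (degree_add_le _ _).trans_lt (max_lt ?_ ?_)
    · rw [degree_neg]
      exact (degree_C_mul_X_pow_le _ _).trans_lt (by exact_mod_cast hpp)
    · exact degree_X_le.trans_lt (by exact_mod_cast (by omega : 1 < p ^ 2))
  rw [sub_add, sub_eq_add_neg, neg_sub, sub_eq_neg_add]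
  exact ⟨monic_X_pow_add hd, by
    rw [add_comm, natDegree_add_eq_right_of_degree_lt (by rwa [degree_X_pow]), natDegree_X_pow]⟩

/-- The roots of `T ^ p ^ 2 - t * T ^ p + T` are the elements `a * u + b * v`. -/
theorem roots_eq [Fact p.Prime] (h : IsDrinfeldField k p u v) [DecidableEq K] :
    (X ^ p ^ 2 - C (dicksonInvariant p u v) * X ^ p + X : K[X]).roots =
      (Finset.univ.image fun q : ZMod p × ZMod p =>
        primeCoeff k p K q.1 * u + primeCoeff k p K q.2 * v).val := by
  obtain ⟨hm, hd⟩ := natDegree_linearized (Fact.out : p.Prime).one_lt (dicksonInvariant p u v)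
  symm
  refine Multiset.eq_of_le_of_card_le ?_ ?_
  · rw [Finset.val_le_iff_val_subset]
    intro z hz
    rw [Finset.mem_val, Finset.mem_image] at hz
    obtain ⟨q, -, rfl⟩ := hz
    rw [mem_roots hm.ne_zero, IsRoot]
    simpa using h.root q.1 q.2
  · refine (card_roots' _).trans ?_
    rw [hd, Finset.card_val, Finset.card_image_of_injective _ h.linear_injective, Finset.card_univ,
      Fintype.card_prod, ZMod.card, pow_two]

theorem exists_linear_of_root [Fact p.Prime] (h : IsDrinfeldField k p u v) {z : K}
    (hz : z ^ p ^ 2 - dicksonInvariant p u v * z ^ p + z = 0) :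
    ∃ a b : ZMod p, z = primeCoeff k p K a * u + primeCoeff k p K b * v := by
  classical
  obtain ⟨hm, -⟩ := natDegree_linearized (Fact.out : p.Prime).one_lt (dicksonInvariant p u v)
  have : z ∈ (X ^ p ^ 2 - C (dicksonInvariant p u v) * X ^ p + X : K[X]).roots := by
    rw [mem_roots hm.ne_zero, IsRoot]
    simpa using hz
  rw [h.roots_eq, Finset.mem_val, Finset.mem_image] at this
  obtain ⟨q, -, rfl⟩ := this
  exact ⟨q.1, q.2, rfl⟩

/-- If t were constant, u and v would be roots of a monic polynomial over k, hence constants, and so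
would u/v. -/
theorem transcendental_dicksonInvariant [Fact p.Prime] [IsAlgClosed k]
    (h : IsDrinfeldField k p u v) : Transcendental k (dicksonInvariant p u v) := by
  rw [transcendental_iff_notMem_range]
  rintro ⟨r, hr⟩
  obtain ⟨hm, -⟩ := natDegree_linearized (Fact.out : p.Prime).one_lt r
  have key (z : K) (hz : z ^ p ^ 2 - dicksonInvariant p u v * z ^ p + z = 0) :
      z ∈ Set.range (algebraMap k K) := by
    by_contra hz'
    exact transcendental_iff_notMem_range.2 hz' ⟨_, hm.ne_zero, by simpa [hr] using hz⟩
  obtain ⟨a, ha⟩ := key u h.root_fst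
  obtain ⟨b, hb⟩ := key v h.root_snd
  exact h.nonconst ⟨a / b, by rw [map_div₀, ha, hb]⟩

/-- The linearized polynomial has derivative 1 in characteristic p and has p² distinct roots in K,
among them the generators u and v. -/
theorem isGalois [Fact p.Prime] (h : IsDrinfeldField k p u v) :
    IsGalois (IntermediateField.adjoin k {dicksonInvariant p u v}) K ∧
      FiniteDimensional (IntermediateField.adjoin k {dicksonInvariant p u v}) K := by
  classical
  set F := IntermediateField.adjoin k {dicksonInvariant p u v}
  have : CharP F p := charP_of_injective_algebraMap (algebraMap k F).injective p
  let t : F := ⟨dicksonInvariant p u v, IntermediateField.mem_adjoin_simple_self k _⟩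
  let f : F[X] := X ^ p ^ 2 - C t * X ^ p + X
  have hfK : f.map (algebraMap F K) = X ^ p ^ 2 - C (dicksonInvariant p u v) * X ^ p + X := by
    simp only [f, Polynomial.map_add, Polynomial.map_sub, Polynomial.map_mul, Polynomial.map_pow,
      map_X, map_C]
    rfl
  obtain ⟨hm, hd⟩ := natDegree_linearized (Fact.out : p.Prime).one_lt t
  obtain ⟨hmK, hdK⟩ := natDegree_linearized (Fact.out : p.Prime).one_lt (dicksonInvariant p u v)
  have hsep : f.Separable := by
    refine separable_def _ |>.2 ?_
    have : derivative f = 1 := by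
      simp [f, derivative_X_pow]
    rw [this]
    exact isCoprime_one_right
  have hroot (a b : ZMod p) : primeCoeff k p K a * u + primeCoeff k p K b * v ∈ f.rootSet K := by
    rw [mem_rootSet]
    refine ⟨hm.ne_zero, ?_⟩
    rw [← eval_map_algebraMap, hfK]
    simpa using h.root a b
  have hsplit : f.IsSplittingField F K := by
    refine ⟨?_, ?_⟩
    · rw [splits_iff_card_roots, hfK, h.roots_eq, hdK, Finset.card_val,
        Finset.card_image_of_injective _ h.linear_injective, Finset.card_univ,
        Fintype.card_prod, ZMod.card, pow_two]
    · have htop : IntermediateField.adjoin F (f.rootSet K) = ⊤ := by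
        rw [← IntermediateField.restrictScalars_eq_top_iff (K := k), eq_top_iff, ← h.adjoin,
          IntermediateField.adjoin_le_iff]
        rintro z (rfl | rfl)
        · exact IntermediateField.subset_adjoin F _ (by simpa using hroot 1 0)
        · exact IntermediateField.subset_adjoin F _ (by simpa using hroot 0 1)
      rw [← IntermediateField.adjoin_toSubalgebra_of_isAlgebraic
        fun _ => isAlgebraic_of_mem_rootSet, htop]
      rfl
  exact ⟨IsGalois.of_separable_splitting_field hsep, IsSplittingField.finiteDimensional K f⟩

/-- The point is that SL₂(p) exhausts the Galois group: an automorphism permutes the roots au + bv,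
so it is determined by a matrix over 𝔽_p, and only the determinant remains to be found. -/
theorem isGaloisGroup [Fact p.Prime] (h : IsDrinfeldField k p u v) :
    IsGaloisGroup (Matrix.SpecialLinearGroup (Fin 2) (ZMod p))
      (IntermediateField.adjoin k {dicksonInvariant p u v}) K := by
  set F := IntermediateField.adjoin k {dicksonInvariant p u v}
  obtain ⟨_, _⟩ := h.isGalois
  have hfix (A : Matrix.SpecialLinearGroup (Fin 2) (ZMod p)) (z : F) : A • (z : K) = z := by
    obtain ⟨z, hz⟩ := z
    induction hz using IntermediateField.adjoin_induction with
    | mem z hz =>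
      obtain rfl := Set.mem_singleton_iff.1 hz
      exact h.smul_dicksonInvariant A
    | algebraMap r => exact h.smul_const A r
    | add z w _ _ hz hw => exact (smul_add A z w).trans (congrArg₂ _ hz hw)
    | inv z _ hz => exact (smul_inv'' A z).trans (congrArg _ hz)
    | mul z w _ _ hz hw => exact (smul_mul' A z w).trans (congrArg₂ _ hz hw)
  refine ⟨⟨fun {A B} hAB => ?_⟩, ⟨fun A z w => ?_⟩, ⟨fun z hz => ?_⟩⟩
  · exact h.eq_of_smul_eq (hAB u) (hAB v)
  · rw [Algebra.smul_def, Algebra.smul_def, smul_mul']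
    exact congrArg (· * _) (hfix A z)
  · have hbot : z ∈ (⊥ : IntermediateField F K) := by
      rw [IsGalois.mem_bot_iff_fixed]
      intro σ
      obtain ⟨t, ht⟩ : ∃ t : F, algebraMap F K t = dicksonInvariant p u v :=
        ⟨⟨_, IntermediateField.mem_adjoin_simple_self k _⟩, rfl⟩
      have hσt : σ (dicksonInvariant p u v) = dicksonInvariant p u v := by
        rw [← ht, σ.commutes]
      obtain ⟨a, b, hab⟩ := h.exists_linear_of_root (z := σ u) (by
        simpa [hσt] using congrArg σ h.root_fst)
      obtain ⟨c, d, hcd⟩ := h.exists_linear_of_root (z := σ v) (by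
        simpa [hσt] using congrArg σ h.root_snd)
      -- Applying σ to u^p v - u v^p = 1 multiplies the left side by the determinant.
      have hdet : a * d - b * c = 1 := by
        have h1 := congrArg σ h.eqn
        have h2 := dickson_linear_substitution (k := k) a b c d u v 1
        rw [pow_one, h.eqn, mul_one] at h2
        simp only [map_sub, map_mul, map_pow, map_one, hab, hcd] at h1
        rw [h2] at h1
        exact (primeCoeff k p K).injective (h1.trans (map_one _).symm)
      let A : Matrix.SpecialLinearGroup (Fin 2) (ZMod p) :=
        ⟨!![a, b; c, d], by rw [Matrix.det_fin_two_of, hdet]⟩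
      have hA : (σ : K →+* K) = MulSemiringAction.toRingHom _ K A⁻¹ :=
        h.ringHom_ext
          (fun r => by
            refine Eq.trans ?_ (h.smul_const A⁻¹ r).symm
            exact σ.commutes (algebraMap k F r))
          (hab.trans (h.inv_smul_fst A).symm) (hcd.trans (h.inv_smul_snd A).symm)
      exact (DFunLike.congr_fun hA z).trans (hz A⁻¹)
    exact IntermediateField.mem_bot.1 hbot

end IsDrinfeldField
end Galois

/-! ### Integral closures of k[t] and k[1/t] in K -/

section Chart

open Polynomial

variable {k : Type*} [Field k] {p : ℕ} [CharP k p] {K : Type*} [Field K]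
  [Algebra k K] [MulSemiringAction (Matrix.SpecialLinearGroup (Fin 2) (ZMod p)) K] {u v : K}
  {A C : Type*} [CommRing A] [CommRing C] [Algebra k A] [Algebra A C] [Algebra C K] [Algebra A K]
  [IsScalarTower A C K] [IsScalarTower k A K] {τ : A}

/-- A `k`-algebra generated by an element that is transcendental in `K` is a polynomial ring. -/
theorem bijective_aeval_of_transcendental (hτ : Function.Surjective (aeval (R := k) τ))
    (ht : Transcendental k (algebraMap A K τ)) :
    Function.Bijective (aeval (R := k) τ) ∧ Function.Injective (algebraMap A K) := by
  have hcomp (q : k[X]) : algebraMap A K (aeval τ q) = aeval (algebraMap A K τ) q :=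
    (aeval_algebraMap_apply K τ q).symm
  have hinj : Function.Injective (aeval (R := k) τ) := fun q r hqr =>
    transcendental_iff_injective.1 ht (by rw [← hcomp, ← hcomp, hqr])
  refine ⟨⟨hinj, hτ⟩, fun a b hab => ?_⟩
  obtain ⟨q, rfl⟩ := hτ a
  obtain ⟨r, rfl⟩ := hτ b
  rw [hcomp, hcomp] at hab
  rw [transcendental_iff_injective.1 ht hab]

theorem isDomain_isPrincipalIdealRing_of_transcendental
    (hτ : Function.Surjective (aeval (R := k) τ)) (ht : Transcendental k (algebraMap A K τ)) :
    IsDomain A ∧ IsPrincipalIdealRing A := by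
  let e : k[X] ≃ₐ[k] A := AlgEquiv.ofBijective _ (bijective_aeval_of_transcendental hτ ht).1
  exact ⟨e.symm.toMulEquiv.isDomain _, IsPrincipalIdealRing.of_surjective e e.surjective⟩

/-- The structure of a chart of the cover attached to the function field `K`. -/
theorem IsDrinfeldField.chart [Fact p.Prime] [IsAlgClosed k] (h : IsDrinfeldField k p u v)
    (hτ : Function.Surjective (aeval (R := k) τ))
    (ht : algebraMap A K τ = dicksonInvariant p u v ∨
      algebraMap A K τ = (dicksonInvariant p u v)⁻¹)
    [IsIntegralClosure C A K] [MulSemiringAction (Matrix.SpecialLinearGroup (Fin 2) (ZMod p)) C]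
    [SMulDistribClass (Matrix.SpecialLinearGroup (Fin 2) (ZMod p)) C K] :
    IsDedekindDomain A ∧ IsDedekindDomain C ∧ Module.Finite A C ∧ Module.Flat A C ∧
      IsFractionRing C K ∧ IsGaloisGroup (Matrix.SpecialLinearGroup (Fin 2) (ZMod p)) A C := by
  have htr : Transcendental k (algebraMap A K τ) := by
    rcases ht with ht | ht <;> rw [ht]
    · exact h.transcendental_dicksonInvariant
    · rw [Transcendental, IsAlgebraic.inv_iff]
      exact h.transcendental_dicksonInvariant
  obtain ⟨_, _⟩ := isDomain_isPrincipalIdealRing_of_transcendental hτ htr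
  obtain ⟨-, hinj⟩ := bijective_aeval_of_transcendental hτ htr
  set F := IntermediateField.adjoin k {dicksonInvariant p u v}
  obtain ⟨_, _⟩ := h.isGalois
  have := h.isGaloisGroup
  have hAF (a : A) : algebraMap A K a ∈ F := by
    obtain ⟨q, rfl⟩ := hτ a
    have hτF : algebraMap A K τ ∈ F := by
      have := IntermediateField.mem_adjoin_simple_self k (dicksonInvariant p u v)
      rcases ht with ht | ht <;> rw [ht]
      exacts [this, inv_mem this]
    rw [← aeval_algebraMap_apply]
    exact (IntermediateField.adjoin_simple_le_iff.2 hτF)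
      ((IntermediateField.mem_adjoin_simple_iff k _).2 ⟨q, 1, by simp⟩)
  let _ : Algebra A F := ((algebraMap A K).codRestrict F hAF).toAlgebra
  have : IsScalarTower A F K := .of_algebraMap_eq fun _ => rfl
  have : FaithfulSMul A F := (faithfulSMul_iff_algebraMap_injective A F).2
    fun a b hab => hinj (congrArg Subtype.val hab)
  -- Whether τ is t or its inverse, k(τ) = k(t).
  have : IsFractionRing A F := by
    refine IsFractionRing.of_field A F fun z => ?_
    have hF : F ≤ IntermediateField.adjoin k {algebraMap A K τ} := by
      rw [IntermediateField.adjoin_simple_le_iff]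
      have := IntermediateField.mem_adjoin_simple_self k (algebraMap A K τ)
      rcases ht with ht | ht <;> rw [ht] at this ⊢
      · exact this
      · simpa using inv_mem this
    obtain ⟨q, r, hqr⟩ := (IntermediateField.mem_adjoin_simple_iff k _).1 (hF z.2)
    refine ⟨aeval τ q, aeval τ r, Subtype.ext ?_⟩
    rw [hqr, aeval_algebraMap_apply, aeval_algebraMap_apply]
    rfl
  have : IsDomain C := (IsIntegralClosure.algebraMap_injective C A K).isDomain (algebraMap C K)
  have := IsIntegralClosure.isFractionRing_of_finite_extension A F K C
  have := IsIntegralClosure.isDedekindDomain A F K C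
  have := IsIntegralClosure.finite A F K C
  have := IsIntegralClosure.isIntegral_algebra A K (A := C)
  have : FaithfulSMul A K := (faithfulSMul_iff_algebraMap_injective A K).2 hinj
  have : Module.IsTorsionFree A K := inferInstance
  have : Module.IsTorsionFree A C := IsIntegralClosure.isTorsionFree A K
  refine ⟨inferInstance, inferInstance, inferInstance, inferInstance, inferInstance, ?_⟩
  exact IsGaloisGroup.of_isFractionRing _ A C F K

/-- By the Nullstellensatz the residue field at a maximal ideal is finite over k, hence equal to k.
-/
theorem exists_sub_mem_of_isMaximal [IsAlgClosed k] (hτ : Function.Surjective (aeval (R := k) τ))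
    [Module.Finite A C] (P : Ideal C) [P.IsMaximal] (c : C) :
    ∃ r : k, c - algebraMap A C (algebraMap k A r) ∈ P := by
  let _ : Algebra k C := ((algebraMap A C).comp (algebraMap k A)).toAlgebra
  have : IsScalarTower k A C := .of_algebraMap_eq fun _ => rfl
  have : Algebra.FiniteType k A := .of_surjective (aeval (R := k) τ) hτ
  have : Algebra.FiniteType k C := .trans this inferInstance
  let _ := Ideal.Quotient.field P
  have : Module.Finite k (C ⧸ P) := finite_of_finite_type_of_isJacobsonRing k (C ⧸ P)
  obtain ⟨r, hr⟩ := (IsAlgClosed.algebraMap_bijective_of_isIntegral (k := k) (K := C ⧸ P)).2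
    (Ideal.Quotient.mk P c)
  exact ⟨r, Ideal.Quotient.eq.1 hr.symm⟩

end Chart

/-! ### Étaleness over the affine line -/

section Chart

open Polynomial

variable {k : Type*} [Field k] {p : ℕ} [CharP k p] {K : Type*} [Field K]
  [Algebra k K] [MulSemiringAction (Matrix.SpecialLinearGroup (Fin 2) (ZMod p)) K] {u v : K}
  {A C : Type*} [CommRing A] [CommRing C] [Algebra k A] [Algebra A C] [Algebra C K] [Algebra A K]
  [IsScalarTower A C K] [IsScalarTower k A K] {τ : A}

/-- The residue field is a copy of k. Perfectness is what makes the order of inertia equal to the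
ramification index. -/
theorem perfectField_residueField [IsAlgClosed k] (hτ : Function.Surjective (aeval (R := k) τ))
    (q : Ideal A) [q.IsMaximal] : PerfectField q.ResidueField := by
  have hsurj : Function.Surjective ((algebraMap A q.ResidueField).comp (algebraMap k A)) := by
    intro z
    obtain ⟨a, rfl⟩ := q.algebraMap_residueField_surjective z
    obtain ⟨r, hr⟩ := exists_sub_mem_of_isMaximal hτ (C := A) q a
    refine ⟨r, ?_⟩
    rw [← sub_eq_zero, RingHom.comp_apply, ← map_sub, q.algebraMap_residueField_eq_zero]
    exact sub_mem_comm_iff.1 hr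
  exact PerfectField.of_ringEquiv (RingEquiv.ofBijective _ ⟨RingHom.injective _, hsurj⟩)

section Finite

variable [Fact p.Prime] [IsAlgClosed k] (h : IsDrinfeldField k p u v)
    (hτ : Function.Surjective (aeval (R := k) τ))
    (ht : algebraMap A K τ = dicksonInvariant p u v)
    [IsIntegralClosure C A K] [MulSemiringAction (Matrix.SpecialLinearGroup (Fin 2) (ZMod p)) C]
    [SMulDistribClass (Matrix.SpecialLinearGroup (Fin 2) (ZMod p)) C K]

omit [IsAlgClosed k] in
include h ht in
/-- Away from `∞` the inertia groups are trivial. -/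
theorem IsDrinfeldField.inertia_eq_bot (P : Ideal C) [P.IsPrime] :
    P.inertia (Matrix.SpecialLinearGroup (Fin 2) (ZMod p)) = ⊥ := by
  have hint (z : K) (hz : z ^ p ^ 2 - dicksonInvariant p u v * z ^ p + z = 0) :
      ∃ c : C, algebraMap C K c = z := by
    refine IsIntegralClosure.isIntegral_iff (A := C) (R := A).1 ?_
    have := (algebraMap A K).domain_nontrivial
    obtain ⟨hm, -⟩ := IsDrinfeldField.natDegree_linearized (Fact.out : p.Prime).one_lt τ
    exact ⟨_, hm, by simpa [ht] using hz⟩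
  obtain ⟨u₀, hu⟩ := hint u h.root_fst
  obtain ⟨v₀, hv⟩ := hint v h.root_snd
  have hinj := IsIntegralClosure.algebraMap_injective C A K
  let c : ZMod p →+* C := ((algebraMap A C).comp (algebraMap k A)).comp (ZMod.castHom dvd_rfl k)
  have hc (a : ZMod p) : algebraMap C K (c a) = primeCoeff k p K a := by
    simp only [c, RingHom.comp_apply, primeCoeff]
    rw [← IsScalarTower.algebraMap_apply A C K, ← IsScalarTower.algebraMap_apply k A K]
  have hsmul (g : Matrix.SpecialLinearGroup (Fin 2) (ZMod p)) (z : C) :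
      algebraMap C K (g • z) = g • algebraMap C K z := algebraMap.coe_smul' g z K
  -- Pairing au + bv with v, respectively u, in the form X^p Y - X Y^p returns the coefficient a,
  -- respectively b. A nonzero element of 𝔽_p is a unit, so it cannot lie in the prime.
  have key (a b : ZMod p) (hab : c a * u₀ + c b * v₀ ∈ P) : a = 0 ∧ b = 0 := by
    have hunit (a : ZMod p) (ha : c a ∈ P) : a = 0 := by
      by_contra ha0
      exact Ideal.IsPrime.ne_top ‹_› (P.eq_top_of_isUnit_mem ha ((IsUnit.mk0 a ha0).map c))
    have hpp : p ≠ 0 := (Fact.out : p.Prime).ne_zero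
    have e1 : c a = (c a * u₀ + c b * v₀) ^ p * v₀ - (c a * u₀ + c b * v₀) * v₀ ^ p := by
      refine hinj ?_
      have := dickson_linear_substitution (k := k) a b 0 1 u v 1
      simp only [pow_one, map_zero, map_one, zero_mul, zero_add, one_mul, mul_one, mul_zero,
        sub_zero, h.eqn] at this
      simp only [map_sub, map_add, map_mul, map_pow, hc, hu, hv, this]
    have e2 : c b = u₀ ^ p * (c a * u₀ + c b * v₀) - u₀ * (c a * u₀ + c b * v₀) ^ p := by
      refine hinj ?_
      have := dickson_linear_substitution (k := k) 1 0 a b u v 1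
      simp only [pow_one, map_zero, map_one, zero_mul, add_zero, one_mul, mul_one,
        sub_zero, h.eqn] at this
      simp only [map_sub, map_add, map_mul, map_pow, hc, hu, hv, this]
    refine ⟨hunit a ?_, hunit b ?_⟩
    · rw [e1]
      exact P.sub_mem (P.mul_mem_right _ (P.pow_mem_of_mem hab _ (pos_of_ne_zero hpp)))
        (P.mul_mem_right _ hab)
    · rw [e2]
      exact P.sub_mem (P.mul_mem_left _ hab)
        (P.mul_mem_left _ (P.pow_mem_of_mem hab _ (pos_of_ne_zero hpp)))
  rw [eq_bot_iff]
  intro g hg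
  obtain ⟨A, rfl⟩ : ∃ A, g = A⁻¹ := ⟨g⁻¹, (inv_inv g).symm⟩
  have h1 := key (A 0 0 - 1) (A 0 1) (by
    have e : c (A 0 0 - 1) * u₀ + c (A 0 1) * v₀ = A⁻¹ • u₀ - u₀ := hinj (by
      simp only [map_sub, map_add, map_mul, map_one, hsmul, hc, hu, hv, h.inv_smul_fst]
      ring)
    rw [e]
    exact hg u₀)
  have h2 := key (A 1 0) (A 1 1 - 1) (by
    have e : c (A 1 0) * u₀ + c (A 1 1 - 1) * v₀ = A⁻¹ • v₀ - v₀ := hinj (by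
      simp only [map_sub, map_add, map_mul, map_one, hsmul, hc, hu, hv, h.inv_smul_snd]
      ring)
    rw [e]
    exact hg v₀)
  rw [Subgroup.mem_bot, inv_eq_one]
  refine Matrix.SpecialLinearGroup.ext _ _ fun i j => ?_
  fin_cases i <;> fin_cases j
  exacts [sub_eq_zero.1 h1.1, h1.2, h2.1, sub_eq_zero.1 h2.2]

include h hτ ht in
-- Trivial inertia gives ramification index 1, so the extension is unramified at the maximal ideals;
-- the unramified locus is open, hence everything. Flatness then gives étaleness.
theorem IsDrinfeldField.etale : Algebra.Etale A C := by
  obtain ⟨_, _, _, _, _, _⟩ := h.chart (C := C) hτ (.inl ht)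
  have : Algebra.FinitePresentation A C := Algebra.FinitePresentation.of_finiteType.1 inferInstance
  have hmax (q : Ideal C) [q.IsMaximal] : Algebra.IsUnramifiedAt A q := by
    have : (q.under A).IsMaximal := inferInstance
    have := perfectField_residueField hτ (q.under A)
    rw [← Ideal.ramificationIdx_eq_one_iff, ← Ideal.ramificationIdxIn_eq_ramificationIdx (q.under A)
      q (Matrix.SpecialLinearGroup (Fin 2) (ZMod p)), ← Ideal.card_inertia_eq_ramificationIdxIn
      (G := Matrix.SpecialLinearGroup (Fin 2) (ZMod p)) (q.under A) q, h.inertia_eq_bot ht]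
    simp
  have hun : Algebra.FormallyUnramified A C := by
    rw [← Algebra.unramifiedLocus_eq_univ_iff, Set.eq_univ_iff_forall]
    intro q
    obtain ⟨m, hm, hqm⟩ := Ideal.exists_le_maximal _ q.2.ne_top
    have hsp : q ⤳ ⟨m, hm.isPrime⟩ := (PrimeSpectrum.le_iff_specializes _ _).1 hqm
    exact hsp.mem_open Algebra.isOpen_unramifiedLocus (hmax m)
  exact .of_formallyUnramified_of_flat

end Finite

end Chart

/-! ### Orders of u, v and t at the poles of t -/

section Valuation

variable {k : Type*} [Field k] {p : ℕ} [Fact p.Prime] [CharP k p] {K : Type*} [Field K]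
  [Algebra k K]

/-- The elements of 𝔽_p are the roots of X^p - X. The factorization shows that where x^p - x
vanishes, x is congruent to an element of 𝔽_p. -/
theorem prod_sub_primeCoeff (x : K) : ∏ a : ZMod p, (x - primeCoeff k p K a) = x ^ p - x := by
  have hroots := FiniteField.roots_X_pow_card_sub_X (ZMod p)
  rw [ZMod.card] at hroots
  have hdeg := FiniteField.X_pow_card_sub_X_natDegree_eq (ZMod p) (Fact.out : p.Prime).one_lt
  have hmonic : (Polynomial.X ^ p - Polynomial.X : Polynomial (ZMod p)).Monic :=
    Polynomial.monic_X_pow_sub (by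
      rw [Polynomial.degree_X]; exact_mod_cast (Fact.out : p.Prime).one_lt)
  have := Polynomial.prod_multiset_X_sub_C_of_monic_of_roots_card_eq hmonic (by
    rw [hroots, hdeg, ← Finset.card_def, Finset.card_univ, ZMod.card])
  rw [hroots] at this
  have h2 := congrArg (Polynomial.eval₂ (primeCoeff k p K) x) this
  simpa [Polynomial.eval₂_finsetProd, Polynomial.eval₂_sub, Polynomial.eval₂_X_pow] using h2

variable [MulSemiringAction (Matrix.SpecialLinearGroup (Fin 2) (ZMod p)) K] {u v : K}
  {Γ₀ : Type*} [LinearOrderedCommGroupWithZero Γ₀] (ν : Valuation K Γ₀)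

omit [MulSemiringAction (Matrix.SpecialLinearGroup (Fin 2) (ZMod p)) K] in
theorem valuation_primeCoeff (hν : ∀ r : k, r ≠ 0 → ν (algebraMap k K r) = 1) {a : ZMod p}
    (ha : a ≠ 0) : ν (primeCoeff k p K a) = 1 :=
  hν _ ((map_ne_zero _).2 ha)

omit [MulSemiringAction (Matrix.SpecialLinearGroup (Fin 2) (ZMod p)) K] in
theorem valuation_primeCoeff_le_one (hν : ∀ r : k, r ≠ 0 → ν (algebraMap k K r) = 1)
    (a : ZMod p) : ν (primeCoeff k p K a) ≤ 1 := by
  obtain rfl | ha := eq_or_ne a 0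
  · simp
  · exact (valuation_primeCoeff ν hν ha).le

/-- The term u^n v dominates. With n = p this is applied to the equation of the curve, with n = p²
to t. -/
theorem valuation_dickson_form_of_lt {u v : K} {n : ℕ} (hn : 1 < n) (hv : v ≠ 0)
    (huv : ν v < ν u) : ν (u ^ n * v - u * v ^ n) = ν u ^ n * ν v := by
  have hu0 : 0 < ν u := zero_le.trans_lt huv
  have hv0 : 0 < ν v := zero_lt_iff.2 ((Valuation.ne_zero_iff _).2 hv)
  rw [Valuation.map_sub_eq_of_lt_left, map_mul, map_pow]
  obtain ⟨m, rfl⟩ : ∃ m, n = m + 1 + 1 := ⟨n - 2, by omega⟩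
  have hpow : ν v ^ (m + 1) < ν u ^ (m + 1) := pow_lt_pow_left₀ huv zero_le (by omega)
  calc ν (u * v ^ (m + 1 + 1)) = ν u * ν v * ν v ^ (m + 1) := by
        rw [map_mul, map_pow, pow_succ' (ν v) (m + 1), mul_assoc]
    _ < ν u * ν v * ν u ^ (m + 1) := by gcongr
    _ = ν (u ^ (m + 1 + 1) * v) := by
        rw [map_mul, map_pow, pow_succ' (ν u) (m + 1), mul_right_comm]

namespace IsDrinfeldField

variable (h : IsDrinfeldField k p u v) (hν : ∀ r : k, r ≠ 0 → ν (algebraMap k K r) = 1)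

include h in
-- The valuation is multiplicative, so values above 1 are poles. The dominant term of the equation
-- gives that u^p v is a unit, and t behaves like u^(p²) v.
theorem valuation_of_one_lt (hx : 1 < ν (u / v)) :
    ν v < ν u ∧ ν u ^ p * ν v = 1 ∧ 1 < ν u ∧
      ν (dicksonInvariant p u v) * ν u ^ p = ν u ^ p ^ 2 := by
  have hp := (Fact.out : p.Prime).one_lt
  have hv0 : 0 < ν v := zero_lt_iff.2 ((Valuation.ne_zero_iff _).2 h.ne_zero.2)
  have huv : ν v < ν u := by
    rwa [map_div₀, one_lt_div₀ hv0] at hx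
  have h1 : ν u ^ p * ν v = 1 := by
    rw [← valuation_dickson_form_of_lt ν hp h.ne_zero.2 huv, h.eqn, map_one]
  have h2 : 1 < ν u := by
    by_contra! hle
    have : ν u ^ p * ν v < 1 :=
      (mul_le_of_le_one_left' (pow_le_one₀ zero_le hle)).trans_lt (huv.trans_le hle)
    exact this.ne h1
  refine ⟨huv, h1, h2, ?_⟩
  rw [dicksonInvariant, valuation_dickson_form_of_lt ν (Nat.one_lt_pow two_ne_zero hp)
    h.ne_zero.2 huv, mul_assoc, mul_comm (ν v), h1, mul_one]

omit [MulSemiringAction (Matrix.SpecialLinearGroup (Fin 2) (ZMod p)) K] in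
include hν in
theorem valuation_linear_of_lt (huv : ν v < ν u) {a : ZMod p} (ha : a ≠ 0) (b : ZMod p) :
    ν (primeCoeff k p K a * u + primeCoeff k p K b * v) = ν u := by
  have h1 : ν (primeCoeff k p K a * u) = ν u := by
    rw [map_mul, valuation_primeCoeff ν hν ha, one_mul]
  have h2 : ν (primeCoeff k p K b * v) ≤ ν v := by
    rw [map_mul]
    exact mul_le_of_le_one_left' (valuation_primeCoeff_le_one ν hν b)
  rw [Valuation.map_add_eq_of_lt_left, h1]
  rw [h1]
  exact h2.trans_lt huv

include h in
-- If x = u/v has no pole, then v has one, so x^p - x = v^(-(p+1)) vanishes at the point and x is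
-- congruent there to some a in 𝔽_p. A matrix sending x to -1/(x - a) creates the pole.
theorem exists_one_lt_valuation (ht : 1 < ν (dicksonInvariant p u v)) :
    ∃ A : Matrix.SpecialLinearGroup (Fin 2) (ZMod p), 1 < ν (A⁻¹ • u / A⁻¹ • v) := by
  by_cases hx : 1 < ν (u / v)
  · exact ⟨1, by simpa using hx⟩
  have hv := h.ne_zero.2
  have hv0 : 0 < ν v := zero_lt_iff.2 ((Valuation.ne_zero_iff _).2 hv)
  have huv : ν u ≤ ν v := by
    rwa [map_div₀, not_lt, div_le_one₀ hv0] at hx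
  -- Otherwise u and v would both be integral, and t with them.
  have hv1 : 1 < ν v := by
    by_contra! hle
    have hle' := huv.trans hle
    refine ht.not_ge ((ν.map_sub _ _).trans (max_le ?_ ?_)) <;> rw [map_mul, map_pow]
    · exact mul_le_one' (pow_le_one₀ zero_le hle') hle
    · exact mul_le_one' hle' (pow_le_one₀ zero_le hle)
  have hprod : ∏ a : ZMod p, ν (u / v - primeCoeff k p K a) < 1 := by
    rw [← map_prod, prod_sub_primeCoeff]
    have he : ((u / v) ^ p - u / v) * v ^ (p + 1) = 1 := by
      rw [← h.eqn]
      rw [div_pow, sub_mul, div_mul_eq_mul_div, div_mul_eq_mul_div, pow_succ, ← mul_assoc,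
        ← mul_assoc]
      field_simp
    have h1 : 1 < ν v ^ (p + 1) := one_lt_pow₀ hv1 (by omega)
    by_contra! hle
    have := congrArg ν he
    rw [map_mul, map_pow, map_one] at this
    exact (h1.trans_le (le_mul_of_one_le_left' hle)).ne' this
  obtain ⟨a, ha⟩ : ∃ a : ZMod p, ν (u / v - primeCoeff k p K a) < 1 := by
    by_contra! hle
    exact hprod.not_ge (Finset.one_le_prod' fun a _ => hle a)
  have ha0 : u / v - primeCoeff k p K a ≠ 0 := fun h0 =>
    h.nonconst (sub_eq_zero.1 h0 ▸ primeCoeff_mem_range k p K a)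
  obtain ⟨A, hA⟩ : ∃ A : Matrix.SpecialLinearGroup (Fin 2) (ZMod p),
      A 0 0 = 0 ∧ A 0 1 = -1 ∧ A 1 0 = 1 ∧ A 1 1 = -a :=
    ⟨⟨!![0, -1; 1, -a], by simp [Matrix.det_fin_two]⟩, rfl, rfl, rfl, rfl⟩
  refine ⟨A, ?_⟩
  have e : (u / v - primeCoeff k p K a) = (u - primeCoeff k p K a * v) / v := by field_simp
  rw [h.inv_smul_fst, h.inv_smul_snd, hA.1, hA.2.1, hA.2.2.1, hA.2.2.2]
  have : (primeCoeff k p K 0 * u + primeCoeff k p K (-1) * v) /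
      (primeCoeff k p K 1 * u + primeCoeff k p K (-a) * v) = - (u / v - primeCoeff k p K a)⁻¹ := by
    rw [e]
    simp only [map_neg, map_one, map_zero]
    rw [inv_div]
    ring
  rw [this, Valuation.map_neg, map_inv₀]
  exact (one_lt_inv₀ (zero_lt_iff.2 ((Valuation.ne_zero_iff _).2 ha0))).2 ha

end IsDrinfeldField

end Valuation

/-! ### Ramification groups in terms of valuations -/

section InertiaValuation

open IsDedekindDomain WithZero

variable {C : Type*} [CommRing C] [IsDedekindDomain C] {K : Type*} [Field K] [Algebra C K]
  [IsFractionRing C K] {G : Type*} [Group G] [MulSemiringAction G C] [MulSemiringAction G K]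
  [SMulDistribClass G C K] (w : HeightOneSpectrum C)

/-- The action of an element of a ramification group on the valuation ring. -/
theorem valuation_smul_sub_le {n : ℕ} (hn : n ≠ 0) {g : G} (hg : g ∈ (w.asIdeal ^ n).inertia G)
    {z : K} (hz : w.valuation K z ≤ 1) : w.valuation K (g • z - z) ≤ exp (-(n : ℤ)) := by
  have hC (c : C) : w.valuation K (g • algebraMap C K c - algebraMap C K c) ≤ exp (-(n : ℤ)) := by
    rw [← algebraMap.coe_smul' g c K, ← map_sub, w.valuation_of_algebraMap,
      w.intValuation_le_pow_iff_mem]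
    exact hg c
  have hlt : exp (-(n : ℤ)) < (1 : ℤᵐ⁰) := by
    rw [← exp_zero, exp_lt_exp]
    omega
  obtain ⟨c, ⟨d, hd⟩, hcd⟩ := w.exists_primeCompl_mul_eq_of_integer z hz
  have hd1 : w.valuation K (algebraMap C K d) = 1 := w.valuation_eq_one_iff_notMem.2 hd
  have hgd1 : w.valuation K (g • algebraMap C K d) = 1 := by
    rw [← sub_add_cancel (g • algebraMap C K d) (algebraMap C K d),
      Valuation.map_add_eq_of_lt_right, hd1]
    rw [hd1]
    exact (hC d).trans_lt hlt
  have hgz : (g • z) * (g • algebraMap C K d) = g • algebraMap C K c := by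
    rw [← smul_mul', hcd]
  -- A quotient rule for z = c/d: it reduces the estimate to elements of C, because g • d is a unit
  -- at the prime.
  have key : (g • z - z) * (g • algebraMap C K d) =
      (g • algebraMap C K c - algebraMap C K c) - z * (g • algebraMap C K d - algebraMap C K d) := by
    linear_combination hgz - hcd
  have := congrArg (w.valuation K) key
  rw [map_mul, hgd1, mul_one] at this
  rw [this]
  refine (Valuation.map_sub _ _ _).trans (max_le (hC c) ?_)
  rw [map_mul]
  exact (mul_le_of_le_one_left' hz).trans (hC d)

theorem mem_inertia_pow_of_valuation_le {n : ℕ} {g : G}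
    (hg : ∀ z : K, w.valuation K z ≤ 1 → w.valuation K (g • z - z) ≤ exp (-(n : ℤ))) :
    g ∈ (w.asIdeal ^ n).inertia G := by
  intro c
  have := hg (algebraMap C K c) (w.valuation_le_one c)
  rwa [← algebraMap.coe_smul' g c K, ← map_sub, w.valuation_of_algebraMap,
    w.intValuation_le_pow_iff_mem] at this

/-- An element `g` of the inertia group such that `g • π - π` has valuation `n`, for a uniformizer
`π`, acts trivially modulo the `n`-th power of the maximal ideal. -/
theorem mem_inertia_pow_of_uniformizer {n : ℕ} {g : G} (hg : g ∈ w.asIdeal.inertia G) {π : K}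
    (hπ : w.valuation K π = exp (-1 : ℤ)) (hgπ : w.valuation K (g • π - π) ≤ exp (-(n : ℤ)))
    (hres : ∀ z : K, w.valuation K z ≤ 1 → ∃ r : K, g • r = r ∧ w.valuation K (z - r) < 1) :
    g ∈ (w.asIdeal ^ n).inertia G := by
  refine mem_inertia_pow_of_valuation_le (K := K) w ?_
  have h1 {z : K} (hz : w.valuation K z ≤ 1) : w.valuation K (g • z - z) ≤ exp (-1 : ℤ) := by
    simpa using valuation_smul_sub_le (K := K) w one_ne_zero (by rwa [pow_one]) hz
  have hle1 : exp (-1 : ℤ) ≤ (1 : ℤᵐ⁰) := by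
    rw [← exp_zero, exp_le_exp]; omega
  have hgπ1 : w.valuation K (g • π) ≤ exp (-1 : ℤ) := by
    rw [← sub_add_cancel (g • π) π]
    exact (Valuation.map_add _ _ _).trans (max_le (h1 (hπ.le.trans hle1)) hπ.le)
  have hπ0 : π ≠ 0 := by
    rintro rfl
    rw [map_zero] at hπ
    exact exp_ne_zero hπ.symm
  -- Induction on the precision m. Subtracting a fixed representative r of the residue of z leaves π
  -- z'; in the resulting product rule the factor g • π raises the precision known for z' by one,
  -- and the other term is controlled by g • π - π.
  suffices H : ∀ m ≤ n, ∀ z : K, w.valuation K z ≤ 1 →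
      w.valuation K (g • z - z) ≤ exp (-(m : ℤ)) from H n le_rfl
  intro m
  induction m with
  | zero => exact fun _ z hz => (h1 hz).trans (by simpa using hle1)
  | succ m ih =>
    intro hm z hz
    obtain ⟨r, hr, hzr⟩ := hres z hz
    have hz' : w.valuation K ((z - r) / π) ≤ 1 := by
      rw [map_div₀, hπ, div_le_one₀ (by simp)]
      have := (WithZero.lt_mul_exp_iff_le (x := w.valuation K (z - r)) (y := exp (-1 : ℤ)) (by simp)).1
        (by rwa [← exp_add, neg_add_cancel, exp_zero])
      exact this
    set z' := (z - r) / π with hz'_def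
    have hzz' : z = r + π * z' := by
      rw [hz'_def]
      field_simp
      ring
    have e : g • z - z = (g • π) * (g • z' - z') + (g • π - π) * z' := by
      rw [hzz', smul_add, smul_mul', hr]
      ring
    rw [e]
    refine (Valuation.map_add _ _ _).trans (max_le ?_ ?_) <;> rw [map_mul]
    · calc _ ≤ exp (-1 : ℤ) * exp (-(m : ℤ)) := mul_le_mul' hgπ1 (ih (by omega) z' hz')
        _ = _ := by rw [← exp_add]; congr 1; push_cast; ring
    · refine (mul_le_of_le_one_right' hz').trans (hgπ.trans ?_)
      rw [exp_le_exp]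
      omega

end InertiaValuation

section InertiaSMul

open scoped Pointwise

/-- Translating the point conjugates all its ramification groups, so their orders and triviality may
be computed at any point of the orbit. -/
theorem inertia_smul {R G : Type*} [CommRing R] [Group G] [MulSemiringAction G R] (a : G)
    (I : Ideal R) : (a • I).inertia G = (I.inertia G).map (MulAut.conj a).toMonoidHom := by
  ext g
  rw [Subgroup.mem_map_equiv, MulAut.conj_symm_apply]
  constructor
  · intro hg x
    have := hg (a • x)
    rw [Submodule.mem_toAddSubgroup, Ideal.mem_pointwise_smul_iff_inv_smul_mem, smul_sub] at this
    simpa [mul_smul] using this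
  · intro hg x
    rw [Submodule.mem_toAddSubgroup, Ideal.mem_pointwise_smul_iff_inv_smul_mem, smul_sub]
    simpa [mul_smul] using hg (a⁻¹ • x)

end InertiaSMul

theorem valuation_algebraMap_eq_one {k : Type*} [Field k] {C : Type*} [CommRing C]
    [IsDedekindDomain C] {K : Type*} [Field K] [Algebra C K] [IsFractionRing C K] [Algebra k K]
    (φ : k →+* C) (hφ : ∀ r, algebraMap C K (φ r) = algebraMap k K r)
    (w : IsDedekindDomain.HeightOneSpectrum C) (r : k) (hr : r ≠ 0) :
    w.valuation K (algebraMap k K r) = 1 := by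
  rw [← hφ, w.valuation_eq_one_iff_notMem]
  exact fun hmem => w.isPrime.ne_top (Ideal.eq_top_of_isUnit_mem _ hmem
    ((IsUnit.mk0 _ hr).map φ))

/-! ### Inertia and conductor above ∞ -/

section ChartAtInfinity

open Polynomial IsDedekindDomain WithZero

variable {k : Type*} [Field k] {p : ℕ} [CharP k p] {K : Type*} [Field K]
  [Algebra k K] [MulSemiringAction (Matrix.SpecialLinearGroup (Fin 2) (ZMod p)) K] {u v : K}
  {A C : Type*} [CommRing A] [CommRing C] [Algebra k A] [Algebra A C] [Algebra C K] [Algebra A K]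
  [IsScalarTower A C K] [IsScalarTower k A K] {τ : A}
  [Fact p.Prime] [IsAlgClosed k] (h : IsDrinfeldField k p u v)
  (hτ : Function.Surjective (aeval (R := k) τ))
  (ht : algebraMap A K τ = (dicksonInvariant p u v)⁻¹)
  [IsIntegralClosure C A K] [MulSemiringAction (Matrix.SpecialLinearGroup (Fin 2) (ZMod p)) C]
  [SMulDistribClass (Matrix.SpecialLinearGroup (Fin 2) (ZMod p)) C K]
  (P : Ideal C) [P.IsPrime] (hP : algebraMap A C τ ∈ P)

omit [Fact p.Prime] in
/-- The upper triangular matrices of determinant one are determined by the first row. -/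
theorem eq_of_lower_left_eq_zero {R : Type*} [CommRing R]
    {A B : Matrix.SpecialLinearGroup (Fin 2) R} (hA : A 1 0 = 0) (hB : B 1 0 = 0)
    (h0 : A 0 0 = B 0 0) (h1 : A 0 1 = B 0 1) : A = B := by
  have hA' := Matrix.SpecialLinearGroup.det_fin_two_eq_one A
  have hB' := Matrix.SpecialLinearGroup.det_fin_two_eq_one B
  rw [hA, mul_zero, sub_zero] at hA'
  rw [hB, mul_zero, sub_zero, ← h0] at hB'
  have h2 : A 1 1 = B 1 1 := by linear_combination A 1 1 * hB' * (-1) + B 1 1 * hA'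
  refine Matrix.SpecialLinearGroup.ext _ _ fun i j => ?_
  fin_cases i <;> fin_cases j
  exacts [h0, h1, hA.trans hB.symm, h2]

omit [CharP k p] [Algebra C K] [Algebra A K] [IsScalarTower A C K] [IsScalarTower k A K]
  [Fact p.Prime] [IsAlgClosed k] [MulSemiringAction (Matrix.SpecialLinearGroup (Fin 2) (ZMod p)) C]
  [Field K] [Algebra k K] [MulSemiringAction (Matrix.SpecialLinearGroup (Fin 2) (ZMod p)) K] in
include hτ hP in
-- Modulo τ an element of A is a constant, and a nonzero constant is a unit, so it does not lie in
-- the prime.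
theorem under_eq_span_singleton : P.under A = Ideal.span {τ} := by
  refine le_antisymm (fun a ha => ?_) ((Ideal.span_singleton_le_iff_mem _).2 hP)
  obtain ⟨q, rfl⟩ := hτ a
  rw [← q.X_mul_divX_add] at ha ⊢
  simp only [map_add, map_mul, aeval_X, aeval_C] at ha ⊢
  have hd : τ * aeval τ q.divX ∈ Ideal.span {τ} :=
    Ideal.mul_mem_right _ _ (Ideal.mem_span_singleton_self τ)
  have h0 : algebraMap A C (algebraMap k A (q.coeff 0)) ∈ P := by
    have := P.sub_mem ha (P.mul_mem_right (algebraMap A C (aeval τ q.divX)) hP)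
    rwa [map_add, map_mul, add_sub_cancel_left] at this
  have : q.coeff 0 = 0 := by
    by_contra hne
    exact Ideal.IsPrime.ne_top ‹_›
      (P.eq_top_of_isUnit_mem h0 (((IsUnit.mk0 _ hne).map (algebraMap k A)).map (algebraMap A C)))
  rw [this, map_zero, add_zero]
  exact hd

section Pole

variable [IsDedekindDomain C] [IsFractionRing C K] (w : HeightOneSpectrum C)
    (hx : 1 < w.valuation K (u / v))

omit [IsAlgClosed k] in
include h hx in
-- The function v is regular at the point, so inertia moves it by a function that vanishes there. A
-- nonzero lower left entry would contribute the pole of u.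
theorem IsDrinfeldField.lower_left_eq_zero {B : Matrix.SpecialLinearGroup (Fin 2) (ZMod p)}
    (hν : ∀ r : k, r ≠ 0 → w.valuation K (algebraMap k K r) = 1)
    (hB : B⁻¹ ∈ w.asIdeal.inertia (Matrix.SpecialLinearGroup (Fin 2) (ZMod p))) : B 1 0 = 0 := by
  obtain ⟨huv, h1, hu, -⟩ := h.valuation_of_one_lt (w.valuation K) hx
  have hv1 : w.valuation K v ≤ 1 := by
    rw [← h1]
    exact le_mul_of_one_le_left' (one_le_pow₀ hu.le)
  by_contra h10
  have := valuation_smul_sub_le (K := K) w one_ne_zero (by rwa [pow_one]) hv1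
  rw [h.inv_smul_snd] at this
  have e : primeCoeff k p K (B 1 0) * u + primeCoeff k p K (B 1 1) * v - v =
      primeCoeff k p K (B 1 0) * u + primeCoeff k p K (B 1 1 - 1) * v := by
    rw [map_sub, map_one]
    ring
  rw [e, valuation_linear_of_lt _ hν huv h10] at this
  refine hu.not_ge (this.trans ?_)
  rw [← exp_zero, exp_le_exp]
  omega

omit [IsIntegralClosure C A K] in
include h hτ ht hx in
/-- The structure of the inertia group at a point above `∞` where `u / v` has a pole, together
with the value of `u`. -/
theorem IsDrinfeldField.inertia_of_pole [IsDedekindDomain A] [Module.Finite A C] [Module.Flat A C]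
    [IsGaloisGroup (Matrix.SpecialLinearGroup (Fin 2) (ZMod p)) A C]
    (hP : algebraMap A C τ ∈ w.asIdeal) :
    Nat.card (w.asIdeal.inertia (Matrix.SpecialLinearGroup (Fin 2) (ZMod p))) = p * (p - 1) ∧
      w.valuation K u = exp (1 : ℤ) ∧
      ∀ B : Matrix.SpecialLinearGroup (Fin 2) (ZMod p), B 1 0 = 0 →
        B⁻¹ ∈ w.asIdeal.inertia (Matrix.SpecialLinearGroup (Fin 2) (ZMod p)) := by
  have hp := (Fact.out : p.Prime).one_lt
  have hν := valuation_algebraMap_eq_one (k := k) (K := K)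
    ((algebraMap A C).comp (algebraMap k A)) (fun r => by
      rw [RingHom.comp_apply, ← IsScalarTower.algebraMap_apply A C K,
        ← IsScalarTower.algebraMap_apply k A K]) w
  obtain ⟨huv, h1, hu, hνt⟩ := h.valuation_of_one_lt (w.valuation K) hx
  have hτ0 : algebraMap A C τ ≠ 0 := by
    intro h0
    have ht' := ht
    rw [IsScalarTower.algebraMap_apply A C K, h0, map_zero, eq_comm, inv_eq_zero] at ht'
    exact h.transcendental_dicksonInvariant (ht' ▸ isAlgebraic_zero)
  have hspan := under_eq_span_singleton hτ w.asIdeal hP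
  have hmap : (w.asIdeal.under A).map (algebraMap A C) = Ideal.span {algebraMap A C τ} := by
    rw [hspan, Ideal.map_span, Set.image_singleton]
  have : w.asIdeal.IsMaximal := w.isMaximal
  have : (w.asIdeal.under A).IsMaximal := inferInstance
  have := perfectField_residueField hτ (w.asIdeal.under A)
  have hcard : Nat.card (w.asIdeal.inertia (Matrix.SpecialLinearGroup (Fin 2) (ZMod p))) =
      multiplicity w.asIdeal (Ideal.span {algebraMap A C τ}) := by
    rw [Ideal.card_inertia_eq_ramificationIdxIn (w.asIdeal.under A),
      Ideal.ramificationIdxIn_eq_ramificationIdx (w.asIdeal.under A) w.asIdeal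
        (Matrix.SpecialLinearGroup (Fin 2) (ZMod p)),
      Ideal.IsDedekindDomain.ramificationIdx_eq_multiplicity (w.asIdeal.under A), hmap]
    rw [hmap]
    simpa using hτ0
  obtain ⟨m, hm⟩ : ∃ m : ℤ, w.valuation K u = exp m := ⟨_, (exp_log (by
    rw [Valuation.ne_zero_iff]; exact h.ne_zero.1)).symm⟩
  -- The order of inertia is the ramification index, that is, the pole order of t. If u has a pole
  -- of order m, this is m p² - m p.
  have he : (Nat.card (w.asIdeal.inertia (Matrix.SpecialLinearGroup (Fin 2) (ZMod p))) : ℤ) =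
      m * (p ^ 2 - p) := by
    have hvt : w.valuation K (dicksonInvariant p u v) =
        exp (Nat.card (w.asIdeal.inertia (Matrix.SpecialLinearGroup (Fin 2) (ZMod p))) : ℤ) := by
      rw [← inv_inv (dicksonInvariant p u v), ← ht, IsScalarTower.algebraMap_apply A C K, map_inv₀,
        w.valuation_of_algebraMap, w.intValuation_eq_exp_neg_multiplicity hτ0, hcard, exp_neg,
        inv_inv]
    rw [hvt, hm, ← exp_nsmul, ← exp_nsmul, ← exp_add, exp_inj] at hνt
    simp only [nsmul_eq_mul] at hνt
    push_cast at hνt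
    linear_combination hνt
  have hm0 : 0 < m := by
    rwa [hm, ← exp_zero, exp_lt_exp] at hu
  have hlow (g : w.asIdeal.inertia (Matrix.SpecialLinearGroup (Fin 2) (ZMod p))) :
      g.1⁻¹ 1 0 = 0 :=
    h.lower_left_eq_zero w hx hν (by rw [inv_inv]; exact g.2)
  have hdet {B : Matrix.SpecialLinearGroup (Fin 2) (ZMod p)} (hB : B 1 0 = 0) :
      B 0 0 * B 1 1 = 1 := by
    simpa [hB] using Matrix.SpecialLinearGroup.det_fin_two_eq_one B
  let f : w.asIdeal.inertia (Matrix.SpecialLinearGroup (Fin 2) (ZMod p)) →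
      (ZMod p)ˣ × ZMod p := fun g =>
    (Units.mkOfMulEqOne (g.1⁻¹ 0 0) (g.1⁻¹ 1 1) (hdet (hlow g)), g.1⁻¹ 0 1)
  have hf : Function.Injective f := by
    intro g g' hgg'
    have h2 := eq_of_lower_left_eq_zero (hlow g) (hlow g') (congrArg (fun z => z.1.1) hgg')
      (congrArg Prod.snd hgg')
    exact Subtype.ext (inv_injective h2)
  have hcard2 : Nat.card ((ZMod p)ˣ × ZMod p) = (p - 1) * p := by
    rw [Nat.card_prod, Nat.card_eq_fintype_card, ZMod.card_units, Nat.card_zmod]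
  have hle : Nat.card (w.asIdeal.inertia (Matrix.SpecialLinearGroup (Fin 2) (ZMod p))) ≤
      (p - 1) * p := 
    hcard2 ▸ Nat.card_le_card_of_injective f hf
  -- The order m(p² - p) with m > 0 is at most (p - 1)p, the number of upper triangular matrices of
  -- determinant 1. Hence m = 1, and every such matrix is in the inertia group.
  have hcard3 : Nat.card (w.asIdeal.inertia (Matrix.SpecialLinearGroup (Fin 2) (ZMod p))) =
      (p - 1) * p ∧ m = 1 := by
    zify [hp.le] at hle ⊢
    rw [he] at hle ⊢
    have hpos : (0 : ℤ) < p ^ 2 - p := by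
      have : (1 : ℤ) < p := by exact_mod_cast hp
      nlinarith
    have : m = 1 := by
      by_contra hne
      have : 2 ≤ m := by omega
      nlinarith
    exact ⟨by rw [this]; ring, this⟩
  refine ⟨by rw [hcard3.1, mul_comm], by rw [hm, hcard3.2], fun B hB => ?_⟩
  have hbij : Function.Bijective f :=
    (Nat.bijective_iff_injective_and_card f).2 ⟨hf, hcard3.1.trans hcard2.symm⟩
  obtain ⟨g, hg⟩ := hbij.2 (Units.mkOfMulEqOne (B 0 0) (B 1 1) (hdet hB), B 0 1)
  have := eq_of_lower_left_eq_zero (hlow g) hB (congrArg (fun z => z.1.1) hg)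
    (congrArg Prod.snd hg)
  rw [← this, inv_inv]
  exact g.2

omit [IsIntegralClosure C A K] in
include h hτ ht hx in
/-- The conductor at a point above `∞` where `u / v` has a pole. -/
theorem IsDrinfeldField.conductor_of_pole [IsDedekindDomain A] [Module.Finite A C] [Module.Flat A C]
    [IsGaloisGroup (Matrix.SpecialLinearGroup (Fin 2) (ZMod p)) A C]
    (hP : algebraMap A C τ ∈ w.asIdeal) :
    (w.asIdeal ^ (p + 2)).inertia (Matrix.SpecialLinearGroup (Fin 2) (ZMod p)) ≠ ⊥ ∧
      ∀ i, p + 1 < i →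
        (w.asIdeal ^ (i + 1)).inertia (Matrix.SpecialLinearGroup (Fin 2) (ZMod p)) = ⊥ := by
  have hp := (Fact.out : p.Prime).one_lt
  have hconst (r : k) : algebraMap C K (algebraMap A C (algebraMap k A r)) = algebraMap k K r := by
    rw [← IsScalarTower.algebraMap_apply A C K, ← IsScalarTower.algebraMap_apply k A K]
  have hν := valuation_algebraMap_eq_one (k := k) (K := K)
    ((algebraMap A C).comp (algebraMap k A)) hconst w
  obtain ⟨huv, h1, -, -⟩ := h.valuation_of_one_lt (w.valuation K) hx
  obtain ⟨-, hu1, hinertia⟩ := h.inertia_of_pole hτ ht w hx hP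
  have hvv : w.valuation K v = exp (-(p : ℤ)) := by
    rw [hu1, ← exp_nsmul] at h1
    rw [← mul_right_inj' (exp_ne_zero (a := p • (1 : ℤ))), h1, ← exp_add, ← exp_zero, exp_inj]
    simp
  have hπ : w.valuation K u⁻¹ = exp (-1 : ℤ) := by
    rw [map_inv₀, hu1, exp_neg]
  -- The difference of 1/(au + bv) and 1/u has numerator (1 - a)u - bv, while its denominator u(au +
  -- bv) has a pole of order 2.
  have hdiff {B : Matrix.SpecialLinearGroup (Fin 2) (ZMod p)} (hB : B 0 0 ≠ 0) :
      w.valuation K (B⁻¹ • u⁻¹ - u⁻¹) =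
        w.valuation K (primeCoeff k p K (1 - B 0 0) * u + primeCoeff k p K (- B 0 1) * v) *
          exp (-2 : ℤ) := by
    have hlin := valuation_linear_of_lt (w.valuation K) hν huv hB (B 0 1)
    have hlin0 : primeCoeff k p K (B 0 0) * u + primeCoeff k p K (B 0 1) * v ≠ 0 := by
      rw [← Valuation.ne_zero_iff (w.valuation K), hlin, hu1]
      exact exp_ne_zero
    have hu0 := h.ne_zero.1
    have e : B⁻¹ • u⁻¹ - u⁻¹ =
        (primeCoeff k p K (1 - B 0 0) * u + primeCoeff k p K (- B 0 1) * v) *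
          (u * (primeCoeff k p K (B 0 0) * u + primeCoeff k p K (B 0 1) * v))⁻¹ := by
      rw [smul_inv'', h.inv_smul_fst, map_sub, map_neg, map_one]
      field_simp
      ring
    rw [e, map_mul, map_inv₀, map_mul, hlin, hu1, ← exp_add, ← exp_neg]
    norm_num
  have hdiff1 {B : Matrix.SpecialLinearGroup (Fin 2) (ZMod p)} (hB : B 0 0 = 1)
      (hB1 : B 0 1 ≠ 0) :
      w.valuation K (B⁻¹ • u⁻¹ - u⁻¹) = exp (-((p + 2 : ℕ) : ℤ)) := by
    rw [hdiff (by rw [hB]; exact one_ne_zero), hB, sub_self, map_zero, zero_mul, zero_add, map_mul,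
      valuation_primeCoeff _ hν (neg_ne_zero.2 hB1), one_mul, hvv, ← exp_add]
    congr 1
    push_cast
    ring
  constructor
  -- A transvection moves the uniformizer 1/u by order p + 2. As G_i is defined modulo the power i +
  -- 1, it lies in G_(p+1).
  · let B : Matrix.SpecialLinearGroup (Fin 2) (ZMod p) :=
      ⟨!![1, 1; 0, 1], by simp [Matrix.det_fin_two]⟩
    have hmem : B⁻¹ ∈ (w.asIdeal ^ (p + 2)).inertia
        (Matrix.SpecialLinearGroup (Fin 2) (ZMod p)) := by
      refine mem_inertia_pow_of_uniformizer (K := K) w (hinertia B rfl) hπ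
        (hdiff1 rfl one_ne_zero).le fun z hz => ?_
      obtain ⟨c, ⟨d, hd⟩, hcd⟩ := w.exists_primeCompl_mul_eq_of_integer z hz
      have : w.asIdeal.IsMaximal := w.isMaximal
      obtain ⟨r, hr⟩ := exists_sub_mem_of_isMaximal hτ w.asIdeal c
      obtain ⟨s, hs⟩ := exists_sub_mem_of_isMaximal hτ w.asIdeal d
      -- The residue of z = c/d is the quotient r/s of constants, which the group fixes.
      have hs0 : s ≠ 0 := by
        rintro rfl
        rw [map_zero, map_zero, sub_zero] at hs
        exact hd hs
      refine ⟨algebraMap k K (r / s), h.smul_const _ _, ?_⟩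
      have hd1 : w.valuation K (algebraMap C K d) = 1 := w.valuation_eq_one_iff_notMem.2 hd
      have hsK : algebraMap k K s ≠ 0 := (_root_.map_ne_zero _).2 hs0
      have e : (z - algebraMap k K (r / s)) * (algebraMap C K d * algebraMap k K s) =
          algebraMap C K ((c - algebraMap A C (algebraMap k A r)) *
            algebraMap A C (algebraMap k A s) - algebraMap A C (algebraMap k A r) *
            (d - algebraMap A C (algebraMap k A s))) := by
        simp only [map_sub, map_mul, hconst, map_div₀]
        rw [← hcd]
        field_simp
        ring
      have := congrArg (w.valuation K) e
      rw [map_mul, map_mul, hd1, hν s hs0, one_mul, mul_one] at this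
      rw [this]
      refine (w.valuation_lt_one_iff_mem _).2 (w.asIdeal.sub_mem (w.asIdeal.mul_mem_right _ hr)
        (w.asIdeal.mul_mem_left _ hs))
    intro hbot
    rw [hbot, Subgroup.mem_bot, inv_eq_one] at hmem
    have : (B 0 1 : ZMod p) = 0 := by rw [hmem]; rfl
    exact one_ne_zero this
  · intro i hi
    rw [eq_bot_iff]
    intro g hg
    obtain ⟨B, rfl⟩ : ∃ B, g = B⁻¹ := ⟨g⁻¹, (inv_inv g).symm⟩
    have h10 : B 1 0 = 0 := h.lower_left_eq_zero w hx hν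
      (fun x => Ideal.pow_le_self (Nat.succ_ne_zero i) (hg x))
    have hdet : B 0 0 * B 1 1 = 1 := by
      simpa [h10] using Matrix.SpecialLinearGroup.det_fin_two_eq_one B
    have hle := valuation_smul_sub_le (K := K) w (Nat.succ_ne_zero i) hg (z := u⁻¹) (by
      rw [hπ, ← exp_zero, exp_le_exp]
      omega)
    -- If the diagonal is nontrivial, the numerator keeps the pole of u and 1/u moves by order
    -- exactly 1: such an element is only tamely in inertia.
    have h00 : B 0 0 = 1 := by
      by_contra hne
      rw [hdiff (left_ne_zero_of_mul_eq_one hdet),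
        valuation_linear_of_lt _ hν huv (sub_ne_zero.2 (Ne.symm hne)), hu1, ← exp_add,
        exp_le_exp] at hle
      push_cast at hle
      omega
    have h01 : B 0 1 = 0 := by
      by_contra hne
      rw [hdiff1 h00 hne, exp_le_exp] at hle
      push_cast at hle
      omega
    rw [Subgroup.mem_bot, inv_eq_one]
    exact eq_of_lower_left_eq_zero h10 rfl h00 h01

end Pole

open scoped Pointwise in
include h hτ ht hP in
/-- The inertia group and the conductor at a point above `∞`. -/
theorem IsDrinfeldField.ramification_at_infinity :
    Nat.card (P.inertia (Matrix.SpecialLinearGroup (Fin 2) (ZMod p))) = p * (p - 1) ∧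
      (P ^ (p + 2)).inertia (Matrix.SpecialLinearGroup (Fin 2) (ZMod p)) ≠ ⊥ ∧
      ∀ i, p + 1 < i →
        (P ^ (i + 1)).inertia (Matrix.SpecialLinearGroup (Fin 2) (ZMod p)) = ⊥ := by
  obtain ⟨_, _, _, _, _, _⟩ := h.chart (C := C) hτ (.inr ht)
  have hτK : algebraMap C K (algebraMap A C τ) = (dicksonInvariant p u v)⁻¹ := by
    rw [← IsScalarTower.algebraMap_apply A C K, ht]
  have ht0 : dicksonInvariant p u v ≠ 0 := fun h0 =>
    h.transcendental_dicksonInvariant (h0 ▸ isAlgebraic_zero)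
  have hτ0 : algebraMap A C τ ≠ 0 := by
    intro h0
    rw [h0, map_zero, eq_comm, inv_eq_zero] at hτK
    exact ht0 hτK
  let w : HeightOneSpectrum C := ⟨P, inferInstance, fun h0 => hτ0 (by rwa [h0] at hP)⟩
  have hνt : 1 < w.valuation K (dicksonInvariant p u v) := by
    have : w.valuation K (dicksonInvariant p u v)⁻¹ < 1 := by
      rw [← hτK]
      exact (w.valuation_lt_one_iff_mem _).2 hP
    rw [map_inv₀] at this
    exact (inv_lt_one₀ (zero_lt_iff.2 ((Valuation.ne_zero_iff _).2 ht0))).1 this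
  obtain ⟨B, hB⟩ := h.exists_one_lt_valuation (w.valuation K) hνt
  have hinv : B • algebraMap A C τ = algebraMap A C τ := smul_algebraMap B τ
  have hmem : algebraMap A C τ ∈ B • P := by
    rw [Ideal.mem_pointwise_smul_iff_inv_smul_mem, inv_smul_eq_iff.2 hinv.symm]
    exact hP
  let w' : HeightOneSpectrum C := ⟨B • P, inferInstance, fun h0 => hτ0 (by rwa [h0] at hmem)⟩
  -- The pole at P of the transform of u/v under B⁻¹ is a pole of u/v itself at B • P. If u/v were
  -- regular there, transporting a fraction c/d for it back by B⁻¹ would contradict the pole at P.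
  have hx : 1 < w'.valuation K (u / v) := by
    by_contra! hle
    obtain ⟨c, ⟨d, hd⟩, hcd⟩ := w'.exists_primeCompl_mul_eq_of_integer _ hle
    have hd' : B⁻¹ • d ∉ P := fun hm => hd (Ideal.mem_pointwise_smul_iff_inv_smul_mem.2 hm)
    have e : (B⁻¹ • u / B⁻¹ • v) * algebraMap C K (B⁻¹ • d) = algebraMap C K (B⁻¹ • c) := by
      have hs (c : C) : algebraMap C K (B⁻¹ • c) = B⁻¹ • algebraMap C K c :=
        algebraMap.coe_smul' B⁻¹ c K
      rw [hs, hs, ← hcd, smul_mul', smul_div₀']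
    have := congrArg (w.valuation K) e
    rw [map_mul, w.valuation_eq_one_iff_notMem.2 hd', mul_one] at this
    rw [this] at hB
    exact hB.not_ge (w.valuation_le_one _)
  have key := h.inertia_of_pole hτ ht w' hx hmem
  have key2 := h.conductor_of_pole hτ ht w' hx hmem
  have hpow (n : ℕ) : (w'.asIdeal ^ n).inertia (Matrix.SpecialLinearGroup (Fin 2) (ZMod p)) =
      ((P ^ n).inertia (Matrix.SpecialLinearGroup (Fin 2) (ZMod p))).map
        (MulAut.conj B).toMonoidHom := by
    rw [← inertia_smul, smul_pow']
  have hinj : Function.Injective (MulAut.conj B).toMonoidHom := (MulAut.conj B).injective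
  refine ⟨?_, ?_, fun i hi => ?_⟩
  · rw [← key.1, ← pow_one w'.asIdeal, hpow, pow_one, Subgroup.card_map_of_injective hinj]
  · intro h0
    refine key2.1 ?_
    rw [hpow, h0, Subgroup.map_bot]
  · rw [← Subgroup.map_eq_bot_iff_of_injective _ hinj, ← hpow]
    exact key2.2 i hi

end ChartAtInfinity

/-! ### Points of an affine open subset and prime ideals -/

section Stalks

theorem mem_primeIdealOf {Y : Scheme.{u}} {V : Y.Opens} (hV : IsAffineOpen V) {y : Y} (hy : y ∈ V)
    (c : Γ(Y, V)) : c ∈ (hV.primeIdealOf ⟨y, hy⟩).asIdeal ↔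
      Y.presheaf.germ V y hy c ∈ IsLocalRing.maximalIdeal (Y.presheaf.stalk y) := by
  rw [hV.primeIdealOf_eq_map_closedPoint]
  rfl

/-- Maps on stalks are local, so vanishing at the image is vanishing of the pull-back. -/
theorem mem_primeIdealOf_map {Z Y : Scheme.{u}} (α : Z ⟶ Y) {V : Y.Opens} (hV : IsAffineOpen V)
    {W : Z.Opens} (hW : IsAffineOpen W) (hWV : W ≤ α ⁻¹ᵁ V) {z : Z} (hz : z ∈ W) (hαz : α z ∈ V)
    (c : Γ(Y, V)) :
    c ∈ (hV.primeIdealOf ⟨α z, hαz⟩).asIdeal ↔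
      α.appLE V W hWV c ∈ (hW.primeIdealOf ⟨z, hz⟩).asIdeal := by
  rw [mem_primeIdealOf, mem_primeIdealOf, IsLocalRing.mem_maximalIdeal,
    IsLocalRing.mem_maximalIdeal, mem_nonunits_iff, mem_nonunits_iff, not_iff_not,
    ← isUnit_map_iff (α.stalkMap z).hom]
  have h1 := Scheme.Hom.germ_stalkMap_apply α V z hαz c
  have h2 : Z.presheaf.germ W z hz (α.appLE V W hWV c) =
      Z.presheaf.germ (α ⁻¹ᵁ V) z hαz (α.app V c) := by
    rw [Scheme.Hom.appLE]
    exact TopCat.Presheaf.germ_res_apply _ (homOfLE hWV) z hz _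
  rw [h2, ← h1]

theorem primeIdealOf_injective {Y : Scheme.{u}} {V : Y.Opens} (hV : IsAffineOpen V) {y y' : Y}
    (hy : y ∈ V) (hy' : y' ∈ V)
    (h : (hV.primeIdealOf ⟨y, hy⟩).asIdeal = (hV.primeIdealOf ⟨y', hy'⟩).asIdeal) : y = y' := by
  have := congrArg hV.fromSpec (PrimeSpectrum.ext h)
  rwa [hV.fromSpec_primeIdealOf, hV.fromSpec_primeIdealOf] at this

theorem isMaximal_primeIdealOf {Y : Scheme.{u}} {V : Y.Opens} (hV : IsAffineOpen V) {y : Y}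
    (hy : y ∈ V) (h : IsClosed {y}) : (hV.primeIdealOf ⟨y, hy⟩).asIdeal.IsMaximal := by
  rw [← PrimeSpectrum.isClosed_singleton_iff_isMaximal]
  have hset : ({hV.primeIdealOf ⟨y, hy⟩} : Set (PrimeSpectrum Γ(Y, V))) = hV.fromSpec ⁻¹' {y} := by
    refine Set.ext fun q => ⟨fun hq => ?_, fun hq => ?_⟩
    · rw [Set.mem_singleton_iff.1 hq]
      exact hV.fromSpec_primeIdealOf _
    · refine hV.fromSpec.isOpenEmbedding.injective ?_
      exact (Set.mem_singleton_iff.1 hq).trans (hV.fromSpec_primeIdealOf ⟨y, hy⟩).symm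
  exact hset ▸ h.preimage hV.fromSpec.continuous

theorem primeIdealOf_surjective {Y : Scheme.{u}} {V : Y.Opens} (hV : IsAffineOpen V)
    (q : Ideal Γ(Y, V)) [hq : q.IsPrime] :
    ∃ (y : Y) (hy : y ∈ V), (hV.primeIdealOf ⟨y, hy⟩).asIdeal = q := by
  have hmem : hV.fromSpec ⟨q, hq⟩ ∈ V := by
    have := Set.mem_range_self (f := hV.fromSpec) ⟨q, hq⟩
    rwa [hV.range_fromSpec] at this
  refine ⟨_, hmem, ?_⟩
  have := hV.fromSpec.isOpenEmbedding.injective (hV.fromSpec_primeIdealOf ⟨_, hmem⟩)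
  rw [this]

end Stalks

/-! ### Congruences in a ring and in its localization -/

section LocalRing

/-- A power of a maximal ideal is primary, so it is recovered from its extension to the
localization. -/
theorem Localization.mem_maximalIdeal_pow_iff {R S : Type*} [CommRing R] [CommRing S] [Algebra R S]
    (P : Ideal R) [P.IsMaximal] [IsLocalRing S] [IsLocalization.AtPrime S P] (n : ℕ) (c : R) :
    algebraMap R S c ∈ IsLocalRing.maximalIdeal S ^ n ↔ c ∈ P ^ n := by
  rw [← IsLocalization.AtPrime.map_eq_maximalIdeal P S, ← Ideal.map_pow]
  rcases Nat.eq_zero_or_pos n with rfl | hn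
  · simp [Ideal.map_top]
  have hprim : (P ^ n).IsPrimary := Ideal.isPrimary_of_isMaximal_radical (by
    rw [Ideal.radical_pow _ hn.ne', Ideal.IsPrime.radical inferInstance]
    infer_instance)
  have := IsLocalization.under_map_of_isPrimary_disjoint P.primeCompl S hprim (by
    rw [Set.disjoint_left]
    exact fun x hx hx' => hx (Ideal.pow_le_self hn.ne' hx'))
  conv_rhs => rw [← this]
  rfl

theorem Localization.forall_sub_mem_maximalIdeal_pow_iff {R S : Type*} [CommRing R] [CommRing S]
    [Algebra R S]
    (P : Ideal R) [P.IsMaximal] [IsLocalRing S] [IsLocalization.AtPrime S P] (n : ℕ) (ψ : S →+* S)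
    (φ : R →+* R) (h : ∀ c, ψ (algebraMap R S c) = algebraMap R S (φ c)) :
    (∀ s, ψ s - s ∈ IsLocalRing.maximalIdeal S ^ (n + 1)) ↔ ∀ c, φ c - c ∈ P ^ (n + 1) := by
  constructor
  · intro hs c
    rw [← Localization.mem_maximalIdeal_pow_iff (S := S), map_sub, ← h]
    exact hs _
  · intro hc s
    have hc' (c : R) : ψ (algebraMap R S c) - algebraMap R S c ∈
        IsLocalRing.maximalIdeal S ^ (n + 1) := by
      rw [h, ← map_sub, Localization.mem_maximalIdeal_pow_iff P]
      exact hc c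
    obtain ⟨⟨c, d⟩, hcd⟩ := IsLocalization.surj P.primeCompl s
    have hd : IsUnit (ψ (algebraMap R S d)) := (IsLocalization.map_units S d).map ψ
    have e : (ψ s - s) * ψ (algebraMap R S d) = (ψ (algebraMap R S c) - algebraMap R S c) -
        s * (ψ (algebraMap R S d) - algebraMap R S d) := by
      have := congrArg ψ hcd
      rw [map_mul] at this
      linear_combination this - hcd
    rw [← Ideal.mul_unit_mem_iff_mem _ hd, e]
    exact Ideal.sub_mem _ (hc' c) (Ideal.mul_mem_left _ _ (hc' d))

end LocalRing

/-! ### Ramification groups computed on a stable affine open subset -/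

section Action

variable {X : Scheme.{u}} {Y : Over X} {G : Type v} [Group G] (ρ : G →* Aut Y) {V : Y.left.Opens}
  (hV : ∀ g, V ≤ act ρ g ⁻¹ᵁ V)

/-- Pull-back of sections over a stable open subset. -/
def sectionsPullback (g : G) : Γ(Y.left, V) →+* Γ(Y.left, V) :=
  ((act ρ g).appLE V V (hV g)).hom

theorem sectionsPullback_one : sectionsPullback ρ hV 1 = RingHom.id _ := by
  have (α : Y.left ⟶ Y.left) (h : V ≤ α ⁻¹ᵁ V) (hα : α = 𝟙 _) : α.appLE V V h = 𝟙 _ := by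
    subst hα
    exact (Category.id_comp _).trans (Y.left.presheaf.map_id _)
  rw [sectionsPullback, this _ _ (act_one ρ)]
  rfl

theorem sectionsPullback_mul (g h : G) : sectionsPullback ρ hV (g * h) =
    (sectionsPullback ρ hV h).comp (sectionsPullback ρ hV g) := by
  have : (act ρ (g * h)).appLE V V (hV (g * h)) =
      (act ρ g).appLE V V (hV g) ≫ (act ρ h).appLE V V (hV h) := by
    rw [Scheme.Hom.appLE_comp_appLE]
    congr 1
    exact act_mul ρ g h
  rw [sectionsPullback, this]
  rfl

/-- The action of `G` on the sections over a stable open subset, by pull-back under the inverse. -/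
abbrev sectionsAction : MulSemiringAction G Γ(Y.left, V) where
  smul g c := sectionsPullback ρ hV g⁻¹ c
  one_smul c := by
    change sectionsPullback ρ hV 1⁻¹ c = c
    rw [inv_one, sectionsPullback_one]
    rfl
  mul_smul g h c := by
    change sectionsPullback ρ hV (g * h)⁻¹ c =
      sectionsPullback ρ hV g⁻¹ (sectionsPullback ρ hV h⁻¹ c)
    rw [mul_inv_rev, sectionsPullback_mul]
    rfl
  smul_zero g := map_zero (sectionsPullback ρ hV g⁻¹)
  smul_add g := map_add (sectionsPullback ρ hV g⁻¹)
  smul_one g := map_one (sectionsPullback ρ hV g⁻¹)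
  smul_mul g := map_mul (sectionsPullback ρ hV g⁻¹)

theorem mem_primeIdealOf_act (haff : IsAffineOpen V) {y : Y.left} (hy : y ∈ V) (g : G)
    (hgy : act ρ g y ∈ V) (c : Γ(Y.left, V)) :
    c ∈ (haff.primeIdealOf ⟨act ρ g y, hgy⟩).asIdeal ↔
      sectionsPullback ρ hV g c ∈ (haff.primeIdealOf ⟨y, hy⟩).asIdeal :=
  mem_primeIdealOf_map (act ρ g) haff haff (hV g) hy hgy c

/-- That g fixes the point need not be required on the right: a congruence modulo the prime already
forces the primes of y and of its image to coincide. -/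
theorem mem_ramificationGroup_iff (haff : IsAffineOpen V) {y : Y.left} (hy : y ∈ V)
    [(haff.primeIdealOf ⟨y, hy⟩).asIdeal.IsMaximal] (i : ℕ) (g : G) :
    g ∈ ramificationGroup ρ y i ↔ ∀ c, sectionsPullback ρ hV g c - c ∈
      (haff.primeIdealOf ⟨y, hy⟩).asIdeal ^ (i + 1) := by
  set P := (haff.primeIdealOf ⟨y, hy⟩).asIdeal with hP
  let _ : Algebra Γ(Y.left, V) (Y.left.presheaf.stalk y) :=
    (Y.left.presheaf.germ V y hy).hom.toAlgebra
  have : IsLocalization.AtPrime (Y.left.presheaf.stalk y) P := haff.isLocalization_stalk ⟨y, hy⟩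
  have key (h : act ρ g y = y) (c : Γ(Y.left, V)) :
      stalkPullback (act ρ g) y h (algebraMap Γ(Y.left, V) (Y.left.presheaf.stalk y) c) =
        algebraMap Γ(Y.left, V) (Y.left.presheaf.stalk y) (sectionsPullback ρ hV g c) := by
    refine (stalkPullback_germ (act ρ g) y h V hy c).trans ?_
    rw [sectionsPullback, Scheme.Hom.appLE]
    exact (TopCat.Presheaf.germ_res_apply _ (homOfLE (hV g)) y hy _).symm
  constructor
  · rintro ⟨h, hs⟩
    exact (Localization.forall_sub_mem_maximalIdeal_pow_iff P i _
      (sectionsPullback ρ hV g)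
      (key h)).1 hs
  · intro hc
    have h : act ρ g y = y := by
      refine primeIdealOf_injective haff (show act ρ g y ∈ V from hV g hy) hy
        (Ideal.ext fun c => ?_)
      rw [mem_primeIdealOf_act ρ hV haff hy]
      have := Ideal.pow_le_self (Nat.succ_ne_zero i) (hc c)
      exact ⟨fun h1 => by simpa using P.sub_mem h1 this, fun h1 => by simpa using P.add_mem this h1⟩
    exact ⟨h, (Localization.forall_sub_mem_maximalIdeal_pow_iff P i _
      (sectionsPullback ρ hV g) (key h)).2 hc⟩

/-- The action on sections is pull-back under the inverse; the discrepancy disappears because a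
subgroup is stable under inversion. -/
theorem ramificationGroup_eq_inertia (haff : IsAffineOpen V) {y : Y.left} (hy : y ∈ V)
    [(haff.primeIdealOf ⟨y, hy⟩).asIdeal.IsMaximal] (i : ℕ) :
    letI := sectionsAction ρ hV
    ramificationGroup ρ y i = ((haff.primeIdealOf ⟨y, hy⟩).asIdeal ^ (i + 1)).inertia G := by
  ext g
  rw [← inv_mem_iff, mem_ramificationGroup_iff ρ hV haff hy]
  rfl

end Action

/-! ### Evaluation of sections at a K-valued point -/

section RingPoint

variable {K : Type u} [CommRing K] {Z : Scheme.{u}} (j : Spec (.of K) ⟶ Z) {V : Z.Opens}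

/-- The value in `K` of the sections over a neighbourhood of the image of a `K`-valued point. -/
noncomputable def evalPoint (h : ⊤ ≤ j ⁻¹ᵁ V) : Γ(Z, V) →+* K :=
  (j.appLE V ⊤ h ≫ (Scheme.ΓSpecIso (.of K)).hom).hom

theorem evalPoint_comp {X : Scheme.{u}} (π : Z ⟶ X) (f : Spec (.of K) ⟶ X) (hf : j ≫ π = f)
    {U : X.Opens} (hU : ⊤ ≤ f ⁻¹ᵁ U) (h : ⊤ ≤ j ⁻¹ᵁ V) (hUV : V ≤ π ⁻¹ᵁ U) (a : Γ(X, U)) :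
    evalPoint j h (π.appLE U V hUV a) = evalPoint f hU a := by
  subst hf
  have : π.appLE U V hUV ≫ j.appLE V ⊤ h = (j ≫ π).appLE U ⊤ hU :=
    Scheme.Hom.appLE_comp_appLE ..
  rw [evalPoint, evalPoint, ← this]
  rfl

theorem evalPoint_SpecMap_comp {L : Type u} [CommRing L] (σ : K →+* L) (h : ⊤ ≤ j ⁻¹ᵁ V)
    (h' : ⊤ ≤ (Spec.map (CommRingCat.ofHom σ) ≫ j) ⁻¹ᵁ V) (a : Γ(Z, V)) :
    evalPoint (Spec.map (CommRingCat.ofHom σ) ≫ j) h' a = σ (evalPoint j h a) := by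
  have h1 : (Spec.map (CommRingCat.ofHom σ) ≫ j).appLE V ⊤ h' =
      j.appLE V ⊤ h ≫ (Spec.map (CommRingCat.ofHom σ)).appLE ⊤ ⊤ le_rfl :=
    (Scheme.Hom.appLE_comp_appLE ..).symm
  have h2 : (Spec.map (CommRingCat.ofHom σ)).appLE ⊤ ⊤ le_rfl =
      (Spec.map (CommRingCat.ofHom σ)).appTop := by
    exact (Spec.map (CommRingCat.ofHom σ)).appLE_eq_app
  have h3 := Scheme.ΓSpecIso_naturality (CommRingCat.ofHom σ)
  rw [evalPoint, h1, h2, Category.assoc, h3]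
  rfl

end RingPoint

/-! ### The normalization in a field and its sections -/

section Normalization

variable {K : Type u} [Field K] {X : Scheme.{u}} (f : Spec (.of K) ⟶ X) [QuasiCompact f]
  [QuasiSeparated f] {U : X.Opens} (hU : IsAffineOpen U) (h : ⊤ ≤ f ⁻¹ᵁ U)

include h in
theorem top_le_toNormalization_preimage :
    ⊤ ≤ f.toNormalization ⁻¹ᵁ f.fromNormalization ⁻¹ᵁ U := by
  rwa [← Scheme.Hom.comp_preimage, f.toNormalization_fromNormalization]

include hU in
/-- The sections of the normalization of `X` in `K` over an affine open subset are the integral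
closure in `K` of the sections of `X`. -/
theorem isIntegralClosure_normalization :
    letI := (f.fromNormalization.app U).hom.toAlgebra
    letI := (evalPoint f h).toAlgebra
    letI := (evalPoint f.toNormalization (V := f.fromNormalization ⁻¹ᵁ U)
      (top_le_toNormalization_preimage f h)).toAlgebra
    IsIntegralClosure Γ(f.normalization, f.fromNormalization ⁻¹ᵁ U) Γ(X, U) K := by
  let _ := (evalPoint f h).toAlgebra
  let _ := (evalPoint f.toNormalization (V := f.fromNormalization ⁻¹ᵁ U)
    (top_le_toNormalization_preimage f h)).toAlgebra
  let _ := (f.app U).hom.toAlgebra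
  have e := f.normalizationObjIso_hom_val hU
  have htop : f ⁻¹ᵁ U = ⊤ := top_le_iff.1 h
  let ψ : Γ(Spec (.of K), f ⁻¹ᵁ U) ≅ CommRingCat.of K :=
    (Spec (.of K)).presheaf.mapIso (eqToIso htop.symm).op ≪≫ Scheme.ΓSpecIso (.of K)
  have h1 : f.app U ≫ ψ.hom = CommRingCat.ofHom (evalPoint f h) := by
    exact (Category.assoc _ _ _).symm
  have h2 : f.toNormalization.appLE (f.fromNormalization ⁻¹ᵁ U) (f ⁻¹ᵁ U)
      (by simp [← Scheme.Hom.comp_preimage]) ≫ ψ.hom =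
      CommRingCat.ofHom (evalPoint f.toNormalization (V := f.fromNormalization ⁻¹ᵁ U)
        (top_le_toNormalization_preimage f h)) := by
    refine (Category.assoc _ _ _).symm.trans ?_
    exact congrArg (· ≫ (Scheme.ΓSpecIso (.of K)).hom) (Scheme.Hom.appLE_map ..)
  let ψ' : Γ(Spec (.of K), f ⁻¹ᵁ U) ≃ₐ[Γ(X, U)] K :=
    { ψ.commRingCatIsoToRingEquiv with
      commutes' := fun a => congrArg (fun m => m.hom a) h1 }
  -- Evaluation at the generic K-point agrees with the identification of the sections with an
  -- integral closure.
  have h3 (c : Γ(f.normalization, f.fromNormalization ⁻¹ᵁ U)) :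
      evalPoint f.toNormalization (V := f.fromNormalization ⁻¹ᵁ U)
        (top_le_toNormalization_preimage f h) c =
        ψ' ((f.normalizationObjIso hU).hom c).1 := by
    have := congrArg (fun m => m.hom c) (h2.symm.trans (congrArg (· ≫ ψ.hom) e.symm))
    exact this
  refine @IsIntegralClosure.mk _ _ _ _ _ _ _ _ (fun c d hcd => ?_) fun {x} => ⟨fun hx => ?_, ?_⟩
  · change evalPoint _ _ c = evalPoint _ _ d at hcd
    rw [h3, h3] at hcd
    exact (f.normalizationObjIso hU).commRingCatIsoToRingEquiv.injective
      (Subtype.ext (ψ'.injective hcd))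
  · obtain ⟨z, rfl⟩ := ψ'.surjective x
    have hz : IsIntegral Γ(X, U) z := (isIntegral_algEquiv ψ').1 hx
    obtain ⟨c, hc⟩ := (f.normalizationObjIso hU).commRingCatIsoToRingEquiv.surjective ⟨z, hz⟩
    exact ⟨c, (h3 c).trans (congrArg (fun w => ψ' w.1) hc)⟩
  · rintro ⟨c, rfl⟩
    change IsIntegral Γ(X, U) (evalPoint _ _ c)
    rw [h3]
    exact (isIntegral_algEquiv ψ').2 ((f.normalizationObjIso hU).hom c).2

end Normalization

theorem act_comp_hom {X : Scheme.{u}} {Y : Over X} {G : Type v} [Group G] (ρ : G →* Aut Y) (g : G) :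
    act ρ g ≫ Y.hom = Y.hom :=
  Over.w (ρ g).hom

theorem hom_act_apply {X : Scheme.{u}} {Y : Over X} {G : Type v} [Group G] (ρ : G →* Aut Y) (g : G)
    (y : Y.left) : Y.hom (act ρ g y) = Y.hom y := by
  rw [← Scheme.Hom.comp_apply, act_comp_hom]

theorem preimage_le_act_preimage {X : Scheme.{u}} {Y : Over X} {G : Type v} [Group G]
    (ρ : G →* Aut Y) (U : X.Opens) (g : G) : Y.hom ⁻¹ᵁ U ≤ act ρ g ⁻¹ᵁ Y.hom ⁻¹ᵁ U := by
  intro y hy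
  change Y.hom (act ρ g y) ∈ U
  rw [hom_act_apply]
  exact hy

/-- The compatibility of the K-point with the action makes the embedding of sections into K
equivariant. -/
theorem evalPoint_sectionsPullback {K : Type u} [Field K] {X : Scheme.{u}} {Y : Over X}
    {G : Type v} [Group G] [MulSemiringAction G K] (ρ : G →* Aut Y) (j : Spec (.of K) ⟶ Y.left)
    (hj : ∀ g, j ≫ act ρ g =
      Spec.map (CommRingCat.ofHom (MulSemiringAction.toRingHom G K g⁻¹)) ≫ j)
    {V : Y.left.Opens} (hV : ∀ g, V ≤ act ρ g ⁻¹ᵁ V) (h : ⊤ ≤ j ⁻¹ᵁ V) (g : G) (c : Γ(Y.left, V)) :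
    evalPoint j h (sectionsPullback ρ hV g c) = g⁻¹ • evalPoint j h c := by
  have h' : ⊤ ≤ (Spec.map (CommRingCat.ofHom (MulSemiringAction.toRingHom G K g⁻¹)) ≫ j) ⁻¹ᵁ V := by
    rw [Scheme.Hom.comp_preimage, top_le_iff.1 h]
    exact le_rfl
  rw [← MulSemiringAction.toRingHom_apply, ← evalPoint_SpecMap_comp j _ h h' c]
  exact evalPoint_comp j (act ρ g) _ (hj g) h' h (hV g) c

/-! ### Extension of the group action to the normalization -/

section NormalizationAction

variable {K : Type u} [Field K] {X : Scheme.{u}} (f : Spec (.of K) ⟶ X) [QuasiCompact f]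
  [QuasiSeparated f] {G : Type v} [Group G] [MulSemiringAction G K]
  (hf : ∀ g : G, Spec.map (CommRingCat.ofHom (MulSemiringAction.toRingHom G K g)) ≫ f = f)

/-- The extension to the normalization of the action of a group on a field. -/
noncomputable def normalizationMap (g : G) : f.normalization ⟶ f.normalization :=
  f.normalizationDesc (Spec.map (CommRingCat.ofHom (MulSemiringAction.toRingHom G K g⁻¹)) ≫
    f.toNormalization) f.fromNormalization (by
      rw [Category.assoc, f.toNormalization_fromNormalization, hf])

theorem toNormalization_normalizationMap (g : G) :
    f.toNormalization ≫ normalizationMap f hf g =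
      Spec.map (CommRingCat.ofHom (MulSemiringAction.toRingHom G K g⁻¹)) ≫ f.toNormalization :=
  f.toNormalization_normalizationDesc ..

theorem normalizationMap_comp (g : G) :
    normalizationMap f hf g ≫ f.fromNormalization = f.fromNormalization :=
  f.normalizationDesc_comp ..

theorem normalizationMap_one : normalizationMap f hf 1 = 𝟙 _ := by
  refine Scheme.Hom.normalization.hom_ext f _ _ f.fromNormalization ?_
    (normalizationMap_comp f hf 1) (Category.id_comp _)
  rw [toNormalization_normalizationMap]
  have : MulSemiringAction.toRingHom G K 1⁻¹ = RingHom.id K := by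
    ext z
    simp
  rw [this, Category.comp_id]
  exact (congrArg (· ≫ _) (Spec.map_id (.of K))).trans (Category.id_comp _)

theorem normalizationMap_mul (g h : G) :
    normalizationMap f hf (g * h) = normalizationMap f hf h ≫ normalizationMap f hf g := by
  refine Scheme.Hom.normalization.hom_ext f _ _ f.fromNormalization ?_
    (normalizationMap_comp f hf _) (by rw [Category.assoc, normalizationMap_comp,
      normalizationMap_comp])
  rw [toNormalization_normalizationMap, reassoc_of% toNormalization_normalizationMap f hf h,
    toNormalization_normalizationMap, ← Spec.map_comp_assoc, ← CommRingCat.ofHom_comp]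
  congr 3
  ext z
  simp [mul_smul]

/-- The action on the normalization of a group acting on a field. -/
noncomputable def normalizationAction : G →* Aut (Over.mk f.fromNormalization) where
  toFun g := Over.isoMk
    { hom := normalizationMap f hf g
      inv := normalizationMap f hf g⁻¹
      hom_inv_id := by
        rw [← normalizationMap_mul, inv_mul_cancel, normalizationMap_one]
        rfl
      inv_hom_id := by
        rw [← normalizationMap_mul, mul_inv_cancel, normalizationMap_one]
        rfl }
    (normalizationMap_comp f hf g)
  map_one' := by
    ext1
    exact Over.OverMorphism.ext (normalizationMap_one f hf)
  map_mul' g h := by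
    ext1
    exact Over.OverMorphism.ext (normalizationMap_mul f hf g h)

theorem toNormalization_act_normalizationAction (g : G) :
    f.toNormalization ≫ act (normalizationAction f hf) g =
      Spec.map (CommRingCat.ofHom (MulSemiringAction.toRingHom G K g⁻¹)) ≫ f.toNormalization :=
  toNormalization_normalizationMap f hf g

end NormalizationAction

/-! ### Function field and constants -/

section FunctionField

variable {K : Type u} [Field K] {Z : Scheme.{u}} [IsIntegral Z] (j : Spec (.of K) ⟶ Z) {V : Z.Opens}

/-- The identification of the function field of an integral scheme with the fraction field `K` of
the sections over an affine open subset. -/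
theorem exists_functionField_ringEquiv (hV : IsAffineOpen V) (h : ⊤ ≤ j ⁻¹ᵁ V)
    (hη : genericPoint Z ∈ V)
    (hK : letI := (evalPoint j h).toAlgebra; IsFractionRing Γ(Z, V) K) :
    ∃ e : K ≃+* Z.functionField, ∀ c : Γ(Z, V),
      e (evalPoint j h c) = Z.presheaf.germ V (genericPoint Z) hη c := by
  let _ := (evalPoint j h).toAlgebra
  have : Nonempty V := ⟨⟨_, hη⟩⟩
  have := functionField_isFractionRing_of_isAffineOpen Z V hV
  let e := IsLocalization.algEquiv (nonZeroDivisors Γ(Z, V)) K Z.functionField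
  exact ⟨e.toRingEquiv, fun c => e.commutes c⟩

end FunctionField

section

variable {K : Type u} [CommRing K]

theorem evalPoint_SpecMap {R : Type u} [CommRing R] (φ : R →+* K) (r : R)
    (h : ⊤ ≤ Spec.map (CommRingCat.ofHom φ) ⁻¹ᵁ ⊤) :
    evalPoint (Spec.map (CommRingCat.ofHom φ)) h ((Scheme.ΓSpecIso (.of R)).inv r) = φ r := by
  have h2 : (Spec.map (CommRingCat.ofHom φ)).appLE ⊤ ⊤ h =
      (Spec.map (CommRingCat.ofHom φ)).appTop :=
    (Spec.map (CommRingCat.ofHom φ)).appLE_eq_app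
  have h3 := Scheme.ΓSpecIso_naturality (CommRingCat.ofHom φ)
  rw [evalPoint, h2, h3]
  change φ ((Scheme.ΓSpecIso (.of R)).hom ((Scheme.ΓSpecIso (.of R)).inv r)) = φ r
  congr 1
  exact congrArg (fun m => m.hom r) (Scheme.ΓSpecIso (.of R)).inv_hom_id

variable {Z : Scheme.{u}} {R : Type u} [CommRing R]

/-- The constants of the ring of sections over an open subset of a scheme over `R`. -/
noncomputable def constSections (q : Z ⟶ Spec (.of R)) (V : Z.Opens) : R →+* Γ(Z, V) :=
  ((Scheme.ΓSpecIso (.of R)).inv ≫ q.appLE ⊤ V le_top).hom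

theorem evalPoint_constSections (q : Z ⟶ Spec (.of R)) {V : Z.Opens} (j : Spec (.of K) ⟶ Z)
    (h : ⊤ ≤ j ⁻¹ᵁ V) (φ : R →+* K) (hj : j ≫ q = Spec.map (CommRingCat.ofHom φ)) (r : R) :
    evalPoint j h (constSections q V r) = φ r := by
  rw [← evalPoint_SpecMap φ r le_top]
  exact evalPoint_comp j q _ hj le_top h le_top _

theorem const_eq_germ {k : Type u} [Field k] (Y : Over (P1 k)) (y : Y.left) (V : Y.left.Opens)
    (hy : y ∈ V) (r : k) :
    const Y y r = Y.left.presheaf.germ V y hy (constSections (Y.hom ≫ P1.toSpec k) V r) := by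
  exact (TopCat.Presheaf.germ_res_apply Y.left.presheaf (homOfLE le_top) y hy
    ((Y.hom ≫ P1.toSpec k).appTop ((Scheme.ΓSpecIso (CommRingCat.of k)).inv r))).symm

theorem stalkPullback_germ_of_le {Y : Scheme.{u}} (φ : Y ⟶ Y) (y : Y) (h : φ y = y)
    (V : Y.Opens) (hy : y ∈ V) (hV : V ≤ φ ⁻¹ᵁ V) (c : Γ(Y, V)) :
    stalkPullback φ y h (Y.presheaf.germ V y hy c) =
      Y.presheaf.germ V y hy (φ.appLE V V hV c) := by
  refine (stalkPullback_germ φ y h V hy c).trans ?_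
  rw [Scheme.Hom.appLE]
  exact (TopCat.Presheaf.germ_res_apply _ (homOfLE hV) y hy _).symm

end

/-! ### Identification with the curve y^(p+1) = x^p - x -/

section StandardModel

variable {k : Type u} [Field k] {p : ℕ} [Fact p.Prime] [CharP k p] {K : Type u} [Field K]
  [Algebra k K] [MulSemiringAction (Matrix.SpecialLinearGroup (Fin 2) (ZMod p)) K] {u v : K}
  (h : IsDrinfeldField k p u v) {Y : Over (P1 k)} [IsIntegral Y.left]
  (ρ : Matrix.SpecialLinearGroup (Fin 2) (ZMod p) →* Aut Y) (j : Spec (.of K) ⟶ Y.left)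
  (hjk : j ≫ Y.hom ≫ P1.toSpec k = Spec.map (CommRingCat.ofHom (algebraMap k K)))
  (hj : ∀ g, j ≫ act ρ g =
    Spec.map (CommRingCat.ofHom (MulSemiringAction.toRingHom _ K g⁻¹)) ≫ j)
  {V : Y.left.Opens} (hV : IsAffineOpen V) (hstable : ∀ g, V ≤ act ρ g ⁻¹ᵁ V)
  (hjV : ⊤ ≤ j ⁻¹ᵁ V)
  (hK : letI := (evalPoint j hjV).toAlgebra; IsFractionRing Γ(Y.left, V) K)

include h hjk hj hV hstable hK in
/-- A curve with function field a Drinfeld field is the standard model. -/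
theorem IsDrinfeldField.isStandardModel : IsStandardModel p ρ := by
  have hη : genericPoint Y.left ∈ V :=
    ((genericPoint_spec Y.left).mem_open_set_iff V.isOpen).2
      ⟨j (IsLocalRing.closedPoint K), Set.mem_univ _, hjV (Set.mem_univ _)⟩
  obtain ⟨e, he⟩ := exists_functionField_ringEquiv j hV hjV hη hK
  have hconst (r : k) : const Y (genericPoint Y.left) r = e (algebraMap k K r) := by
    rw [const_eq_germ Y _ V hη r, ← he]
    exact congrArg e (evalPoint_constSections _ j hjV _ hjk r)
  have hpull (g : Matrix.SpecialLinearGroup (Fin 2) (ZMod p)) (z : K) :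
      functionFieldPullback ρ g (e z) = e (g⁻¹ • z) := by
    -- K is the fraction field of the sections over V, so the two ring homomorphisms need only be
    -- compared on sections.
    let _ := (evalPoint j hjV).toAlgebra
    have : IsFractionRing Γ(Y.left, V) K := hK
    have : (functionFieldPullback ρ g).comp (e : K →+* Y.left.functionField) =
        (e : K →+* Y.left.functionField).comp (MulSemiringAction.toRingHom _ K g⁻¹) := by
      refine IsLocalization.ringHom_ext (nonZeroDivisors Γ(Y.left, V)) (RingHom.ext fun c => ?_)
      change functionFieldPullback ρ g (e (evalPoint _ hjV c)) = e (g⁻¹ • evalPoint _ hjV c)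
      rw [← evalPoint_sectionsPullback ρ j hj hstable hjV, he, he]
      exact stalkPullback_germ_of_le (act ρ g) _ _ V hη (hstable g) c
    exact congrArg (fun m => m z) this
  have hv0 := h.ne_zero.2
  have hcoeff (a : ZMod p) : const Y (genericPoint Y.left)
      (ZMod.castHom dvd_rfl k a) = e (primeCoeff k p K a) := hconst _
  -- This inverts the substitution u = x/y, v = 1/y.
  refine ⟨inferInstance, e (u / v), e (1 / v), ?_, ?_, fun A => ?_⟩
  · rw [eq_top_iff]
    set S := Subfield.closure (Set.range (const Y
      (genericPoint Y.left)) ∪ {e (u / v), e (1 / v)}) with hS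
    have hSk (r : k) : algebraMap k K r ∈ S.comap (e : K →+* Y.left.functionField) := by
      refine Subfield.subset_closure (.inl ⟨r, ?_⟩)
      exact hconst r
    have h1 : 1 / v ∈ S.comap (e : K →+* Y.left.functionField) := Subfield.subset_closure (by simp)
    have h2 : u / v ∈ S.comap (e : K →+* Y.left.functionField) := Subfield.subset_closure (by simp)
    have h3 : v ∈ S.comap (e : K →+* Y.left.functionField) := by simpa using inv_mem h1
    have h4 : u ∈ S.comap (e : K →+* Y.left.functionField) := by
      have := mul_mem h2 h3
      rwa [div_mul_cancel₀ _ hv0] at this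
    have h5 : (⊤ : IntermediateField k K) ≤
        (S.comap (e : K →+* Y.left.functionField)).toIntermediateField hSk := by
      rw [← h.adjoin, IntermediateField.adjoin_le_iff]
      rintro z (rfl | rfl)
      exacts [h4, h3]
    intro z _
    obtain ⟨z, rfl⟩ := e.surjective z
    exact h5 (IntermediateField.mem_top (x := z))
  · rw [← map_pow, ← map_pow, ← map_sub]
    congr 1
    have := h.eqn
    rw [div_pow, div_pow, one_pow, eq_sub_iff_add_eq, div_add_div _ _ (pow_ne_zero _ hv0) hv0,
      div_eq_div_iff (mul_ne_zero (pow_ne_zero _ hv0) hv0) (pow_ne_zero _ hv0)]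
    linear_combination (-v ^ (p + 1)) * this
  · have hlin : primeCoeff k p K (A 1 0) * u + primeCoeff k p K (A 1 1) * v ≠ 0 := by
      rw [← h.inv_smul_snd]
      exact (smul_ne_zero_iff_ne _).2 hv0
    have hlin' : primeCoeff k p K (A 1 0) * (u / v) + primeCoeff k p K (A 1 1) ≠ 0 := by
      intro h0
      refine hlin ?_
      have := congrArg (· * v) h0
      simpa [add_mul, mul_assoc, div_mul_cancel₀ _ hv0] using this
    simp only [hcoeff]
    constructor
    · refine (hpull A (u / v)).trans ?_
      rw [← map_mul, ← map_add, ← map_mul, ← map_add, ← map_div₀, smul_div₀', h.inv_smul_fst,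
        h.inv_smul_snd]
      congr 1
      field_simp
    · refine (hpull A (1 / v)).trans ?_
      rw [← map_mul, ← map_add, ← map_div₀, smul_div₀', h.inv_smul_snd, smul_one]
      congr 1
      field_simp

end StandardModel

open HomogeneousLocalization

theorem aeval_mul_of_isHomogeneous {σ R S : Type*} [CommRing R] [CommRing S] [Algebra R S]
    {f : MvPolynomial σ R} {n : ℕ} (hf : f.IsHomogeneous n) (r : S) (y : σ → S) :
    MvPolynomial.aeval (fun l => r * y l) f = r ^ n * MvPolynomial.aeval y f := by
  rw [MvPolynomial.aeval_def, MvPolynomial.aeval_def, MvPolynomial.eval₂_eq, MvPolynomial.eval₂_eq,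
    Finset.mul_sum]
  refine Finset.sum_congr rfl fun d hd => ?_
  have hdn : ∑ l ∈ d.support, d l = n := by
    have := hf (MvPolynomial.mem_support_iff.1 hd)
    exact (DFunLike.congr_fun Finsupp.degree_eq_weight_one d).trans this
  simp only [mul_pow, Finset.prod_mul_distrib]
  rw [Finset.prod_pow_eq_pow_sum, hdn]
  ring

theorem X_mem_homogeneousSubmodule {σ : Type*} (k : Type*) [CommSemiring k] (i : σ) :
    (MvPolynomial.X i : MvPolynomial σ k) ∈ MvPolynomial.homogeneousSubmodule σ k 1 :=
  MvPolynomial.isHomogeneous_X k i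

/-! ### Degree-zero fractions and their values -/

section HomogeneousLocalization

attribute [local instance] MvPolynomial.gradedAlgebra

variable {σ : Type*} {k K : Type u} [Field k] [Field K] [Algebra k K] (s : σ → K)

local notation "𝓗" => MvPolynomial.homogeneousSubmodule σ k

/-- The value at `s` of the homogeneous fractions with denominator a power of `f`. -/
noncomputable def evalAway (f : MvPolynomial σ k) (hf : MvPolynomial.aeval s f ≠ 0) :
    Away 𝓗 f →+* K :=
  (Localization.awayLift (MvPolynomial.aeval s).toRingHom f (IsUnit.mk0 _ hf)).comp
    (algebraMap (Away 𝓗 f) (Localization.Away f))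

variable {s}

theorem evalAway_mk {d : ℕ} {f : MvPolynomial σ k} (hf : MvPolynomial.aeval s f ≠ 0)
    (hfd : f ∈ 𝓗 d) (n : ℕ) (a : MvPolynomial σ k) (ha : a ∈ 𝓗 (n • d)) :
    evalAway s f hf (Away.mk 𝓗 hfd n a ha) =
      MvPolynomial.aeval s a / MvPolynomial.aeval s f ^ n := by
  change Localization.awayLift (MvPolynomial.aeval s).toRingHom f (IsUnit.mk0 _ hf)
    (Away.mk 𝓗 hfd n a ha).val = _
  rw [Away.val_mk, Localization.awayLift_mk (v := (MvPolynomial.aeval s f)⁻¹)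
    (hv := mul_inv_cancel₀ hf), inv_pow, div_eq_mul_inv]
  rfl

theorem evalAway_fromZeroRingHom {f : MvPolynomial σ k} (hf : MvPolynomial.aeval s f ≠ 0) (r : k) :
    evalAway s f hf (fromZeroRingHom 𝓗 _ (algebraMap k (𝓗 0) r)) = algebraMap k K r := by
  change Localization.awayLift (MvPolynomial.aeval s).toRingHom f (IsUnit.mk0 _ hf)
    (algebraMap _ _ (algebraMap k (MvPolynomial σ k) r)) = _
  rw [Localization.awayLift, IsLocalization.Away.lift_eq]
  exact (MvPolynomial.aeval s).commutes r

theorem evalAway_comp_awayMap {d e : ℕ} {f g x : MvPolynomial σ k} (hfd : f ∈ 𝓗 d) (hge : g ∈ 𝓗 e)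
    (hx : x = f * g) (hf : MvPolynomial.aeval s f ≠ 0) (hxs : MvPolynomial.aeval s x ≠ 0) :
    (evalAway s x hxs).comp (awayMap 𝓗 hge hx) = evalAway s f hf := by
  ext a
  obtain ⟨n, a, ha, rfl⟩ := Away.mk_surjective 𝓗 hfd a
  have hg : MvPolynomial.aeval s g ≠ 0 := by
    rintro h0
    rw [hx, map_mul, h0, mul_zero] at hxs
    exact hxs rfl
  rw [RingHom.comp_apply, awayMap_mk, evalAway_mk, evalAway_mk]
  subst hx
  rw [map_mul, map_mul, map_pow, mul_pow, mul_div_mul_right _ _ (pow_ne_zero _ hg)]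

theorem comp_evalAway (g : K →+* K) (hgk : ∀ r, g (algebraMap k K r) = algebraMap k K r)
    (hgs : ∀ i, g (s i) = s i) (f : MvPolynomial σ k) (hf : MvPolynomial.aeval s f ≠ 0) :
    g.comp (evalAway s f hf) = evalAway s f hf := by
  have h1 : g.comp (MvPolynomial.aeval (R := k) s).toRingHom = (MvPolynomial.aeval s).toRingHom :=
    MvPolynomial.ringHom_ext (by simp [hgk, MvPolynomial.algHom_C]) (by simp [hgs])
  rw [evalAway, ← RingHom.comp_assoc]
  congr 1
  refine IsLocalization.ringHom_ext (Submonoid.powers f) ?_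
  rw [RingHom.comp_assoc, Localization.awayLift, IsLocalization.Away.lift_comp, h1]

/-- Dehomogenization: for f homogeneous of degree n, f / X_i^n is f evaluated at the quotients X_l /
X_i, which are 1 and a single coordinate when there are two variables. -/
theorem exists_eval₂_eq_away (i j : σ) (hij : ∀ l, l = i ∨ l = j)
    (a : Away 𝓗 (MvPolynomial.X i : MvPolynomial σ k)) :
    ∃ q : Polynomial k, a = q.eval₂ ((fromZeroRingHom 𝓗 _).comp (algebraMap k (𝓗 0)))
      (Away.isLocalizationElem (𝒜 := 𝓗) (X_mem_homogeneousSubmodule k i)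
        (X_mem_homogeneousSubmodule k j)) := by
  classical
  obtain ⟨n, f, hf, rfl⟩ := Away.mk_surjective 𝓗 (X_mem_homogeneousSubmodule k i) a
  let L := Localization.Away (MvPolynomial.X i : MvPolynomial σ k)
  have hinj : Function.Injective (algebraMap (Away 𝓗 (MvPolynomial.X i : MvPolynomial σ k)) L) :=
    val_injective _
  let x (l : σ) : L := algebraMap _ _ (MvPolynomial.X (R := k) l)
  let m : Submonoid.powers (MvPolynomial.X i : MvPolynomial σ k) :=
    ⟨MvPolynomial.X i, Submonoid.mem_powers _⟩
  let w : L := Localization.mk 1 m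
  have hw : x i * w = 1 := by
    change algebraMap _ _ _ * _ = _
    rw [← Algebra.smul_def, Localization.smul_mk]
    exact (congrArg (Localization.mk · m) (mul_one _)).trans (Localization.mk_self m)
  let y (l : σ) : L := w * x l
  let q : Polynomial k := MvPolynomial.aeval (fun l => if l = i then 1 else Polynomial.X) f
  refine ⟨q, hinj ?_⟩
  rw [Polynomial.hom_eval₂]
  have h1 : (algebraMap (Away 𝓗 (MvPolynomial.X i : MvPolynomial σ k)) L).comp
      ((fromZeroRingHom 𝓗 _).comp (algebraMap k (𝓗 0))) = algebraMap k L := rfl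
  have h2 : algebraMap (Away 𝓗 (MvPolynomial.X i : MvPolynomial σ k)) L
      (Away.isLocalizationElem (𝒜 := 𝓗) (X_mem_homogeneousSubmodule k i)
        (X_mem_homogeneousSubmodule k j)) = y j := by
    refine (Away.val_mk 𝓗 1 (X_mem_homogeneousSubmodule k i) _ _).trans ?_
    change _ = Localization.mk 1 m * Localization.mk _ 1
    rw [Localization.mk_mul]
    exact congrArg₂ Localization.mk (by simp) (Subtype.ext (by simp [m]))
  rw [h1, h2]
  have h3 : (Polynomial.aeval (R := k) (y j)).comp
      (MvPolynomial.aeval fun l => if l = i then 1 else Polynomial.X) = MvPolynomial.aeval y := by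
    refine MvPolynomial.algHom_ext fun l => ?_
    rw [AlgHom.comp_apply, MvPolynomial.aeval_X, MvPolynomial.aeval_X]
    split_ifs with hl
    · rw [map_one, hl, ← hw, mul_comm]
    · rw [Polynomial.aeval_X, (hij l).resolve_left hl]
  have hf' : f.IsHomogeneous n := by simpa using hf
  have h4 : MvPolynomial.aeval x f = (algebraMap (MvPolynomial σ k) L f) :=
    congrArg (fun m : MvPolynomial σ k →ₐ[k] L => m f)
      (MvPolynomial.aeval_unique (IsScalarTower.toAlgHom k (MvPolynomial σ k) L)).symm
  have h5 : Polynomial.eval₂ (algebraMap k L) (y j) q = MvPolynomial.aeval y f :=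
    DFunLike.congr_fun h3 f
  rw [h5, aeval_mul_of_isHomogeneous hf', h4]
  refine (Away.val_mk 𝓗 n (X_mem_homogeneousSubmodule k i) _ _).trans ?_
  change _ = Localization.mk 1 m ^ n * Localization.mk _ 1
  rw [Localization.mk_pow, Localization.mk_mul]
  exact congrArg₂ Localization.mk (by simp) (Subtype.ext (by simp [m]))

end HomogeneousLocalization

/-! ### The projective line, its two charts and the point [t : 1] -/

section Coordinates

attribute [local instance] MvPolynomial.gradedAlgebra

variable (k : Type u) [Field k]

local notation "𝓗" => MvPolynomial.homogeneousSubmodule (Fin 2) k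

/-- The standard affine open subset of the projective line on which the `i`-th coordinate does not
vanish. -/
noncomputable def P1.chart (i : Fin 2) : (P1 k).Opens :=
  Proj.basicOpen 𝓗 (MvPolynomial.X i)

/-- The affine coordinate on a standard chart of the projective line. -/
noncomputable def P1.coord (i : Fin 2) : Γ(P1 k, P1.chart k i) :=
  Proj.awayToSection 𝓗 _ (Away.isLocalizationElem (𝒜 := 𝓗) (X_mem_homogeneousSubmodule k i)
        (X_mem_homogeneousSubmodule k (i + 1)))

theorem P1.isAffineOpen_chart (i : Fin 2) : IsAffineOpen (P1.chart k i) :=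
  Proj.isAffineOpen_basicOpen 𝓗 _ (X_mem_homogeneousSubmodule k i) one_pos

theorem P1.infty_mem_chart : P1.infty k ∈ P1.chart k 0 := by
  change MvPolynomial.X 0 ∉ Ideal.span {MvPolynomial.X 1}
  rw [Ideal.mem_span_singleton, MvPolynomial.X_dvd_X]
  simp

theorem P1.infty_notMem_chart : P1.infty k ∉ P1.chart k 1 :=
  fun h => h (Ideal.mem_span_singleton_self _)

theorem P1.mem_chart_zero {x : P1 k} (hx : x ∉ P1.chart k 1) : x ∈ P1.chart k 0 := by
  have h : ⨆ i, P1.chart k i = ⊤ := by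
    refine Proj.iSup_basicOpen_eq_top' 𝓗 MvPolynomial.X
      (fun i => ⟨1, X_mem_homogeneousSubmodule k i⟩) ?_
    rw [eq_top_iff]
    intro f _
    have hf : f ∈ Algebra.adjoin k (Set.range MvPolynomial.X) := by
      rw [MvPolynomial.adjoin_range_X]
      trivial
    induction hf using Algebra.adjoin_induction with
    | mem x hx => exact Algebra.subset_adjoin hx
    | algebraMap r => exact Subalgebra.algebraMap_mem _ (algebraMap k (𝓗 0) r)
    | add x y _ _ h1 h2 => exact add_mem (h1 trivial) (h2 trivial)
    | mul x y _ _ h1 h2 => exact mul_mem (h1 trivial) (h2 trivial)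
  obtain ⟨i, hi⟩ := TopologicalSpace.Opens.mem_iSup.1 (h.ge (Set.mem_univ x))
  fin_cases i
  · exact hi
  · exact absurd hi hx

theorem ι_appLE_self {X : Scheme.{u}} (U : X.Opens) (h : ⊤ ≤ U.ι ⁻¹ᵁ U) :
    U.ι.appLE U ⊤ h = U.topIso.inv := by
  exact (U.ι_appLE U ⊤ h).trans (congrArg X.presheaf.map rfl)

theorem evalPoint_awayι {d : ℕ} {f : MvPolynomial (Fin 2) k} (hf : f ∈ 𝓗 d) (hd : 0 < d)
    (h : ⊤ ≤ Proj.awayι 𝓗 f hf hd ⁻¹ᵁ Proj.basicOpen 𝓗 f) (a : Away 𝓗 f) :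
    evalPoint (Proj.awayι 𝓗 f hf hd) h (Proj.awayToSection 𝓗 f a) = a := by
  have h1 : Proj.basicOpenToSpec 𝓗 f ≫ Proj.awayι 𝓗 f hf hd = (Proj.basicOpen 𝓗 f).ι := by
    rw [← Proj.basicOpenIsoSpec_inv_ι, ← Proj.basicOpenIsoSpec_hom 𝓗 f hf hd,
      Iso.hom_inv_id_assoc]
  have h2 : (Proj.awayι 𝓗 f hf hd).appLE _ ⊤ h ≫ (Proj.basicOpenToSpec 𝓗 f).app ⊤ =
      (Proj.basicOpen 𝓗 f).topIso.inv := by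
    rw [← Scheme.Hom.appLE_eq_app]
    refine (Scheme.Hom.appLE_comp_appLE ..).trans ?_
    simp only [h1]
    exact ι_appLE_self _ _
  have h3 : ((Proj.awayι 𝓗 f hf hd).appLE _ ⊤ h ≫ (Scheme.ΓSpecIso _).hom) ≫
      Proj.awayToSection 𝓗 f = 𝟙 _ := by
    have h5 := congrArg (· ≫ (Proj.basicOpen 𝓗 f).topIso.hom) h2
    refine Eq.trans ?_ (h5.trans (Iso.inv_hom_id _))
    have h6 := Proj.basicOpenToSpec_app_top 𝓗 f
    refine Eq.trans ?_ (Category.assoc _ _ _).symm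
    refine (Category.assoc _ _ _).trans (congrArg _ ?_)
    refine Eq.symm ((congrArg (· ≫ (Proj.basicOpen 𝓗 f).topIso.hom) h6).trans ?_)
    exact (Category.assoc _ _ _).trans (congrArg _ ((Category.assoc _ _ _).trans
      ((congrArg _ (Iso.inv_hom_id _)).trans (Category.comp_id _))))
  have : IsIso (Proj.awayToSection 𝓗 f) := by
    rw [← Proj.basicOpenIsoAway_hom 𝓗 f hf hd]
    infer_instance
  have h4 : Proj.awayToSection 𝓗 f ≫ ((Proj.awayι 𝓗 f hf hd).appLE _ ⊤ h ≫ (Scheme.ΓSpecIso _).hom)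
      = 𝟙 _ := by
    rw [← cancel_mono (Proj.awayToSection 𝓗 f), Category.assoc, h3, Category.comp_id,
      Category.id_comp]
  exact congrArg (fun m => m.hom a) h4

variable {k} {K : Type u} [Field K] [Algebra k K]

/-- Both morphisms factor through the open subset where f g is invertible. Thus a point may be
described in any chart containing it. -/
theorem specMap_evalAway_awayι_eq {s : Fin 2 → K} {d e : ℕ} {f g : MvPolynomial (Fin 2) k}
    (hfd : f ∈ 𝓗 d) (hge : g ∈ 𝓗 e) (hd : 0 < d) (he : 0 < e) (hf : MvPolynomial.aeval s f ≠ 0)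
    (hg : MvPolynomial.aeval s g ≠ 0) :
    Spec.map (CommRingCat.ofHom (evalAway s f hf)) ≫ Proj.awayι 𝓗 f hfd hd =
      Spec.map (CommRingCat.ofHom (evalAway s g hg)) ≫ Proj.awayι 𝓗 g hge he := by
  have hfg : MvPolynomial.aeval s (f * g) ≠ 0 := by
    rw [map_mul]
    exact mul_ne_zero hf hg
  have h1 := Proj.SpecMap_awayMap_awayι 𝓗 hfd hd hge rfl
  have h2 := Proj.SpecMap_awayMap_awayι 𝓗 hge he hfd (mul_comm f g)
  rw [← evalAway_comp_awayMap hfd hge rfl hf hfg,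
    ← evalAway_comp_awayMap hge hfd (mul_comm f g) hg hfg, CommRingCat.ofHom_comp,
    CommRingCat.ofHom_comp, Spec.map_comp, Spec.map_comp, Category.assoc,
    Category.assoc, h1, h2]
  rfl

variable (k) (t : K)

theorem aeval_X_ne_zero (ht : t ≠ 0) (i : Fin 2) :
    MvPolynomial.aeval ![t, 1] (MvPolynomial.X i : MvPolynomial (Fin 2) k) ≠ 0 := by
  rw [MvPolynomial.aeval_X]
  fin_cases i
  · exact ht
  · exact one_ne_zero

/-- The point `[t : 1]` of the projective line. -/
noncomputable def P1.point (ht : t ≠ 0) : Spec (.of K) ⟶ P1 k :=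
  Spec.map (CommRingCat.ofHom (evalAway ![t, 1] (MvPolynomial.X 1) (aeval_X_ne_zero k t ht 1))) ≫
    Proj.awayι 𝓗 _ (X_mem_homogeneousSubmodule k 1) one_pos

variable (ht : t ≠ 0)

theorem P1.point_eq (i : Fin 2) : P1.point k t ht =
    Spec.map (CommRingCat.ofHom (evalAway ![t, 1] (MvPolynomial.X i) (aeval_X_ne_zero k t ht i))) ≫
      Proj.awayι 𝓗 _ (X_mem_homogeneousSubmodule k i) one_pos :=
  specMap_evalAway_awayι_eq ..

theorem P1.specMap_comp_point (g : K →+* K) (hgk : ∀ r, g (algebraMap k K r) = algebraMap k K r)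
    (hgt : g t = t) : Spec.map (CommRingCat.ofHom g) ≫ P1.point k t ht = P1.point k t ht := by
  rw [P1.point, ← Category.assoc, ← Spec.map_comp, ← CommRingCat.ofHom_comp, comp_evalAway g hgk]
  intro i
  fin_cases i
  · exact hgt
  · exact map_one g

theorem P1.point_toSpec : P1.point k t ht ≫ P1.toSpec k =
    Spec.map (CommRingCat.ofHom (algebraMap k K)) := by
  rw [P1.point, P1.toSpec, Category.assoc, Proj.awayι_toSpecZero_assoc, ← Spec.map_comp,
    ← Spec.map_comp, ← CommRingCat.ofHom_comp, ← CommRingCat.ofHom_comp]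
  congr 2
  ext r
  exact evalAway_fromZeroRingHom (aeval_X_ne_zero k t ht 1) r

theorem P1.top_le_awayι_preimage (i : Fin 2) :
    ⊤ ≤ Proj.awayι 𝓗 _ (X_mem_homogeneousSubmodule k i) one_pos ⁻¹ᵁ P1.chart k i := by
  rintro z -
  have := Set.mem_range_self (f := Proj.awayι 𝓗 _ (X_mem_homogeneousSubmodule k i) one_pos) z
  rw [← Scheme.Hom.coe_opensRange, Proj.opensRange_awayι] at this
  exact this

theorem P1.top_le_point_preimage (i : Fin 2) : ⊤ ≤ P1.point k t ht ⁻¹ᵁ P1.chart k i := by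
  rw [P1.point_eq, Scheme.Hom.comp_preimage, top_le_iff.1 (P1.top_le_awayι_preimage k i)]
  exact le_rfl

theorem P1.evalPoint_awayι_coord (i : Fin 2) :
    evalPoint (Proj.awayι 𝓗 _ (X_mem_homogeneousSubmodule k i) one_pos)
      (P1.top_le_awayι_preimage k i) (P1.coord k i) =
      Away.isLocalizationElem (𝒜 := 𝓗) (X_mem_homogeneousSubmodule k i)
        (X_mem_homogeneousSubmodule k (i + 1)) :=
  evalPoint_awayι ..

theorem P1.evalPoint_coord (i : Fin 2) :
    evalPoint (P1.point k t ht) (P1.top_le_point_preimage k t ht i) (P1.coord k i) =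
      ![t⁻¹, t] i := by
  have h (f) (hf : f = Spec.map (CommRingCat.ofHom (evalAway ![t, 1] (MvPolynomial.X i)
      (aeval_X_ne_zero k t ht i))) ≫
      Proj.awayι 𝓗 _ (X_mem_homogeneousSubmodule k i) one_pos) (hle : ⊤ ≤ f ⁻¹ᵁ P1.chart k i) :
      evalPoint f hle (P1.coord k i) = ![t⁻¹, t] i := by
    subst hf
    rw [evalPoint_SpecMap_comp _ _ (P1.top_le_awayι_preimage k i), P1.evalPoint_awayι_coord]
    refine (evalAway_mk ..).trans ?_
    fin_cases i <;> simp
  exact h _ (P1.point_eq k t ht i) _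

theorem P1.exists_eval₂_coord (i : Fin 2) (a : Γ(P1 k, P1.chart k i)) :
    ∃ q : Polynomial k, a = q.eval₂ (constSections (P1.toSpec k) (P1.chart k i))
      (P1.coord k i) := by
  have hbij : Function.Bijective
      (Proj.awayToSection 𝓗 (MvPolynomial.X i : MvPolynomial (Fin 2) k)) := by
    have := (Proj.basicOpenIsoAway 𝓗 _ (X_mem_homogeneousSubmodule k i)
      one_pos).commRingCatIsoToRingEquiv.bijective
    exact this
  obtain ⟨b, rfl⟩ := hbij.surjective a
  obtain ⟨q, hq⟩ := exists_eval₂_eq_away i (i + 1)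
    (fun l => by clear hbij; fin_cases i <;> fin_cases l <;> simp) b
  refine ⟨q, ?_⟩
  conv_lhs => rw [hq]
  refine (Polynomial.hom_eval₂ q _
    (Proj.awayToSection 𝓗 (MvPolynomial.X i : MvPolynomial (Fin 2) k)).hom _).trans ?_
  congr 1
  refine RingHom.ext fun r => ?_
  obtain ⟨b, hb⟩ := hbij.surjective (constSections (P1.toSpec k) (P1.chart k i) r)
  have h1 := evalPoint_constSections (P1.toSpec k)
    (Proj.awayι 𝓗 _ (X_mem_homogeneousSubmodule k i) one_pos) (P1.top_le_awayι_preimage k i)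
    ((fromZeroRingHom 𝓗 _).comp (algebraMap k (𝓗 0))) (by
      rw [P1.toSpec, Proj.awayι_toSpecZero_assoc, ← Spec.map_comp, ← CommRingCat.ofHom_comp]) r
  refine Eq.trans (congrArg (Proj.awayToSection 𝓗 (MvPolynomial.X i : MvPolynomial (Fin 2) k))
    (h1.symm.trans ?_)) hb
  rw [← hb]
  exact evalPoint_awayι ..

theorem mem_primeIdealOf_Spec {R : Type u} [CommRing R] (z : Spec (.of R))
    (c : Γ(Spec (.of R), ⊤)) :
    c ∈ ((isAffineOpen_top (Spec (.of R))).primeIdealOf ⟨z, TopologicalSpace.Opens.mem_top z⟩).asIdeal ↔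
      z ∉ PrimeSpectrum.basicOpen ((Scheme.ΓSpecIso (.of R)).hom c) := by
  rw [mem_primeIdealOf, IsLocalRing.mem_maximalIdeal, mem_nonunits_iff, not_iff_not,
    ← Scheme.mem_basicOpen _ _ z (TopologicalSpace.Opens.mem_top z), basicOpen_eq_of_affine']
  rfl

/-- Within chart i the other chart is the locus where the affine coordinate X_(i+1)/X_i is
invertible. -/
theorem P1.mem_chart_add_one_iff (i : Fin 2) {x : P1 k} (hx : x ∈ P1.chart k i) :
    x ∈ P1.chart k (i + 1) ↔
      P1.coord k i ∉ ((P1.isAffineOpen_chart k i).primeIdealOf ⟨x, hx⟩).asIdeal := by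
  have hx' := hx
  rw [P1.chart, ← Proj.opensRange_awayι 𝓗 _ (X_mem_homogeneousSubmodule k i) one_pos] at hx'
  obtain ⟨z, rfl⟩ := hx'
  rw [mem_primeIdealOf_map _ (P1.isAffineOpen_chart k i) (isAffineOpen_top _)
    (P1.top_le_awayι_preimage k i) (TopologicalSpace.Opens.mem_top z), mem_primeIdealOf_Spec,
    not_not]
  have h1 := Proj.awayι_preimage_basicOpen 𝓗 (X_mem_homogeneousSubmodule k i) one_pos
    (X_mem_homogeneousSubmodule k (i + 1)) one_pos
  rw [← P1.evalPoint_awayι_coord] at h1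
  exact (congrArg (z ∈ ·) h1).to_iff

end Coordinates

/-! ### Finite and étale morphisms from sections over affine opens -/

section Restrict

variable {X Y : Scheme.{u}} (f : Y ⟶ X) (U : X.Opens)

theorem morphismRestrict_appTop_of_app
    (P : ∀ {R S : Type u} [CommRing R] [CommRing S], (R →+* S) → Prop)
    (h : P (f.app U).hom) : P (f ∣_ U).appTop.hom := by
  have key (U' : X.Opens) (hU' : U' = U) (V' : Y.Opens) (hV' : V' = f ⁻¹ᵁ U) (e : V' ≤ f ⁻¹ᵁ U') :
      P (f.appLE U' V' e).hom := by
    subst hU' hV'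
    rwa [Scheme.Hom.appLE_eq_app]
  have := ((f ∣_ U).appLE_eq_app).symm.trans (morphismRestrict_appLE f U ⊤ ⊤ le_rfl)
  rw [Scheme.Hom.appTop, this]
  exact key _ U.ι_image_top _ (f ⁻¹ᵁ U).ι_image_top _

theorem etale_morphismRestrict {U : X.Opens} (hU : IsAffineOpen U) (hV : IsAffineOpen (f ⁻¹ᵁ U))
    (h : (f.app U).hom.Etale) : Etale (f ∣_ U) := by
  have : IsAffine U := hU
  have : IsAffine (f ⁻¹ᵁ U) := hV
  rw [HasRingHomProperty.iff_of_isAffine (P := @Etale)]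
  exact morphismRestrict_appTop_of_app f U RingHom.Etale h

theorem isFinite_of_iSup_eq_top {ι : Type*} (U : ι → X.Opens) (hU : ∀ i, IsAffineOpen (U i))
    (hV : ∀ i, IsAffineOpen (f ⁻¹ᵁ U i)) (hU' : ⨆ i, U i = ⊤)
    (h : ∀ i, (f.app (U i)).hom.Finite) : IsFinite f := by
  have h1 :=
    IsFinite.instHasAffinePropertyAndIsAffineFiniteCarrierObjOppositeOpensCarrierCarrierCommRingCatPresheafOpOpensTopHomAppTop.{u}
  exact (@HasAffineProperty.iff_of_iSup_eq_top _ _ h1 _ _ f _ (fun i => ⟨U i, hU i⟩) hU').2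
    fun i => ⟨hV i, morphismRestrict_appTop_of_app f (U i) RingHom.Finite (h i)⟩

/-- Lying over for an injective integral extension. -/
theorem exists_eq_of_finite {U : X.Opens} (hU : IsAffineOpen U) (hV : IsAffineOpen (f ⁻¹ᵁ U))
    (h : (f.app U).hom.Finite) (hinj : Function.Injective (f.app U)) {x : X} (hx : x ∈ U) :
    ∃ y, f y = x := by
  let _ := (f.app U).hom.toAlgebra
  have : Module.Finite Γ(X, U) Γ(Y, f ⁻¹ᵁ U) := h
  obtain ⟨Q, -, hQp, hQ⟩ := Ideal.exists_ideal_over_prime_of_isIntegral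
    (hU.primeIdealOf ⟨x, hx⟩).asIdeal (⊥ : Ideal Γ(Y, f ⁻¹ᵁ U)) (by
      intro a ha
      have : a = 0 := hinj ((Ideal.mem_bot.1 ha).trans (map_zero _).symm)
      exact this ▸ zero_mem _)
  obtain ⟨y, hy, rfl⟩ := primeIdealOf_surjective hV Q
  refine ⟨y, primeIdealOf_injective hU hy hx (Ideal.ext fun a => ?_)⟩
  rw [mem_primeIdealOf_map f hU hV le_rfl hy hy, ← hQ, Scheme.Hom.appLE_eq_app]
  rfl

end Restrict

theorem isDiscreteValuationRing_stalk {Y : Scheme.{u}} {V : Y.Opens} (hV : IsAffineOpen V)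
    [IsDedekindDomain Γ(Y, V)] (hfield : ¬ IsField Γ(Y, V)) {y : Y} (hy : y ∈ V)
    (hc : IsClosed {y}) :
    ∃ _ : IsDomain (Y.presheaf.stalk y), IsDiscreteValuationRing (Y.presheaf.stalk y) := by
  let _ : Algebra Γ(Y, V) (Y.presheaf.stalk y) := (Y.presheaf.germ V y hy).hom.toAlgebra
  set P := (hV.primeIdealOf ⟨y, hy⟩).asIdeal
  have : IsLocalization.AtPrime (Y.presheaf.stalk y) P := hV.isLocalization_stalk ⟨y, hy⟩
  have := isMaximal_primeIdealOf hV hy hc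
  have hP : P ≠ ⊥ := Ring.ne_bot_of_isMaximal_of_not_isField this hfield
  have : IsDomain (Y.presheaf.stalk y) :=
    IsLocalization.isDomain_of_le_nonZeroDivisors _ P.primeCompl_le_nonZeroDivisors
  exact ⟨this, IsLocalization.AtPrime.isDiscreteValuationRing_of_dedekind_domain Γ(Y, V) hP _⟩

/-! ### Group action on the fibres -/

section Galois

variable {X : Scheme.{u}} {Y : Over X} {G : Type v} [Group G] (ρ : G →* Aut Y) {U : X.Opens}
  (hU : IsAffineOpen U) (hV : IsAffineOpen (Y.hom ⁻¹ᵁ U))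

include hU hV

open scoped Pointwise in
-- A finite group acts transitively on the primes above a given prime of its ring of invariants.
theorem exists_act_eq [Finite G]
    (hG : letI := (Y.hom.app U).hom.toAlgebra
      letI := sectionsAction ρ (preimage_le_act_preimage ρ U)
      IsGaloisGroup G Γ(X, U) Γ(Y.left, Y.hom ⁻¹ᵁ U)) {y y' : Y.left} (hy : Y.hom y ∈ U)
    (h : Y.hom y = Y.hom y') : ∃ g, act ρ g y = y' := by
  let _ := (Y.hom.app U).hom.toAlgebra
  let _ := sectionsAction ρ (preimage_le_act_preimage ρ U)
  have hy' : Y.hom y' ∈ U := h ▸ hy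
  set P := (hV.primeIdealOf ⟨y, hy⟩).asIdeal with hP
  set P' := (hV.primeIdealOf ⟨y', hy'⟩).asIdeal with hP'
  have hunder {z : Y.left} (hz : Y.hom z ∈ U) :
      (hV.primeIdealOf ⟨z, hz⟩).asIdeal.under Γ(X, U) =
        (hU.primeIdealOf ⟨Y.hom z, hz⟩).asIdeal := by
    refine Ideal.ext fun a => ?_
    rw [mem_primeIdealOf_map Y.hom hU hV le_rfl hz hz, Scheme.Hom.appLE_eq_app]
    rfl
  have := hG.commutes
  have := hG.isInvariant
  obtain ⟨g, hg⟩ := Algebra.IsInvariant.exists_smul_of_under_eq Γ(X, U) Γ(Y.left, Y.hom ⁻¹ᵁ U) G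
    P P' ((hunder hy).trans (Eq.trans (by simp only [h]) (hunder hy').symm))
  have hgy : act ρ g y ∈ Y.hom ⁻¹ᵁ U := preimage_le_act_preimage ρ U g hy
  refine ⟨g, primeIdealOf_injective hV hgy hy' (Ideal.ext fun c => ?_)⟩
  rw [mem_primeIdealOf_act ρ (preimage_le_act_preimage ρ U) hV hy, ← hP', hg,
    Ideal.mem_pointwise_smul_iff_inv_smul_mem]
  change _ ↔ sectionsPullback ρ _ g⁻¹⁻¹ c ∈ P
  rw [inv_inv]

omit hU in
-- Every residue class at the point comes from a function on the base, which the group fixes; hence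
-- the stabilizer equals the inertia group.
theorem mem_inertiaGroup_of_act_eq
    (hG : letI := (Y.hom.app U).hom.toAlgebra
      letI := sectionsAction ρ (preimage_le_act_preimage ρ U)
      SMulCommClass G Γ(X, U) Γ(Y.left, Y.hom ⁻¹ᵁ U)) {y : Y.left} (hy : y ∈ Y.hom ⁻¹ᵁ U)
    (hc : IsClosed {y}) (hres : ∀ c, ∃ a, c - Y.hom.app U a ∈ (hV.primeIdealOf ⟨y, hy⟩).asIdeal)
    {g : G} (hg : act ρ g y = y) : g ∈ inertiaGroup ρ y := by
  have := isMaximal_primeIdealOf hV hy hc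
  rw [inertiaGroup, mem_ramificationGroup_iff ρ (preimage_le_act_preimage ρ U) hV hy, zero_add]
  intro c
  obtain ⟨a, ha⟩ := hres c
  have h1 : sectionsPullback ρ (preimage_le_act_preimage ρ U) g (Y.hom.app U a) =
      Y.hom.app U a := by
    let _ := (Y.hom.app U).hom.toAlgebra
    let _ := sectionsAction ρ (preimage_le_act_preimage ρ U)
    have := smul_algebraMap (A := Γ(Y.left, Y.hom ⁻¹ᵁ U)) g⁻¹ a
    change sectionsPullback ρ _ g⁻¹⁻¹ (Y.hom.app U a) = _ at this
    rwa [inv_inv] at this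
  have hgy : act ρ g y ∈ Y.hom ⁻¹ᵁ U := preimage_le_act_preimage ρ U g hy
  have h2 : c - Y.hom.app U a ∈ (hV.primeIdealOf ⟨act ρ g y, hgy⟩).asIdeal := by
    simpa only [hg] using ha
  rw [mem_primeIdealOf_act ρ (preimage_le_act_preimage ρ U) hV hy, map_sub, h1] at h2
  rw [pow_one]
  convert Ideal.sub_mem _ h2 ha using 1
  ring

end Galois

/-! ### Transfer of the ring-theoretic results to the cover -/

/-- The morphism `Y.hom` is the normalization of its target in the field of `j`, and the action
`ρ` extends the one on this field. -/
structure IsNormalizationIn {K : Type u} [Field K] {X : Scheme.{u}} (f : Spec (.of K) ⟶ X)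
    {Y : Over X} {G : Type v} [Group G] [MulSemiringAction G K] (ρ : G →* Aut Y)
    (j : Spec (.of K) ⟶ Y.left) : Prop where
  comp_hom : j ≫ Y.hom = f
  comp_act : ∀ g, j ≫ act ρ g =
    Spec.map (CommRingCat.ofHom (MulSemiringAction.toRingHom G K g⁻¹)) ≫ j
  isAffineHom : IsAffineHom Y.hom
  isIntegral : IsIntegral Y.left
  isIntegralClosure : ∀ (U : X.Opens) (_ : IsAffineOpen U) (hf : ⊤ ≤ f ⁻¹ᵁ U)
    (hj : ⊤ ≤ j ⁻¹ᵁ Y.hom ⁻¹ᵁ U),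
    letI := (Y.hom.app U).hom.toAlgebra
    letI := (evalPoint f hf).toAlgebra
    letI := (evalPoint j hj).toAlgebra
    IsIntegralClosure Γ(Y.left, Y.hom ⁻¹ᵁ U) Γ(X, U) K

theorem isNormalizationIn_normalizationAction {K : Type u} [Field K] {X : Scheme.{u}}
    (f : Spec (.of K) ⟶ X) [QuasiCompact f] [QuasiSeparated f] [IsIntegral f.normalization]
    {G : Type v} [Group G] [MulSemiringAction G K]
    (hf : ∀ g : G, Spec.map (CommRingCat.ofHom (MulSemiringAction.toRingHom G K g)) ≫ f = f) :
    IsNormalizationIn f (normalizationAction f hf) f.toNormalization where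
  comp_hom := f.toNormalization_fromNormalization
  comp_act := toNormalization_act_normalizationAction f hf
  isAffineHom := inferInstanceAs (IsAffineHom f.fromNormalization)
  isIntegral := inferInstanceAs (IsIntegral f.normalization)
  isIntegralClosure _ hU h _ := isIntegralClosure_normalization f hU h

section Chart

variable {k : Type u} [Field k] {p : ℕ} [Fact p.Prime] [CharP k p] {K : Type u} [Field K]
  [Algebra k K] [MulSemiringAction (Matrix.SpecialLinearGroup (Fin 2) (ZMod p)) K] {u v : K}

theorem IsDrinfeldField.dicksonInvariant_ne_zero [IsAlgClosed k] (h : IsDrinfeldField k p u v) :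
    dicksonInvariant p u v ≠ 0 :=
  fun h0 => h.transcendental_dicksonInvariant (h0 ▸ isAlgebraic_zero)

variable [IsAlgClosed k] (h : IsDrinfeldField k p u v) {Y : Over (P1 k)}
  {ρ : Matrix.SpecialLinearGroup (Fin 2) (ZMod p) →* Aut Y} {j : Spec (.of K) ⟶ Y.left}
  (hY : IsNormalizationIn (P1.point k (dicksonInvariant p u v) h.dicksonInvariant_ne_zero) ρ j)

/-- The ring of sections of the projective line over a standard chart, as an algebra over `k`. -/
noncomputable abbrev P1.algebraChart (k : Type u) [Field k] (i : Fin 2) :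
    Algebra k Γ(P1 k, P1.chart k i) :=
  (constSections (P1.toSpec k) (P1.chart k i)).toAlgebra

theorem P1.surjective_aeval_coord (k : Type u) [Field k] (i : Fin 2) :
    letI := P1.algebraChart k i
    Function.Surjective (Polynomial.aeval (R := k) (P1.coord k i)) := fun a =>
  have ⟨q, hq⟩ := P1.exists_eval₂_coord k i a
  ⟨q, hq.symm⟩

include hY in
theorem IsNormalizationIn.top_le_preimage (i : Fin 2) :
    ⊤ ≤ j ⁻¹ᵁ Y.hom ⁻¹ᵁ P1.chart k i := by
  rw [← Scheme.Hom.comp_preimage, hY.comp_hom]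
  exact P1.top_le_point_preimage k _ h.dicksonInvariant_ne_zero i

include h hY in
-- Gathers what the algebra gives on one chart, so that the geometry below only quotes its
-- components. Chart 1 is the affine line with coordinate t, chart 0 the neighbourhood of ∞ with
-- coordinate 1/t.
theorem IsNormalizationIn.chart (i : Fin 2) :
    letI := (Y.hom.app (P1.chart k i)).hom.toAlgebra
    letI := (evalPoint j (hY.top_le_preimage h i)).toAlgebra
    letI := sectionsAction ρ (preimage_le_act_preimage ρ (P1.chart k i))
    IsDedekindDomain Γ(Y.left, Y.hom ⁻¹ᵁ P1.chart k i) ∧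
      ¬ IsField Γ(Y.left, Y.hom ⁻¹ᵁ P1.chart k i) ∧
      (Y.hom.app (P1.chart k i)).hom.Finite ∧
      Function.Injective (Y.hom.app (P1.chart k i)) ∧
      IsFractionRing Γ(Y.left, Y.hom ⁻¹ᵁ P1.chart k i) K ∧
      IsGaloisGroup (Matrix.SpecialLinearGroup (Fin 2) (ZMod p)) Γ(P1 k, P1.chart k i)
        Γ(Y.left, Y.hom ⁻¹ᵁ P1.chart k i) ∧
      (∀ (P : Ideal Γ(Y.left, Y.hom ⁻¹ᵁ P1.chart k i)) [P.IsMaximal] (c),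
        ∃ a, c - Y.hom.app (P1.chart k i) a ∈ P) ∧
      (i = 1 → (Y.hom.app (P1.chart k i)).hom.Etale ∧
        ∀ (P : Ideal Γ(Y.left, Y.hom ⁻¹ᵁ P1.chart k i)) [P.IsPrime],
          P.inertia (Matrix.SpecialLinearGroup (Fin 2) (ZMod p)) = ⊥) ∧
      (i = 0 → ∀ (P : Ideal Γ(Y.left, Y.hom ⁻¹ᵁ P1.chart k i)) [P.IsPrime],
        Y.hom.app (P1.chart k i) (P1.coord k i) ∈ P → P.IsMaximal ∧
        Nat.card (P.inertia (Matrix.SpecialLinearGroup (Fin 2) (ZMod p))) = p * (p - 1) ∧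
        (P ^ (p + 2)).inertia (Matrix.SpecialLinearGroup (Fin 2) (ZMod p)) ≠ ⊥ ∧
        ∀ i, p + 1 < i →
          (P ^ (i + 1)).inertia (Matrix.SpecialLinearGroup (Fin 2) (ZMod p)) = ⊥) := by
  let _ := (Y.hom.app (P1.chart k i)).hom.toAlgebra
  let _ := (evalPoint j (hY.top_le_preimage h i)).toAlgebra
  let _ := (evalPoint (P1.point k (dicksonInvariant p u v) h.dicksonInvariant_ne_zero)
    (P1.top_le_point_preimage k _ h.dicksonInvariant_ne_zero i)).toAlgebra
  let _ := sectionsAction ρ (preimage_le_act_preimage ρ (P1.chart k i))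
  let _ := P1.algebraChart k i
  have hτ := P1.surjective_aeval_coord k i
  have hcoord : algebraMap Γ(P1 k, P1.chart k i) K (P1.coord k i) =
      ![(dicksonInvariant p u v)⁻¹, dicksonInvariant p u v] i :=
    P1.evalPoint_coord k _ h.dicksonInvariant_ne_zero i
  have : IsScalarTower Γ(P1 k, P1.chart k i) Γ(Y.left, Y.hom ⁻¹ᵁ P1.chart k i) K :=
    .of_algebraMap_eq fun a => by
      have := evalPoint_comp j Y.hom _ hY.comp_hom
        (P1.top_le_point_preimage k _ h.dicksonInvariant_ne_zero i) (hY.top_le_preimage h i)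
        le_rfl a
      rw [Scheme.Hom.appLE_eq_app] at this
      exact this.symm
  have : IsScalarTower k Γ(P1 k, P1.chart k i) K := .of_algebraMap_eq fun r =>
    (evalPoint_constSections (P1.toSpec k) _ _ (algebraMap k K)
      (P1.point_toSpec k _ h.dicksonInvariant_ne_zero) r).symm
  have : IsIntegralClosure Γ(Y.left, Y.hom ⁻¹ᵁ P1.chart k i) Γ(P1 k, P1.chart k i) K :=
    hY.isIntegralClosure _ (P1.isAffineOpen_chart k i) _ _
  have : SMulDistribClass (Matrix.SpecialLinearGroup (Fin 2) (ZMod p))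
      Γ(Y.left, Y.hom ⁻¹ᵁ P1.chart k i) K := by
    refine ⟨fun g c x => ?_⟩
    have h1 := evalPoint_sectionsPullback ρ j hY.comp_act
      (preimage_le_act_preimage ρ (P1.chart k i)) (hY.top_le_preimage h i) g⁻¹ c
    rw [inv_inv] at h1
    change g • (evalPoint j _ c * x) = evalPoint j _ (sectionsPullback ρ _ g⁻¹ c) * g • x
    rw [h1, smul_mul']
  have ht : algebraMap Γ(P1 k, P1.chart k i) K (P1.coord k i) = dicksonInvariant p u v ∨
      algebraMap Γ(P1 k, P1.chart k i) K (P1.coord k i) = (dicksonInvariant p u v)⁻¹ := by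
    rw [hcoord]
    fin_cases i
    · exact .inr rfl
    · exact .inl rfl
  obtain ⟨_, _, hfin, _, hfrac, hG⟩ := h.chart (C := Γ(Y.left, Y.hom ⁻¹ᵁ P1.chart k i)) hτ ht
  have htr : Transcendental k (algebraMap Γ(P1 k, P1.chart k i) K (P1.coord k i)) := by
    rcases ht with ht | ht <;> rw [ht]
    · exact h.transcendental_dicksonInvariant
    · rw [Transcendental, IsAlgebraic.inv_iff]
      exact h.transcendental_dicksonInvariant
  obtain ⟨hbij, hinjK⟩ := bijective_aeval_of_transcendental hτ htr
  have hinj : Function.Injective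
      (algebraMap Γ(P1 k, P1.chart k i) Γ(Y.left, Y.hom ⁻¹ᵁ P1.chart k i)) := by
    rw [IsScalarTower.algebraMap_eq _ Γ(Y.left, Y.hom ⁻¹ᵁ P1.chart k i) K] at hinjK
    exact Function.Injective.of_comp
      (f := algebraMap Γ(Y.left, Y.hom ⁻¹ᵁ P1.chart k i) K) hinjK
  refine ⟨inferInstance, fun hfield => ?_, hfin, hinj, hfrac, hG, fun P _ c => ?_, fun hi => ?_,
    fun hi P _ hP => ?_⟩
  · have h1 := isField_of_isIntegral_of_isField hinj hfield
    let e : Polynomial k ≃ₐ[k] Γ(P1 k, P1.chart k i) := AlgEquiv.ofBijective _ hbij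
    exact Polynomial.not_isField k (e.toMulEquiv.isField h1)
  · obtain ⟨r, hr⟩ := exists_sub_mem_of_isMaximal hτ P c
    exact ⟨_, hr⟩
  · subst hi
    have hE := h.etale (C := Γ(Y.left, Y.hom ⁻¹ᵁ P1.chart k 1)) hτ hcoord
    exact ⟨hE, fun P _ => h.inertia_eq_bot hcoord P⟩
  · subst hi
    have hP0 : P ≠ ⊥ := by
      rintro rfl
      have h0 : P1.coord k 0 = 0 := hinj ((Ideal.mem_bot.1 hP).trans (map_zero _).symm)
      rw [h0, map_zero] at hcoord
      exact inv_ne_zero h.dicksonInvariant_ne_zero hcoord.symm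
    exact ⟨Ideal.IsPrime.isMaximal inferInstance hP0, h.ramification_at_infinity hτ hcoord P hP⟩

end Chart

/-- Outside chart 1 the coordinate of chart 0 vanishes, and the prime of the point is then generated
by it; so there is only one such point. -/
theorem P1.eq_infty_iff {k : Type u} [Field k] (x : P1 k) :
    x = P1.infty k ↔ x ∉ P1.chart k 1 := by
  refine ⟨fun h => h ▸ P1.infty_notMem_chart k, fun hx => ?_⟩
  have hspan {x : P1 k} (hx : x ∉ P1.chart k 1) :
      ((P1.isAffineOpen_chart k 0).primeIdealOf ⟨x, P1.mem_chart_zero k hx⟩).asIdeal =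
        Ideal.span {P1.coord k 0} := by
    let _ := P1.algebraChart k 0
    refine under_eq_span_singleton (C := Γ(P1 k, P1.chart k 0)) (P1.surjective_aeval_coord k 0)
      ((P1.isAffineOpen_chart k 0).primeIdealOf ⟨x, P1.mem_chart_zero k hx⟩).asIdeal ?_
    by_contra h
    exact hx ((P1.mem_chart_add_one_iff k 0 (P1.mem_chart_zero k hx)).2 h)
  exact primeIdealOf_injective (P1.isAffineOpen_chart k 0) (P1.mem_chart_zero k hx)
    (P1.infty_mem_chart k) ((hspan hx).trans (hspan (P1.infty_notMem_chart k)).symm)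

theorem P1.isClosed_infty (k : Type u) [Field k] : IsClosed {P1.infty k} := by
  have : {P1.infty k} = (P1.chart k 1 : Set (P1 k))ᶜ := Set.ext P1.eq_infty_iff
  rw [this]
  exact (P1.chart k 1).isOpen.isClosed_compl

/-! ### The tail cover and its branch locus -/

section Cover

variable {k : Type u} [Field k] {p : ℕ} [Fact p.Prime] [CharP k p] {K : Type u} [Field K]
  [Algebra k K] [MulSemiringAction (Matrix.SpecialLinearGroup (Fin 2) (ZMod p)) K] {u v : K}
  [IsAlgClosed k] (h : IsDrinfeldField k p u v) {Y : Over (P1 k)}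
  {ρ : Matrix.SpecialLinearGroup (Fin 2) (ZMod p) →* Aut Y} {j : Spec (.of K) ⟶ Y.left}
  (hY : IsNormalizationIn (P1.point k (dicksonInvariant p u v) h.dicksonInvariant_ne_zero) ρ j)

include hY in
theorem IsNormalizationIn.isAffineOpen (i : Fin 2) : IsAffineOpen (Y.hom ⁻¹ᵁ P1.chart k i) :=
  have := hY.isAffineHom
  (P1.isAffineOpen_chart k i).preimage Y.hom

include hY in
theorem IsNormalizationIn.inertiaGroup_eq_bot {y : Y.left} (hy : Y.hom y ∈ P1.chart k 1)
    (hmax : ((hY.isAffineOpen h 1).primeIdealOf ⟨y, hy⟩).asIdeal.IsMaximal) :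
    inertiaGroup ρ y = ⊥ := by
  obtain ⟨-, -, -, -, -, -, -, hE, -⟩ := hY.chart h 1
  refine (ramificationGroup_eq_inertia ρ (preimage_le_act_preimage ρ _)
    (hY.isAffineOpen h 1) hy 0).trans ?_
  rw [zero_add, pow_one]
  exact (hE rfl).2 _

include hY in
theorem IsNormalizationIn.ramification_at_infinity {y : Y.left} (hy : Y.hom y = P1.infty k) :
    Nat.card (inertiaGroup ρ y) = p * (p - 1) ∧ IsConductorAt ρ y (p + 1) := by
  have hy0 : Y.hom y ∈ P1.chart k 0 := hy ▸ P1.infty_mem_chart k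
  obtain ⟨-, -, -, -, -, -, -, -, hR⟩ := hY.chart h 0
  have hcoord : Y.hom.app (P1.chart k 0) (P1.coord k 0) ∈
      ((hY.isAffineOpen h 0).primeIdealOf ⟨y, hy0⟩).asIdeal := by
    have := mem_primeIdealOf_map Y.hom (P1.isAffineOpen_chart k 0) (hY.isAffineOpen h 0) le_rfl
      hy0 hy0 (P1.coord k 0)
    rw [Scheme.Hom.appLE_eq_app] at this
    refine this.1 ?_
    by_contra h1
    refine P1.infty_notMem_chart k (hy ▸ ?_)
    exact (P1.mem_chart_add_one_iff k 0 hy0).2 h1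
  obtain ⟨hmax, h1, h2, h3⟩ := hR rfl _ hcoord
  have hram := ramificationGroup_eq_inertia ρ (preimage_le_act_preimage ρ _)
    (hY.isAffineOpen h 0) hy0
  refine ⟨?_, ?_, fun i hi => (hram i).trans (h3 i hi)⟩
  · rw [inertiaGroup, hram 0, zero_add, pow_one]
    exact h1
  · rw [hram]
    exact h2

include hY in
theorem IsNormalizationIn.surjective (x : P1 k) : ∃ y, Y.hom y = x := by
  have key (i : Fin 2) (hx : x ∈ P1.chart k i) : ∃ y, Y.hom y = x := by
    obtain ⟨-, -, hfin, hinj, -⟩ := hY.chart h i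
    exact exists_eq_of_finite Y.hom (P1.isAffineOpen_chart k i) (hY.isAffineOpen h i) hfin hinj hx
  by_cases hx : x ∈ P1.chart k 1
  · exact key 1 hx
  · exact key 0 (P1.mem_chart_zero k hx)

include hY in
theorem IsNormalizationIn.isGaloisCover : IsGaloisCover ρ where
  nonsingular y hy := by
    have key (i : Fin 2) (hi : Y.hom y ∈ P1.chart k i) :
        ∃ _ : IsDomain (Y.left.presheaf.stalk y),
          IsDiscreteValuationRing (Y.left.presheaf.stalk y) := by
      obtain ⟨_, hfield, -⟩ := hY.chart h i
      exact isDiscreteValuationRing_stalk (hY.isAffineOpen h i) hfield hi hy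
    by_cases hx : Y.hom y ∈ P1.chart k 1
    · exact key 1 hx
    · exact key 0 (P1.mem_chart_zero k hx)
  finite := by
    refine isFinite_of_iSup_eq_top Y.hom (P1.chart k) (P1.isAffineOpen_chart k)
      (hY.isAffineOpen h) (eq_top_iff.2 fun x _ => ?_) fun i => (hY.chart h i).2.2.1
    by_cases hx : x ∈ P1.chart k 1
    · exact TopologicalSpace.Opens.mem_iSup.2 ⟨1, hx⟩
    · exact TopologicalSpace.Opens.mem_iSup.2 ⟨0, P1.mem_chart_zero k hx⟩
  surjective := ⟨hY.surjective h⟩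
  torsor := by
    obtain ⟨-, -, -, -, -, hG, hres, hE, -⟩ := hY.chart h 1
    refine ⟨P1.chart k 1, ?_, etale_morphismRestrict Y.hom (P1.isAffineOpen_chart k 1)
      (hY.isAffineOpen h 1) (hE rfl).1, fun y y' hy hc hc' hyy' => ?_⟩
    · have := hY.isIntegral
      have : IrreducibleSpace (P1 k) := by
        rw [irreducibleSpace_def, Set.top_eq_univ, ← Set.range_eq_univ.2 (hY.surjective h),
          ← Set.image_univ]
        exact (IrreducibleSpace.isIrreducible_univ Y.left).image _ Y.hom.continuous.continuousOn
      refine (P1.chart k 1).isOpen.dense ⟨Y.hom (j (IsLocalRing.closedPoint K)), ?_⟩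
      exact hY.top_le_preimage h 1 (Set.mem_univ _)
    · obtain ⟨g, hg⟩ := exists_act_eq ρ (P1.isAffineOpen_chart k 1) (hY.isAffineOpen h 1) hG hy hyy'
      refine ⟨g, hg, fun g' hg' => ?_⟩
      -- Two elements with the same effect on y differ by an element of the stabilizer, which is the
      -- trivial inertia group.
      have h1 : act ρ (g⁻¹ * g') y = y := by
        rw [act_mul, Scheme.Hom.comp_apply, hg', ← hg, ← Scheme.Hom.comp_apply, ← act_mul,
          inv_mul_cancel, act_one]
        rfl
      have := isMaximal_primeIdealOf (hY.isAffineOpen h 1) hy hc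
      have h2 := mem_inertiaGroup_of_act_eq ρ (hY.isAffineOpen h 1) hG.commutes hy hc
        (hres _) h1
      rw [hY.inertiaGroup_eq_bot h hy this, Subgroup.mem_bot, inv_mul_eq_one] at h2
      exact h2.symm

include hY in
theorem IsNormalizationIn.branchLocus_eq : branchLocus ρ = {P1.infty k} := by
  have hp := (Fact.out : p.Prime).two_le
  refine Set.Subset.antisymm ?_ ?_
  · rintro x ⟨hx, y, rfl, hy⟩
    by_contra hne
    have hy1 : Y.hom y ∈ P1.chart k 1 := by
      by_contra h1
      exact hne ((P1.eq_infty_iff _).2 h1)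
    refine hy (hY.inertiaGroup_eq_bot h hy1 ?_)
    -- The branch locus only asks that x be closed; since the extension of sections is integral, the
    -- prime of y above x is maximal too.
    let _ := (Y.hom.app (P1.chart k 1)).hom.toAlgebra
    have : Module.Finite Γ(P1 k, P1.chart k 1) Γ(Y.left, Y.hom ⁻¹ᵁ P1.chart k 1) :=
      (hY.chart h 1).2.2.1
    refine Ideal.isMaximal_of_isIntegral_of_isMaximal_comap (R := Γ(P1 k, P1.chart k 1)) _ ?_
    have h1 := isMaximal_primeIdealOf (P1.isAffineOpen_chart k 1) hy1 hx
    convert h1 using 1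
    refine Ideal.ext fun a => ?_
    rw [mem_primeIdealOf_map Y.hom (P1.isAffineOpen_chart k 1) (hY.isAffineOpen h 1) le_rfl hy1 hy1,
      Scheme.Hom.appLE_eq_app]
    rfl
  · rintro _ rfl
    obtain ⟨y, hy⟩ := hY.surjective h (P1.infty k)
    refine ⟨P1.isClosed_infty k, y, hy, fun h0 => ?_⟩
    have := (hY.ramification_at_infinity h hy).1
    rw [h0, Subgroup.card_bot] at this
    nlinarith [Nat.sub_add_cancel (show 1 ≤ p by omega)]

include hY in
theorem IsNormalizationIn.isTailCover : IsTailCover p ρ where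
  isGaloisCover := hY.isGaloisCover h
  wild := ⟨p - 1,
    (Nat.coprime_self_sub_left (Fact.out : p.Prime).one_le).2 (Nat.coprime_one_left p),
    fun y hy => (hY.ramification_at_infinity h hy).1⟩
  tame y hc hy := by
    have hy1 : Y.hom y ∈ P1.chart k 1 := by
      by_contra h1
      exact hy ((P1.eq_infty_iff _).2 h1)
    rw [hY.inertiaGroup_eq_bot h hy1 (isMaximal_primeIdealOf (hY.isAffineOpen h 1) hy1 hc),
      Subgroup.card_bot]
    exact Nat.coprime_one_left p
  subsingleton := by
    rw [hY.branchLocus_eq h, sdiff_self]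
    exact Set.subsingleton_empty

end Cover

end TailCover

/-! ### The main theorem -/

open TailCover
theorem mainTheorem11 (k : Type u) [Field k] [IsAlgClosed k] (p : ℕ) [Fact p.Prime]
    [CharP k p] (hp : 2 < p) :
    ∃ (Y : Over (P1 k)) (ρ : Matrix.SpecialLinearGroup (Fin 2) (ZMod p) →* Aut Y),
      IsStandardModel p ρ ∧
      ConnectedSpace Y.left ∧
      IsTailCover p ρ ∧
      IsNew ρ ∧
      branchLocus ρ = {P1.infty k} ∧
      (∀ y : Y.left, Y.hom y = P1.infty k →
        Nat.card (inertiaGroup ρ y) = p * (p - 1)) ∧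
      HasRamificationInvariant p ρ (((p : ℚ) + 1) / ((p : ℚ) - 1)) := by
  obtain ⟨K, _, _, _, u, v, h⟩ := exists_isDrinfeldField k p
  have hf (g : Matrix.SpecialLinearGroup (Fin 2) (ZMod p)) :=
    P1.specMap_comp_point k _ h.dicksonInvariant_ne_zero
      (MulSemiringAction.toRingHom _ K g) (h.smul_const g) (h.smul_dicksonInvariant g)
  have hint : IsIntegral (P1.point k _ h.dicksonInvariant_ne_zero).normalization := inferInstance
  have hY := isNormalizationIn_normalizationAction _ hf
  -- From here on only the properties recorded in `IsNormalizationIn` matter, not the construction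
  -- of the action.
  generalize normalizationAction _ hf = ρ at hY
  have := hY.isIntegral
  refine ⟨_, ρ, ?_, ?_, hY.isTailCover h, ?_, hY.branchLocus_eq h,
    fun y hy => (hY.ramification_at_infinity h hy).1, p + 1, p - 1, ?_, ?_,
    fun y hy => hY.ramification_at_infinity h hy⟩
  · refine h.isStandardModel ρ _ ?_ hY.comp_act (hY.isAffineOpen h 1)
      (preimage_le_act_preimage ρ _) (hY.top_le_preimage h 1) (hY.chart h 1).2.2.2.2.1
    rw [← Category.assoc, hY.comp_hom]
    exact P1.point_toSpec k _ h.dicksonInvariant_ne_zero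
  · infer_instance
  -- A primitive cover has two branch points, while the branch locus here is a single point.
  · rw [IsNew, IsPrimitive, hY.branchLocus_eq h, Set.encard_singleton]
    norm_num
  · exact (Nat.coprime_self_sub_left (Fact.out : p.Prime).one_le).2 (Nat.coprime_one_left p)
  · rw [Nat.cast_sub (by omega)]
    push_cast
    rfl
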